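/- **Model.** Let $2\le K\le n$ be integers, $p,q\in(0,1)$ with $p>q$, and $\lambda=p-q$. Let $z_1,\dots,z_n$ be i.i.d. uniform on $\{1,\dots,K\}$ and, conditionally on $z$, let $Y^*_{ij}$ ($1\le i<j\le n$) be independent Bernoulli variables with parameter $q+\lambda\mathbf 1\{z_i=z_j\}$. Put $Y_{ij}=Y_{ji}=Y^*_{ij}-q$ for $i<j$ and $\bar q=q(1-q)$. **Templates.** Consider simple undirected graphs $G=(V,E)$ with $V=\{v_1,\dots,v_r\}$, $r\ge 2$, with $1\le |E|\le D$ and without isolated nodes, except possibly $v_1,v_2$. Two such graphs are equivalent if there is a graph isomorphism between them that maps $v_1$ to $v_1$ and $v_2$ to $v_2$. Let $\mathcal G_{\le D}$ contain exactly one graph of each equivalence class; its elements are called templates. For a template $G$ with $|V|\le n$, let $\Pi_V$ be the set of injections $\pi:V\to\{1,\dots,n\}$ with $\pi(v_1)=1$ and $\pi(v_2)=2$. For $\pi\in\Pi_V$ and a subgraph $H$ of $G$, let $P_{H,\pi}=\prod_{(v,v')\in E(H)}Y_{\pi(v)\pi(v')}$. With $G_1,\dots,G_c$ the connected components of $G$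 that contain at least one edge, set $$\overline P_G=\sum_{\pi\in\Pi_V}\prod_{l=1}^{c}\big(P_{G_l,\pi}-\mathbb E[P_{G_l,\pi}]\big),\qquad \mathbb V(G)=\frac{(n-2)!}{(n-|V|)!}\,|\mathrm{Aut}(G)|\,\mathbb E[P_{G,\pi}^2],\qquad \Psi_G=\frac{\overline P_G}{\sqrt{\mathbb V(G)}},$$ where $\mathrm{Aut}(G)$ is the group of automorphisms of $G$ that fix $v_1$ and $v_2$, and where $\mathbb E[P_{G,\pi}^2]$ does not depend on $\pi\in\Pi_V$. Let $\Gamma_{G_1,G_2}=\mathbb E[\Psi_{G_1}\Psi_{G_2}]$ be the Gram matrix, indexed by the templates of $\mathcal G_{\le D}$ with at most $n$ nodes (these are all the templates when $n\ge 2D+2$). **Edit distance.** A node matching of $G_1=(V_1,E_1)$ and $G_2=(V_2,E_2)$ is a set $M\subset V_1\times V_2$ of pairs in which no node of $V_1$ or of $V_2$ appears twice, and which matches $v_1$ with $v_1$ and $v_2$ with $v_2$. An edge of $G_1$ and an edge of $G_2$ are matched if their incident nodes are matched. The edit distance $d(G_1,G_2)$ is the minimum over $M$ of the number of edges of $G_1$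 not matched to an edge of $G_2$ plus the number of edges of $G_2$ not matched to an edge of $G_1$. **Proposition.** Let $c_s\ge 14$ be real, $D\ge 2$ an integer, $q\le 1/2$, $q+2\lambda\le 1$, and assume that $$\sup_{1\le r\le D}\left\{D^{8c_s r}\left[\left(\frac{\sqrt n}{K}\Big(\frac{\lambda}{\sqrt{\bar q}}\Big)^{r}\right)\wedge\left(\frac{\lambda^{r/2}}{\sqrt{K/n}}\right)\right]\right\}\le 1,$$ the supremum being over real $r$. Then, for all templates $G_1,G_2\in\mathcal G_{\le D}$ with at most $n$ nodes, $$\big|\Gamma_{G_1,G_2}-\mathbf 1\{G_1=G_2\}\big|\le 3D^{-c_s\,(d(G_1,G_2)\vee 1)},$$ and, in $\ell^2$ operator norm, $$\|\Gamma-\mathrm{Id}\|_{op}\le 6D^{-c_s/2}.$$ -/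

import Mathlib

noncomputable section

namespace SBM

/-! ### Templates -/

/-- A simple undirected graph `G = (V, E)` on a node set `V = {v₁, …, v_r}` with `r ≥ 2`.
The nodes are `0, …, r - 1`; the first two nodes `v₁`, `v₂` play a special role. -/
structure Template where
  /-- the number of nodes, `|V|` -/
  order : ℕ
  two_le : 2 ≤ order
  /-- the graph on the node set -/
  graph : SimpleGraph (Fin order)

instance : DecidableEq Template := Classical.decEq _

namespace Template

/-- The first distinguished node. -/
def v₁ (G : Template) : Fin G.order := ⟨0, lt_of_lt_of_le (by decide) G.two_le⟩

/-- The second distinguished node. -/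
def v₂ (G : Template) : Fin G.order := ⟨1, lt_of_lt_of_le (by decide) G.two_le⟩

open scoped Classical in
/-- The edge set `E`. -/
def edges (G : Template) : Finset (Sym2 (Fin G.order)) := G.graph.edgeFinset

/-- Two templates are equivalent if they are isomorphic through a graph isomorphism that maps
`v₁` to `v₁` and `v₂` to `v₂`. -/
def Equivalent (G H : Template) : Prop :=
  ∃ σ : G.graph ≃g H.graph, σ G.v₁ = H.v₁ ∧ σ G.v₂ = H.v₂

/-- `|Aut(G)|`: the number of automorphisms of `G` that fix `v₁` and `v₂`. -/
def autCard (G : Template) : ℕ :=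
  Nat.card {σ : G.graph ≃g G.graph // σ G.v₁ = G.v₁ ∧ σ G.v₂ = G.v₂}

/-- `G` has between `1` and `D` edges, and no isolated node except possibly `v₁` and `v₂`. -/
def Admissible (D : ℕ) (G : Template) : Prop :=
  (∀ v, v ≠ G.v₁ → v ≠ G.v₂ → ∃ w, G.graph.Adj v w) ∧ 1 ≤ G.edges.card ∧ G.edges.card ≤ D

/-- `𝒢` is a maximum collection of pairwise non-equivalent admissible templates, that is, it
contains exactly one member of every equivalence class of admissible templates. -/
def IsMaximumCollection (D : ℕ) (𝒢 : Finset Template) : Prop :=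
  (∀ G ∈ 𝒢, Admissible D G) ∧
  (∀ G ∈ 𝒢, ∀ H ∈ 𝒢, G.Equivalent H → G = H) ∧
  (∀ G, Admissible D G → ∃ H ∈ 𝒢, G.Equivalent H)

open scoped Classical in
/-- The edge set of a connected component of `G`. -/
def componentEdges (G : Template) (c : G.graph.ConnectedComponent) :
    Finset (Sym2 (Fin G.order)) :=
  {e ∈ G.edges | ∀ v ∈ e, G.graph.connectedComponentMk v = c}

open scoped Classical in
/-- The connected components of `G` that contain at least one edge. -/
def edgeComponents (G : Template) : Finset G.graph.ConnectedComponent :=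
  {c | (G.componentEdges c).Nonempty}

/-! ### Node matchings and edit distance -/

/-- A node matching of `G` and `H`: a set of pairs of nodes in which no node of `G` and no node of
`H` appears twice, and in which `v₁` is matched with `v₁` and `v₂` with `v₂` (as is the case for
the matching induced by any two labelings, which all send `v₁` to `1` and `v₂` to `2`). -/
def IsMatching (G H : Template) (M : Finset (Fin G.order × Fin H.order)) : Prop :=
  (∀ a ∈ M, ∀ b ∈ M, a.1 = b.1 ↔ a.2 = b.2) ∧ (G.v₁, H.v₁) ∈ M ∧ (G.v₂, H.v₂) ∈ M

/-- Two edges are matched by `M` if their incident nodes are matched. -/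
def EdgeMatched {G H : Template} (M : Finset (Fin G.order × Fin H.order))
    (e : Sym2 (Fin G.order)) (f : Sym2 (Fin H.order)) : Prop :=
  ∃ a ∈ M, ∃ b ∈ M, e = s(a.1, b.1) ∧ f = s(a.2, b.2)

open scoped Classical in
/-- `|E_Δ|`: the number of edges of the symmetric difference graph attached to the matching `M`,
i.e. the edges of `G` not matched to an edge of `H` and the edges of `H` not matched to an edge
of `G`. -/
def symmDiffCard (G H : Template) (M : Finset (Fin G.order × Fin H.order)) : ℕ :=
  (G.edges.filter fun e => ¬ ∃ f ∈ H.edges, EdgeMatched M e f).card +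
  (H.edges.filter fun f => ¬ ∃ e ∈ G.edges, EdgeMatched M e f).card

/-- The edit distance: the minimum of `|E_Δ|` over all node matchings. -/
def editDist (G H : Template) : ℕ :=
  sInf {k | ∃ M, IsMatching G H M ∧ symmDiffCard G H M = k}

end Template

/-! ### The stochastic block model -/

/-- Probability that `e = {i, j}` is an edge given the assignment `z`: `q + λ 1{z i = z j}`. -/
def edgeProb {n K : ℕ} (q lam : ℝ) (z : Fin n → Fin K) (e : Sym2 (Fin n)) : ℝ :=
  q + lam * (if (e.map z).IsDiag then 1 else 0)

/-- The unordered pairs `{i, j}`, `i ≠ j`, of the node set `{1, …, n}` (modelled as `Fin n`). -/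
def pairs (n : ℕ) : Finset (Sym2 (Fin n)) := {e | ¬ e.IsDiag}

/-- Expectation, under the stochastic block model with `n` nodes and `K` communities, of a function
`f` of the edge set `A` of the observed graph: the assignment `z` is uniform on
`{1, …, K}ⁿ` and, given `z`, each pair `e` belongs to `A` independently with
probability `edgeProb q lam z e`. -/
def expect (n K : ℕ) (q lam : ℝ) (f : Finset (Sym2 (Fin n)) → ℝ) : ℝ :=
  ∑ z : Fin n → Fin K, (1 / (K : ℝ)) ^ n *
    ∑ A ∈ (pairs n).powerset,
      (∏ e ∈ A, edgeProb q lam z e) * (∏ e ∈ pairs n \ A, (1 - edgeProb q lam z e)) * f A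

/-- The entry `Y_{ij} = Y*_{ij} - q` of the recentered adjacency matrix, for `e = {i, j}`. -/
def Y {n : ℕ} (q : ℝ) (A : Finset (Sym2 (Fin n))) (e : Sym2 (Fin n)) : ℝ :=
  (if e ∈ A then 1 else 0) - q

/-! ### The invariant polynomials -/

/-- `Π_V`: the injections `π : V → {1, …, n}` that send `v₁` to the first and `v₂` to the second
element. -/
def labelings (n : ℕ) (G : Template) : Finset (Fin G.order ↪ Fin n) :=
  {π | (π G.v₁ : ℕ) = 0 ∧ (π G.v₂ : ℕ) = 1}

/-- `∏_{(i,j) ∈ S} Y_{π(i), π(j)}` for a set `S` of edges. With `S` the edge set of `G` this is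
`P_{G,π}`; with `S` the edge set of a component `G_l` it is `P_{G_l,π}`. -/
def edgePoly {n m : ℕ} (q : ℝ) (S : Finset (Sym2 (Fin m))) (π : Fin m ↪ Fin n)
    (A : Finset (Sym2 (Fin n))) : ℝ :=
  ∏ e ∈ S, Y q A (e.map π)

/-- `P̄_{G,π} = ∏_l (P_{G_l,π} - 𝔼[P_{G_l,π}])`, over the connected components `G_l` of `G` with
at least one edge. -/
def corrected (n K : ℕ) (q lam : ℝ) (G : Template) (π : Fin G.order ↪ Fin n)
    (A : Finset (Sym2 (Fin n))) : ℝ :=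
  ∏ c ∈ G.edgeComponents, (edgePoly q (G.componentEdges c) π A -
    expect n K q lam (edgePoly q (G.componentEdges c) π))

/-- `𝕍(G) = (n-2)! / (n-|V|)! · |Aut(G)| · 𝔼[P_{G,π}²]`, for `|V| ≤ n`. The last factor does not
depend on the labeling; we take the one sending the `k`-th node of `V` to the `k`-th element of
`{1, …, n}`. -/
def varianceProxy (n K : ℕ) (q lam : ℝ) (G : Template) (h : G.order ≤ n) : ℝ :=
  ((n - 2).factorial : ℝ) / ((n - G.order).factorial : ℝ) * (G.autCard : ℝ) *
    expect n K q lam (fun A => edgePoly q G.edges (Fin.castLEEmb h) A ^ 2)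

/-- `Ψ_G = P̄_G / √𝕍(G)`, with `P̄_G = ∑_{π ∈ Π_V} P̄_{G,π}`, for `|V| ≤ n`. -/
def Psi (n K : ℕ) (q lam : ℝ) (G : Template) (h : G.order ≤ n)
    (A : Finset (Sym2 (Fin n))) : ℝ :=
  (∑ π ∈ labelings n G, corrected n K q lam G π A) / √(varianceProxy n K q lam G h)

/-- The Gram matrix `Γ_{G,H} = 𝔼[Ψ_G Ψ_H]`, indexed by the templates of the collection `𝒢` with at
most `n` nodes. -/
def gram (n K : ℕ) (q lam : ℝ) (𝒢 : Finset Template) :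
    Matrix {G : 𝒢 // G.1.order ≤ n} {G : 𝒢 // G.1.order ≤ n} ℝ :=
  fun G H => expect n K q lam (fun A => Psi n K q lam G.1.1 G.2 A * Psi n K q lam H.1.1 H.2 A)

/-- The signal condition
`sup_{1 ≤ r ≤ D} D^{8 c r} [ (√n / K) (λ / √q̄)^r ∧ λ^{r/2} / √(K/n) ] ≤ 1`, `q̄ = q (1 - q)`,
over real `r`. -/
def SignalCondition (n K D : ℕ) (q lam c : ℝ) : Prop :=
  ∀ r : ℝ, 1 ≤ r → r ≤ D →
    (D : ℝ) ^ (8 * c * r) *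
      min (√(n : ℝ) / (K : ℝ) * (lam / √(q * (1 - q))) ^ r)
        (lam ^ (r / 2) / √((K : ℝ) / (n : ℝ))) ≤ 1

end SBM

end

/-! Expanding Γ_{G,H} gives a normalised sum, over pairs of labelings (α, β), of correlations of
corrected monomials with image edge sets S and T. Given the assignment z, an edge of S ∩ T
contributes its second moment and an edge of the symmetric difference S Δ T contributes λ times the
indicator that its endpoints agree. The correlation must therefore decay with |S Δ T|, while the
number of pairs grows with the number of nodes matched on one side only. The signal condition makes
the decay win.

One pair. If a set of unmatched nodes is cut off from the other nodes, a centered factor makes the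
correlation vanish (`hangsOff_or_eq_zero`). Otherwise the set U of unmatched nodes hangs on the
rest, and averaging over their communities gains K^(-|U|) (`Ez_mul_xprod_le`). The result is
compared with the second moments of the two monomials, bounded below on each side by the noise level
q(1 - q) or by the signal level λ. This produces `gainNoise` or `gainSignal`, and the signal
condition at r = e / u makes one of them tiny (`signal_nat`). Unmatched edges without unmatched
nodes need separate care, with `dense_bound` when λ is large and n < K². The outcome is
`sq_Ez_crossMean_le`. Subtracting the means costs only 16^|S Δ T| (`abs_expect_corr_mul_corr_le`),
by a positive association inequality which comes from submultiplicativity of the index of subgroups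
of (ℤ/K)^n (`Ez_xprod_mul_le`).

Counting. Pairs are grouped by their shadow, which records how the nodes touched by S Δ T are
matched. A shadow with u₁ and u₂ unmatched nodes is realised by few pairs, up to automorphisms and a
power of n (`card_filter_shadow_le`). The geometric mean of the bounds seen from G and from H
produces √(n^(u₁+u₂)), which is exactly what the correlation bound compensates, and the
normalisation √(𝕍(G) 𝕍(H)). There are few shadows of a given size, so the nonempty ones sum to a
small quantity. The empty shadow exists only for equivalent templates and then contributes almost 1.

Norm. Few templates lie at a given edit distance from G (`sum_eps_pow_editDist_le`), so the row sums
of Γ - Id are small and Schur's test concludes. -/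

noncomputable section

namespace SBM

open Finset

variable {n K : ℕ}

/-! ### Averages over assignments -/

/-- The indicator that the two endpoints of `e` are in the same community. -/
def xi (z : Fin n → Fin K) (e : Sym2 (Fin n)) : ℝ := if (e.map z).IsDiag then 1 else 0

/-- The indicator that `z` is constant along all edges of `S`. -/
def xprod (S : Finset (Sym2 (Fin n))) (z : Fin n → Fin K) : ℝ := ∏ e ∈ S, xi z e

/-- The average over all assignments. -/
def Ez (f : (Fin n → Fin K) → ℝ) : ℝ := ∑ z, (1 / (K : ℝ)) ^ n * f z

theorem xi_nonneg (z : Fin n → Fin K) (e : Sym2 (Fin n)) : 0 ≤ xi z e := by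
  unfold xi; split_ifs <;> norm_num

theorem xi_le_one (z : Fin n → Fin K) (e : Sym2 (Fin n)) : xi z e ≤ 1 := by
  unfold xi; split_ifs <;> norm_num

theorem xprod_nonneg (S : Finset (Sym2 (Fin n))) (z : Fin n → Fin K) : 0 ≤ xprod S z :=
  prod_nonneg fun _ _ => xi_nonneg _ _

theorem xprod_eq_ite (S : Finset (Sym2 (Fin n))) (z : Fin n → Fin K) :
    xprod S z = if ∀ e ∈ S, (e.map z).IsDiag then 1 else 0 := by
  unfold xprod xi
  exact prod_ite_zero.trans (by simp)

theorem xprod_union (S T : Finset (Sym2 (Fin n))) (z : Fin n → Fin K) :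
    xprod (S ∪ T) z = xprod S z * xprod T z := by
  simp only [xprod_eq_ite]
  by_cases h₁ : ∀ e ∈ S, (e.map z).IsDiag <;> by_cases h₂ : ∀ e ∈ T, (e.map z).IsDiag
  · rw [if_pos h₁, if_pos h₂, if_pos]
    · simp
    · intro e he
      rcases mem_union.1 he with h | h
      exacts [h₁ e h, h₂ e h]
  all_goals
    rw [if_neg]
    · simp [h₁, h₂]
    · intro h
      simp_all

theorem Ez_mono {f g : (Fin n → Fin K) → ℝ} (h : ∀ z, f z ≤ g z) : Ez f ≤ Ez g :=
  sum_le_sum fun z _ => mul_le_mul_of_nonneg_left (h z) (by positivity)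

theorem Ez_nonneg {f : (Fin n → Fin K) → ℝ} (h : ∀ z, 0 ≤ f z) : 0 ≤ Ez f :=
  sum_nonneg fun z _ => mul_nonneg (by positivity) (h z)

theorem Ez_const_mul (c : ℝ) (f : (Fin n → Fin K) → ℝ) : Ez (fun z => c * f z) = c * Ez f := by
  unfold Ez
  rw [mul_sum]
  exact sum_congr rfl fun z _ => by ring

theorem Ez_add (f g : (Fin n → Fin K) → ℝ) : Ez (fun z => f z + g z) = Ez f + Ez g := by
  unfold Ez
  rw [← sum_add_distrib]
  exact sum_congr rfl fun z _ => by ring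

theorem Ez_one (hK : K ≠ 0) : Ez (fun _ : Fin n → Fin K => (1 : ℝ)) = 1 := by
  have : (K : ℝ) ≠ 0 := by exact_mod_cast hK
  simp [Ez, this]

/-! ### Positive association -/

/-- The subgroup of assignments that are constant along the edges of `S`. -/
def constSubgroup [NeZero K] (S : Finset (Sym2 (Fin n))) : AddSubgroup (Fin n → Fin K) where
  carrier := {z | ∀ i j, s(i, j) ∈ S → z i = z j}
  add_mem' := by
    intro a b ha hb i j h
    simp [ha i j h, hb i j h]
  zero_mem' := by intro i j _; rfl
  neg_mem' := by
    intro a ha i j h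
    simp [ha i j h]

theorem mem_constSubgroup_iff [NeZero K] (S : Finset (Sym2 (Fin n))) (z : Fin n → Fin K) :
    z ∈ constSubgroup S ↔ ∀ e ∈ S, (e.map z).IsDiag := by
  constructor
  · intro h e
    induction e with
    | _ i j => intro he; simpa using h i j he
  · intro h i j hij
    simpa using h _ hij

theorem Ez_xprod [NeZero K] (S : Finset (Sym2 (Fin n))) :
    Ez (K := K) (xprod S) =
      (Nat.card (constSubgroup (K := K) S) : ℝ) / (K : ℝ) ^ n := by
  classical
  have : Nat.card (constSubgroup (K := K) S) =
      (univ.filter fun z : Fin n → Fin K => ∀ e ∈ S, (e.map z).IsDiag).card := by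
    rw [← Fintype.card_subtype, ← Nat.card_eq_fintype_card]
    exact Nat.card_congr (Equiv.subtypeEquivRight fun z => mem_constSubgroup_iff S z)
  rw [this]
  simp only [Ez, xprod_eq_ite]
  rw [← mul_sum, sum_boole, one_div, inv_pow]
  field_simp

/-- With communities read as residues modulo K, the assignments constant along S form a subgroup,
and the average of the indicator is the inverse of its index. The inequality says that the index of
an intersection is at most the product of the indices. -/
theorem Ez_xprod_mul_le (hK : K ≠ 0) (S T : Finset (Sym2 (Fin n))) :
    Ez (K := K) (xprod S) * Ez (K := K) (xprod T) ≤ Ez (K := K) (xprod (S ∪ T)) := by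
  have : NeZero K := ⟨hK⟩
  have hinf : constSubgroup (K := K) (S ∪ T) = constSubgroup S ⊓ constSubgroup T := by
    ext z
    simp only [AddSubgroup.mem_inf, mem_constSubgroup_iff, mem_union]
    exact ⟨fun h => ⟨fun e he => h e (Or.inl he), fun e he => h e (Or.inr he)⟩,
      fun h e he => he.elim (h.1 e) (h.2 e)⟩
  have h1 := (constSubgroup (K := K) S).card_mul_index
  have h2 := (constSubgroup (K := K) T).card_mul_index
  have h3 := (constSubgroup (K := K) S ⊓ constSubgroup T).card_mul_index
  have h4 := AddSubgroup.index_inf_le (H := constSubgroup (K := K) S) (K := constSubgroup T)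
  have hG : Nat.card (Fin n → Fin K) = K ^ n := by simp
  rw [hG] at h1 h2 h3
  rw [Ez_xprod, Ez_xprod, Ez_xprod, hinf]
  set a := Nat.card (constSubgroup (K := K) S)
  set b := Nat.card (constSubgroup (K := K) T)
  set d := Nat.card ↥(constSubgroup (K := K) S ⊓ constSubgroup T)
  have hpos : 0 < K ^ n := by positivity
  have key : a * b ≤ d * K ^ n := by
    have hd : 0 < (constSubgroup (K := K) S ⊓ constSubgroup T).index := by
      rcases Nat.eq_zero_or_pos (constSubgroup (K := K) S ⊓ constSubgroup T).index with h | h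
      · rw [h] at h3; omega
      · exact h
    refine Nat.le_of_mul_le_mul_right ?_ hd
    calc a * b * (constSubgroup (K := K) S ⊓ constSubgroup T).index
        ≤ a * b * ((constSubgroup (K := K) S).index * (constSubgroup (K := K) T).index) := by
          gcongr
      _ = K ^ n * K ^ n := by rw [← h1]; nth_rewrite 2 [h1]; rw [← h2]; ring
      _ = d * K ^ n * (constSubgroup (K := K) S ⊓ constSubgroup T).index := by
          nth_rewrite 1 [← h3]; ring
  have key' : (a : ℝ) * b ≤ d * (K : ℝ) ^ n := by exact_mod_cast key
  have hposR : (0 : ℝ) < (K : ℝ) ^ n := by exact_mod_cast hpos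
  rw [div_mul_div_comm, div_le_div_iff₀ (by positivity) hposR]
  nlinarith

/-- Nonnegative combinations of the indicators `xprod A`. -/
inductive PosComb : ((Fin n → Fin K) → ℝ) → Prop
  | smul (c : ℝ) (hc : 0 ≤ c) (A : Finset (Sym2 (Fin n))) : PosComb fun z => c * xprod A z
  | add (f g : (Fin n → Fin K) → ℝ) (hf : PosComb f) (hg : PosComb g) :
      PosComb fun z => f z + g z

namespace PosComb

variable {f g : (Fin n → Fin K) → ℝ}

theorem nonneg (hf : PosComb f) (z : Fin n → Fin K) : 0 ≤ f z := by
  induction hf with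
  | smul c hc A => exact mul_nonneg hc (xprod_nonneg _ _)
  | add f g _ _ hf hg => exact add_nonneg hf hg

theorem mul (hf : PosComb f) (hg : PosComb g) : PosComb fun z => f z * g z := by
  induction hf with
  | smul c hc A =>
    induction hg with
    | smul c' hc' A' =>
      have := PosComb.smul (K := K) (c * c') (mul_nonneg hc hc') (A ∪ A')
      convert this using 2 with z
      rw [xprod_union]; ring
    | add f g _ _ hf hg =>
      convert PosComb.add _ _ hf hg using 2 with z
      ring
  | add f' g' _ _ hf hg' =>
    convert PosComb.add _ _ hf hg' using 2 with z
    ring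

theorem affine {α β : ℝ} (hα : 0 ≤ α) (hβ : 0 ≤ β) (e : Sym2 (Fin n)) :
    PosComb (K := K) fun z => α + β * xi z e := by
  convert PosComb.add _ _ (PosComb.smul α hα ∅) (PosComb.smul β hβ {e}) using 2 with z
  simp [xprod]

theorem prod {ι : Type*} (S : Finset ι) {f : ι → (Fin n → Fin K) → ℝ}
    (hf : ∀ i ∈ S, PosComb (f i)) : PosComb fun z => ∏ i ∈ S, f i z := by
  classical
  induction S using Finset.induction_on with
  | empty =>
    convert PosComb.smul (K := K) (n := n) 1 zero_le_one ∅ using 2 with z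
    simp [xprod]
  | insert a s ha ih =>
    simp only [prod_insert ha]
    exact (hf a (by simp)).mul (ih fun i hi => hf i (by simp [hi]))

/-- Both sides are bilinear, so the inequality for indicators extends to the cone they span. All
conditional moments below lie in this cone. -/
theorem Ez_mul_le (hK : K ≠ 0) (hf : PosComb f) (hg : PosComb g) :
    Ez f * Ez g ≤ Ez fun z => f z * g z := by
  induction hf with
  | smul c hc A =>
    induction hg with
    | smul c' hc' A' =>
      have h := Ez_xprod_mul_le (K := K) hK A A'
      have : (fun z : Fin n → Fin K => c * xprod A z * (c' * xprod A' z)) =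
          fun z => c * c' * xprod (A ∪ A') z := by
        funext z; rw [xprod_union]; ring
      rw [this, Ez_const_mul, Ez_const_mul, Ez_const_mul]
      have := mul_le_mul_of_nonneg_left h (mul_nonneg hc hc')
      linarith
    | add f g _ _ hf hg =>
      simp only [mul_add, Ez_add] at *
      linarith
  | add f' g' _ _ hf hg' =>
    simp only [add_mul, Ez_add] at *
    linarith

end PosComb

/-! ### Nodes hanging on the other nodes -/

/-- `e` has exactly one endpoint in `W`. -/
def Crosses (W : Finset (Fin n)) (e : Sym2 (Fin n)) : Prop :=
  ∃ v w, e = s(v, w) ∧ v ∈ W ∧ w ∉ W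

/-- Every nonempty subset of `U` is crossed by an edge of `S`. -/
def Hanging (S : Finset (Sym2 (Fin n))) (U : Finset (Fin n)) : Prop :=
  ∀ W ⊆ U, W.Nonempty → ∃ e ∈ S, Crosses W e

/-- The set where the two assignments differ lies in U. If it were nonempty, an edge of S would
cross it, and both assignments are constant along that edge. -/
theorem Hanging.unique {S : Finset (Sym2 (Fin n))} {U : Finset (Fin n)} (h : Hanging S U)
    {z z' : Fin n → Fin K} (hz : ∀ e ∈ S, (e.map z).IsDiag) (hz' : ∀ e ∈ S, (e.map z').IsDiag)
    (hzz' : ∀ v, v ∉ U → z v = z' v) : z = z' := by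
  classical
  by_contra hne
  obtain ⟨v₀, hv₀⟩ := Function.ne_iff.1 hne
  obtain ⟨e, he, v, w, rfl, hv, hw⟩ := h (univ.filter fun v => z v ≠ z' v)
    (fun v hv => by by_contra hvU; exact (mem_filter.1 hv).2 (hzz' v hvU))
    ⟨v₀, by simpa using hv₀⟩
  have h1 : z v = z w := by simpa using hz _ he
  have h2 : z' v = z' w := by simpa using hz' _ he
  simp only [mem_filter, mem_univ, true_and, not_not] at hv hw
  exact hv (by rw [h1, h2, hw])

/-- An assignment constant along S is determined by its values off U. Overwriting its values on U
arbitrarily is therefore injective in the pair (assignment, new values), and it leaves g unchanged: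
each assignment counted on the left yields K^|U| distinct ones on the right. -/
theorem Ez_mul_xprod_le {S : Finset (Sym2 (Fin n))} {U : Finset (Fin n)} (hK : K ≠ 0)
    (h : Hanging S U) {g : (Fin n → Fin K) → ℝ} (hg0 : ∀ z, 0 ≤ g z)
    (hg : ∀ z z', (∀ v, v ∉ U → z v = z' v) → g z = g z') :
    (K : ℝ) ^ U.card * Ez (fun z => g z * xprod S z) ≤ Ez g := by
  classical
  simp only [Ez]
  rw [mul_sum]
  set A := univ.filter fun z : Fin n → Fin K => ∀ e ∈ S, (e.map z).IsDiag
  have hL : ∑ z : Fin n → Fin K, (K : ℝ) ^ U.card * ((1 / (K : ℝ)) ^ n * (g z * xprod S z)) =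
      ∑ p ∈ A ×ˢ (univ : Finset (U → Fin K)), (1 / (K : ℝ)) ^ n * g p.1 := by
    rw [sum_product]
    simp only [sum_const, card_univ, Fintype.card_fun, Fintype.card_fin, Fintype.card_coe,
      nsmul_eq_mul, A, sum_filter]
    refine sum_congr rfl fun z _ => ?_
    rw [xprod_eq_ite]
    split_ifs
    · push_cast; ring
    · ring
  rw [hL]
  let φ : (Fin n → Fin K) × (U → Fin K) → (Fin n → Fin K) :=
    fun p v => if hv : v ∈ U then p.2 ⟨v, hv⟩ else p.1 v
  have hφ : Set.InjOn φ (A ×ˢ (univ : Finset (U → Fin K)) : Finset _) := by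
    rintro ⟨z, y⟩ hz ⟨z', y'⟩ hz' heq
    simp only [coe_product, Set.mem_prod, mem_coe, A, mem_filter, mem_univ, true_and,
      and_true] at hz hz'
    have h1 : z = z' := h.unique hz hz' fun v hv => by
      simpa [φ, hv] using congrFun heq v
    have h2 : y = y' := by
      funext v
      simpa [φ, v.2] using congrFun heq v
    rw [h1, h2]
  calc ∑ p ∈ A ×ˢ (univ : Finset (U → Fin K)), (1 / (K : ℝ)) ^ n * g p.1
      = ∑ p ∈ A ×ˢ (univ : Finset (U → Fin K)), (1 / (K : ℝ)) ^ n * g (φ p) := by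
        refine sum_congr rfl fun p _ => ?_
        rw [hg p.1 (φ p)]
        intro v hv
        simp [φ, hv]
    _ = ∑ z ∈ (A ×ˢ (univ : Finset (U → Fin K))).image φ, (1 / (K : ℝ)) ^ n * g z :=
        (sum_image (f := fun z => (1 / (K : ℝ)) ^ n * g z) hφ).symm
    _ ≤ ∑ z, (1 / (K : ℝ)) ^ n * g z :=
        sum_le_sum_of_subset_of_nonneg (subset_univ _)
          fun z _ _ => mul_nonneg (by positivity) (hg0 z)

theorem Ez_xprod_le_of_hanging {S : Finset (Sym2 (Fin n))} {U : Finset (Fin n)} (hK : K ≠ 0)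
    (h : Hanging S U) : (K : ℝ) ^ U.card * Ez (K := K) (xprod S) ≤ 1 := by
  have := Ez_mul_xprod_le hK h (g := fun _ => 1) (fun _ => zero_le_one) fun _ _ _ => rfl
  simpa [Ez_one hK] using this

theorem hanging_singleton {i j : Fin n} (hij : i ≠ j) : Hanging {s(i, j)} {i} := by
  intro W hW hne
  have : W = {i} := (Finset.subset_singleton_iff.1 hW).resolve_left hne.ne_empty
  exact ⟨_, mem_singleton_self _, i, j, rfl, by simp [this], by simp [this, hij.symm]⟩

theorem Ez_xi_le_of_not_isDiag (hK : K ≠ 0) {e : Sym2 (Fin n)} (he : ¬ e.IsDiag) :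
    K * Ez (K := K) (fun z => xi z e) ≤ 1 := by
  induction e with
  | _ i j =>
    have := Ez_xprod_le_of_hanging (K := K) hK (hanging_singleton (by simpa using he : i ≠ j))
    have h2 : (xprod (K := K) {s(i, j)}) = fun z => xi z s(i, j) := by
      funext z; simp [xprod]
    simpa [h2] using this

/-- Resample the community of one endpoint: among its K values at least one agrees with the other
endpoint. -/
theorem one_le_Ez_xi (hK : K ≠ 0) (e : Sym2 (Fin n)) :
    1 ≤ K * Ez (K := K) (fun z => xi z e) := by
  classical
  induction e with
  | _ i j =>
    have h : ∀ z : Fin n → Fin K, ∑ k : Fin K, xi (Function.update z i k) s(i, j) ≥ 1 := by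
      intro z
      refine le_trans ?_ (single_le_sum (fun k _ => xi_nonneg _ _) (mem_univ (z j)))
      by_cases hij : j = i <;> simp [xi, hij, Function.update_apply]
    have h2 : K * Ez (K := K) (fun z => xi z s(i, j)) =
        Ez fun z : Fin n → Fin K => ∑ k : Fin K, xi (Function.update z i k) s(i, j) := by
      simp only [Ez, ← mul_sum]
      rw [mul_left_comm]
      congr 1
      have e := Equiv.funSplitAt i (Fin K)
      rw [← (Equiv.funSplitAt i (Fin K)).symm.sum_comp, ← (Equiv.funSplitAt i (Fin K)).symm.sum_comp]
      have key : ∀ (p : Fin K × ({ j // j ≠ i } → Fin K)) k,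
          Function.update ((Equiv.funSplitAt i (Fin K)).symm p) i k =
            (Equiv.funSplitAt i (Fin K)).symm (k, p.2) := by
        intro p k
        funext v
        by_cases hv : v = i
        · subst hv; simp [Equiv.funSplitAt, Equiv.piSplitAt]
        · simp [Equiv.funSplitAt, Equiv.piSplitAt, hv]
      simp only [key]
      rw [Fintype.sum_prod_type, Fintype.sum_prod_type]
      simp only [sum_const, card_univ, Fintype.card_fin, nsmul_eq_mul]
      congr 1
      exact sum_comm
    rw [h2]
    calc (1 : ℝ) = Ez (fun _ : Fin n → Fin K => (1 : ℝ)) := (Ez_one hK).symm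
      _ ≤ _ := Ez_mono h

theorem one_le_Ez_xprod (hK : K ≠ 0) (S : Finset (Sym2 (Fin n))) :
    1 ≤ (K : ℝ) ^ S.card * Ez (K := K) (xprod S) := by
  classical
  induction S using Finset.induction_on with
  | empty =>
    have : (xprod (K := K) (n := n) ∅) = fun _ => 1 := by funext z; simp [xprod]
    simp [this, Ez_one hK]
  | insert a s ha ih =>
    have h1 := one_le_Ez_xi hK a
    have h2 := Ez_xprod_mul_le (K := K) hK {a} s
    rw [← insert_eq] at h2
    rw [card_insert_of_notMem ha, pow_succ]
    have h3 : Ez (K := K) (xprod {a}) = Ez fun z : Fin n → Fin K => xi z a := by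
      congr 1; funext z; simp [xprod]
    rw [h3] at h2
    have hK' : (0 : ℝ) < K := by positivity
    calc (1 : ℝ) ≤ ((K : ℝ) ^ s.card * Ez (K := K) (xprod s)) * (K * Ez (fun z : Fin n → Fin K => xi z a)) :=
          one_le_mul_of_one_le_of_one_le ih h1
      _ = (K : ℝ) ^ s.card * K * (Ez (fun z : Fin n → Fin K => xi z a) * Ez (K := K) (xprod s)) := by ring
      _ ≤ _ := by gcongr

/-- With two communities, the probability of being constant along S is at least 2^(-|S|) and at most
2^(-|U|). -/
theorem Hanging.card_le {S : Finset (Sym2 (Fin n))} {U : Finset (Fin n)} (h : Hanging S U) :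
    U.card ≤ S.card := by
  have h1 := Ez_xprod_le_of_hanging (K := 2) two_ne_zero h
  have h2 := one_le_Ez_xprod (K := 2) two_ne_zero S
  have hpos : 0 < Ez (K := 2) (xprod S) := by
    by_contra h0
    have := mul_nonpos_of_nonneg_of_nonpos (by positivity : (0 : ℝ) ≤ ((2 : ℕ) : ℝ) ^ S.card)
      (not_lt.1 h0)
    linarith
  have h3 : (((2 : ℕ) : ℝ)) ^ U.card ≤ ((2 : ℕ) : ℝ) ^ S.card :=
    le_of_mul_le_mul_right (h1.trans h2) hpos
  exact (pow_le_pow_iff_right₀ (by norm_num)).1 h3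

variable {D : ℕ} {q lam c : ℝ}

/-! ### Parameters -/

/-- The standing assumptions on the parameters. -/
structure Params (n K D : ℕ) (q lam c : ℝ) : Prop where
  two_le_K : 2 ≤ K
  K_le : K ≤ n
  two_le_D : 2 ≤ D
  c_ge : 14 ≤ c
  q_pos : 0 < q
  lam_pos : 0 < lam
  q_le : q ≤ 1 / 2
  q_lam : q + 2 * lam ≤ 1
  signal : SignalCondition n K D q lam c

/-- The basic small quantity `D ^ (-c)`. -/
def eps (D : ℕ) (c : ℝ) : ℝ := (D : ℝ) ^ (-c)

namespace Params

variable (P : Params n K D q lam c)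
include P

theorem K_ne : K ≠ 0 := by have := P.two_le_K; omega
theorem K_pos : (0 : ℝ) < K := by have := P.two_le_K; exact_mod_cast (by omega : 0 < K)
theorem n_pos : (0 : ℝ) < n := by
  have := P.two_le_K; have := P.K_le; exact_mod_cast (by omega : 0 < n)
theorem D_pos : (0 : ℝ) < D := by have := P.two_le_D; exact_mod_cast (by omega : 0 < D)
theorem two_le_D' : (2 : ℝ) ≤ D := by exact_mod_cast P.two_le_D
theorem two_le_K' : (2 : ℝ) ≤ K := by exact_mod_cast P.two_le_K
theorem K_le' : (K : ℝ) ≤ n := by exact_mod_cast P.K_le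
theorem qb_pos : 0 < q * (1 - q) := mul_pos P.q_pos (by linarith [P.q_le])
theorem lam_le : lam ≤ 1 / 2 := by linarith [P.q_lam, P.q_pos]

theorem eps_pos : 0 < eps D c := Real.rpow_pos_of_pos P.D_pos _

/-- This is where `c_ge` enters. Every polynomial factor in D met later is absorbed by one power of
`eps`. -/
theorem eps_le_inv_pow : eps D c ≤ ((D : ℝ) ^ 14)⁻¹ := by
  unfold eps
  rw [← Real.rpow_natCast, ← Real.rpow_neg P.D_pos.le]
  exact Real.rpow_le_rpow_of_exponent_le (by linarith [P.two_le_D']) (by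
    push_cast; linarith [P.c_ge])

theorem eps_mul_le {k : ℕ} (hk : k ≤ 14) : eps D c * (D : ℝ) ^ k ≤ 1 := by
  have h1 := P.eps_le_inv_pow
  have hD : (1 : ℝ) ≤ D := by linarith [P.two_le_D']
  calc eps D c * (D : ℝ) ^ k ≤ ((D : ℝ) ^ 14)⁻¹ * (D : ℝ) ^ 14 :=
        mul_le_mul h1 (pow_le_pow_right₀ hD hk) (by positivity) (by positivity)
    _ = 1 := inv_mul_cancel₀ (by have := P.D_pos; positivity)

theorem eps_le : eps D c ≤ 1 / 2 ^ 14 := by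
  refine P.eps_le_inv_pow.trans ?_
  rw [← one_div]
  have := P.two_le_D'
  gcongr

theorem eps_le_one : eps D c ≤ 1 := P.eps_le.trans (by norm_num)

theorem eps_pow_le {j k : ℕ} (h : k ≤ j) : eps D c ^ j ≤ eps D c ^ k :=
  pow_le_pow_of_le_one P.eps_pos.le P.eps_le_one h

end Params

/-- The squared gain when the edges at unmatched nodes are compared to the noise level. -/
def gainNoise (n K : ℕ) (q lam : ℝ) (e u : ℕ) : ℝ :=
  (lam ^ 2 / (q * (1 - q))) ^ e * ((n : ℝ) / (K : ℝ) ^ 2) ^ u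

/-- The squared gain when the edges at unmatched nodes are compared to the signal level. -/
def gainSignal (n K : ℕ) (lam : ℝ) (e u : ℕ) : ℝ := lam ^ e * ((n : ℝ) / K) ^ u

namespace Params

variable (P : Params n K D q lam c)
include P

theorem gainNoise_nonneg (e u : ℕ) : 0 ≤ gainNoise n K q lam e u := by
  have := P.qb_pos
  unfold gainNoise; positivity

theorem gainSignal_nonneg (e u : ℕ) : 0 ≤ gainSignal n K lam e u := by
  have := P.lam_pos
  unfold gainSignal; positivity

/-- The signal condition at r = e / u, raised to the power 2u: this clears the square roots and
makes every exponent an integer. The bounds on u and e place r in [1, D]. -/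
theorem signal_nat {e u : ℕ} (hu : 1 ≤ u) (hue : u ≤ e) (heD : e ≤ D) :
    gainNoise n K q lam e u ≤ eps D c ^ (16 * e) ∨
      gainSignal n K lam e u ≤ eps D c ^ (16 * e) := by
  have hu' : (0 : ℝ) < u := by exact_mod_cast hu
  have hqb := P.qb_pos
  have hl := P.lam_pos
  have hn := P.n_pos
  have hK := P.K_pos
  have hDp := P.D_pos
  have he := P.eps_pos
  set r : ℝ := (e : ℝ) / u with hr
  have h1 : 1 ≤ r := by rw [hr, le_div_iff₀ hu', one_mul]; exact_mod_cast hue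
  have h2 : r ≤ D := by
    rw [hr, div_le_iff₀ hu']
    have : e ≤ D * u := heD.trans (Nat.le_mul_of_pos_right D hu)
    exact_mod_cast this
  have hru : r * ((2 * u : ℕ) : ℝ) = ((2 * e : ℕ) : ℝ) := by
    rw [hr]; push_cast; field_simp
  have hs := P.signal r h1 h2
  have hpos : 0 < (D : ℝ) ^ (8 * c * r) := Real.rpow_pos_of_pos hDp _
  have hmin : min (√(n : ℝ) / (K : ℝ) * (lam / √(q * (1 - q))) ^ r)
        (lam ^ (r / 2) / √((K : ℝ) / (n : ℝ))) ≤ (D : ℝ) ^ (-(8 * c * r)) := by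
    rw [Real.rpow_neg hDp.le, ← one_div, le_div_iff₀ hpos]
    linarith
  have hE : ((D : ℝ) ^ (-(8 * c * r))) ^ (2 * u) = eps D c ^ (16 * e) := by
    unfold eps
    rw [← Real.rpow_natCast, ← Real.rpow_natCast, ← Real.rpow_mul hDp.le, ← Real.rpow_mul hDp.le]
    congr 1
    have : -(8 * c * r) * ((2 * u : ℕ) : ℝ) = -(8 * c) * (r * ((2 * u : ℕ) : ℝ)) := by ring
    rw [this, hru]
    push_cast; ring
  rcases min_le_iff.1 hmin with h | h
  · left
    have := pow_le_pow_left₀ (by positivity) h (2 * u)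
    rw [hE, mul_pow, ← Real.rpow_natCast ((lam / √(q * (1 - q))) ^ r), ← Real.rpow_mul (by positivity),
      hru, Real.rpow_natCast, pow_mul, div_pow, Real.sq_sqrt hn.le, pow_mul (lam / _), div_pow lam,
      Real.sq_sqrt hqb.le] at this
    unfold gainNoise
    rw [mul_comm]
    exact this
  · right
    have := pow_le_pow_left₀ (by positivity) h (2 * u)
    rw [hE, div_pow, ← Real.rpow_natCast (lam ^ (r / 2)), ← Real.rpow_mul hl.le,
      pow_mul (√_), Real.sq_sqrt (by positivity)] at this
    have h3 : r / 2 * ((2 * u : ℕ) : ℝ) = (e : ℝ) := by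
      have : r / 2 * ((2 * u : ℕ) : ℝ) = (r * ((2 * u : ℕ) : ℝ)) / 2 := by ring
      rw [this, hru]; push_cast; ring
    rw [h3, Real.rpow_natCast] at this
    unfold gainSignal
    rw [← inv_div (K : ℝ) n, inv_pow, ← div_eq_mul_inv]
    exact this

theorem gainSignal_zero (h : lam ≤ eps D c ^ 8) (e : ℕ) :
    gainSignal n K lam e 0 ≤ eps D c ^ (8 * e) := by
  unfold gainSignal
  rw [pow_zero, mul_one, pow_mul]
  exact pow_le_pow_left₀ P.lam_pos.le h e

/-- For λ above eps^8 the signal alternative is impossible: as n ≥ K, the signal gain is at least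
λ^e > eps^(8e). -/
theorem gainNoise_le (h : eps D c ^ 8 < lam) {e u : ℕ} (hu : 1 ≤ u) (hue : u ≤ e) (heD : e ≤ D) :
    gainNoise n K q lam e u ≤ eps D c ^ (16 * e) := by
  refine (P.signal_nat hu hue heD).resolve_right fun h2 => ?_
  have h3 : eps D c ^ (8 * e) < lam ^ e := by
    rw [pow_mul]; exact pow_lt_pow_left₀ h (pow_pos P.eps_pos _).le (by omega)
  have h4 : eps D c ^ (16 * e) ≤ eps D c ^ (8 * e) := P.eps_pow_le (by omega)
  have h5 : lam ^ e ≤ gainSignal n K lam e u := by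
    refine le_mul_of_one_le_right (pow_pos P.lam_pos _).le (one_le_pow₀ ?_)
    rw [le_div_iff₀ P.K_pos, one_mul]; exact P.K_le'
  linarith

/-- The case e = u = 1 bounds (λ²/q̄)(n/K²) with q̄ = q(1 - q), and here n/K² ≥ 1 can be dropped. -/
theorem gainNoise_zero (h : eps D c ^ 8 < lam) (hKn : K ^ 2 ≤ n) (e : ℕ) :
    gainNoise n K q lam e 0 ≤ eps D c ^ (16 * e) := by
  have h1 := P.gainNoise_le h le_rfl le_rfl (by have := P.two_le_D; omega : 1 ≤ D)
  have hqb := P.qb_pos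
  have hK := P.K_pos
  simp only [gainNoise, pow_one, mul_one] at h1
  have h2 : (1 : ℝ) ≤ (n : ℝ) / (K : ℝ) ^ 2 := by
    rw [le_div_iff₀ (by positivity), one_mul]; exact_mod_cast hKn
  unfold gainNoise
  rw [pow_zero, mul_one, pow_mul]
  refine pow_le_pow_left₀ (by positivity) ?_ e
  exact (le_mul_of_one_le_right (by positivity) h2).trans h1

/-- Bound when an edge between matched nodes is unmatched, in the dense regime. -/
theorem dense_bound (h : eps D c ^ 8 < lam) (hKn : n < K ^ 2) {e m u : ℕ} (hem : e + 2 * m ≤ 2 * D) :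
    (lam ^ 2 / (q * (1 - q))) ^ e * (1 + lam / (q * (1 - q))) ^ (2 * m) *
      ((n : ℝ) / (K : ℝ) ^ 2) ^ u / (K : ℝ) ^ 2 ≤ 4 * eps D c ^ (16 * e) := by
  have hqb := P.qb_pos
  have hl := P.lam_pos
  have hK := P.K_pos
  have hn := P.n_pos
  have he := P.eps_pos
  -- The choice e = D, u = 1 gives A^D ≤ ε^(16D) R with R = K²/n, so A exceeds ε^16 by at most a
  -- D-th root of R.
  have h1 := P.gainNoise_le h le_rfl (by have := P.two_le_D; omega : 1 ≤ D) le_rfl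
  simp only [gainNoise, pow_one] at h1
  set qb := q * (1 - q)
  set A := lam ^ 2 / qb with hA
  set ε := eps D c
  set R := (K : ℝ) ^ 2 / n with hR
  have hR1 : 1 ≤ R := by
    rw [hR, le_div_iff₀ hn, one_mul]; exact_mod_cast hKn.le
  have hRinv : (n : ℝ) / (K : ℝ) ^ 2 = R⁻¹ := by rw [hR, inv_div]
  rw [hRinv] at h1 ⊢
  have hA0 : 0 ≤ A := by positivity
  set A' := A / ε ^ 16 with hA'
  have hAA' : A = ε ^ 16 * A' := by rw [hA']; field_simp
  have hA'D : A' ^ D ≤ R := by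
    rw [hA', div_pow, ← pow_mul, div_le_iff₀ (by positivity)]
    have : A ^ D = A ^ D * R⁻¹ * R := by field_simp
    rw [this]
    nlinarith
  -- Truncation at 1 allows exponents of `m₀` to be raised up to 2D.
  set m₀ := max A' 1 with hm₀
  have hm1 : 1 ≤ m₀ := le_max_right _ _
  have hmD : m₀ ^ D ≤ R := by
    rcases max_choice A' 1 with h' | h' <;> rw [hm₀, h']
    · exact hA'D
    · simpa using hR1
  have hAm : A ≤ ε ^ 16 * m₀ := by
    rw [hAA']; gcongr; exact le_max_left _ _
  -- Here λ/q̄ = A/λ, and the lower bound λ > ε^8 costs only half of the factor ε^16.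
  have hθ : 1 + lam / qb ≤ m₀ * (1 + ε ^ 8) := by
    have h2 : lam / qb = A / lam := by rw [hA]; field_simp
    have h3 : A / lam ≤ ε ^ 8 * m₀ := by
      rw [div_le_iff₀ hl]
      calc A ≤ ε ^ 16 * m₀ := hAm
        _ = ε ^ 8 * m₀ * ε ^ 8 := by ring
        _ ≤ _ := by gcongr
    rw [h2]; linarith
  have hexp : (1 + ε ^ 8) ^ (2 * m) ≤ 4 := by
    have h2 : (1 + ε ^ 8) ^ (2 * m) ≤ Real.exp (ε ^ 8 * (2 * m : ℕ)) := by
      rw [mul_comm (ε ^ 8), Real.exp_nat_mul]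
      exact pow_le_pow_left₀ (by positivity) (by linarith [Real.add_one_le_exp (ε ^ 8)]) _
    have h3 : ε ^ 8 * ((2 * m : ℕ) : ℝ) ≤ 1 := by
      have h4 : ((2 * m : ℕ) : ℝ) ≤ 2 * D := by exact_mod_cast (by omega : 2 * m ≤ 2 * D)
      have h5 : ε ^ 8 ≤ ε ^ 1 := P.eps_pow_le (by norm_num)
      have h6 := P.eps_mul_le (k := 2) (by norm_num)
      have h7 := P.two_le_D'
      calc ε ^ 8 * ((2 * m : ℕ) : ℝ) ≤ ε ^ 1 * (2 * D) := by gcongr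
        _ ≤ ε * (D : ℝ) ^ 2 := by rw [pow_one]; gcongr; nlinarith
        _ ≤ 1 := h6
    have h4 := Real.exp_le_exp.2 h3
    linarith [Real.exp_one_lt_d9]
  have hu : R⁻¹ ^ u ≤ 1 := pow_le_one₀ (by positivity) (inv_le_one_of_one_le₀ hR1)
  have hm2 : m₀ ^ (e + 2 * m) ≤ R ^ 2 := by
    calc m₀ ^ (e + 2 * m) ≤ m₀ ^ (D * 2) := pow_le_pow_right₀ hm1 (by omega)
      _ = (m₀ ^ D) ^ 2 := pow_mul _ _ _
      _ ≤ R ^ 2 := by gcongr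
  -- Since K ≤ n, R ≤ K: the factor 1/K² pays for the R² accumulated over the at most 2D edges.
  have hRK : R ^ 2 / (K : ℝ) ^ 2 ≤ 1 := by
    rw [hR, div_pow, div_div, div_le_one (by positivity)]
    have := P.K_le'
    calc ((K : ℝ) ^ 2) ^ 2 = (K : ℝ) ^ 2 * (K : ℝ) ^ 2 := by ring
      _ ≤ (n : ℝ) ^ 2 * (K : ℝ) ^ 2 := by gcongr
  calc A ^ e * (1 + lam / qb) ^ (2 * m) * R⁻¹ ^ u / (K : ℝ) ^ 2
      ≤ (ε ^ 16 * m₀) ^ e * (m₀ * (1 + ε ^ 8)) ^ (2 * m) * 1 / (K : ℝ) ^ 2 := by gcongr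
    _ = ε ^ (16 * e) * m₀ ^ (e + 2 * m) * (1 + ε ^ 8) ^ (2 * m) / (K : ℝ) ^ 2 := by
        rw [mul_pow, mul_pow, pow_add, pow_mul]; ring
    _ ≤ ε ^ (16 * e) * R ^ 2 * 4 / (K : ℝ) ^ 2 := by gcongr
    _ = 4 * ε ^ (16 * e) * (R ^ 2 / (K : ℝ) ^ 2) := by ring
    _ ≤ 4 * ε ^ (16 * e) := mul_le_of_le_one_right (by positivity) hRK

end Params

/-! ### The second moment of two monomials -/

/-- The conditional second moment of `Y e`. -/
def sqMean (q lam : ℝ) (z : Fin n → Fin K) (e : Sym2 (Fin n)) : ℝ :=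
  q * (1 - q) + lam * (1 - 2 * q) * xi z e

/-- The conditional mean of the product of the monomials attached to `S` and `T`. -/
def crossMean (q lam : ℝ) (S T : Finset (Sym2 (Fin n))) (z : Fin n → Fin K) : ℝ :=
  (∏ e ∈ S ∩ T, sqMean q lam z e) * ∏ e ∈ symmDiff S T, lam * xi z e

/-- `e` has an endpoint in `U`. -/
def Touches (U : Finset (Fin n)) (e : Sym2 (Fin n)) : Prop := ∃ v ∈ e, v ∈ U

theorem xi_congr {z z' : Fin n → Fin K} {U : Finset (Fin n)} (h : ∀ v, v ∉ U → z v = z' v)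
    {e : Sym2 (Fin n)} (he : ¬ Touches U e) : xi z e = xi z' e := by
  have : e.map z = e.map z' := by
    refine Sym2.map_congr fun v hv => h v fun hU => he ⟨v, hv, hU⟩
  unfold xi; rw [this]

theorem prod_lam_xi (S : Finset (Sym2 (Fin n))) (z : Fin n → Fin K) :
    ∏ e ∈ S, lam * xi z e = lam ^ S.card * xprod S z := by
  rw [prod_mul_distrib, prod_const]; rfl

theorem crossMean_eq (S T : Finset (Sym2 (Fin n))) (z : Fin n → Fin K) :
    crossMean q lam S T z = lam ^ (symmDiff S T).card *
      ((∏ e ∈ S ∩ T, sqMean q lam z e) * xprod (symmDiff S T) z) := by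
  unfold crossMean
  rw [prod_lam_xi]; ring

namespace Params

variable (P : Params n K D q lam c)
include P

theorem qb_le_sqMean (z : Fin n → Fin K) (e : Sym2 (Fin n)) : q * (1 - q) ≤ sqMean q lam z e := by
  have := mul_nonneg (mul_nonneg P.lam_pos.le (by linarith [P.q_le] : 0 ≤ 1 - 2 * q)) (xi_nonneg z e)
  unfold sqMean; linarith

theorem sqMean_pos (z : Fin n → Fin K) (e : Sym2 (Fin n)) : 0 < sqMean q lam z e :=
  P.qb_pos.trans_le (P.qb_le_sqMean z e)

/-- When the endpoints agree this reads 2λq ≤ q(1 - q), which is the assumption q + 2λ ≤ 1. -/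
theorem lam_xi_le_sqMean (z : Fin n → Fin K) (e : Sym2 (Fin n)) :
    lam * xi z e ≤ sqMean q lam z e := by
  have h : lam ≤ q * (1 - q) + lam * (1 - 2 * q) := by
    have := P.q_lam; have := P.q_pos; nlinarith
  have h0 := P.qb_pos
  unfold sqMean xi
  split_ifs <;> linarith

theorem lam_sq_xi_le_sqMean (z : Fin n → Fin K) (e : Sym2 (Fin n)) :
    lam * xi z e * (lam * xi z e) ≤ sqMean q lam z e := by
  refine le_trans ?_ (P.lam_xi_le_sqMean z e)
  have h1 : lam * xi z e ≤ 1 := by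
    have := P.lam_le; have := P.lam_pos; have := xi_le_one z e; have := xi_nonneg z e
    nlinarith
  exact mul_le_of_le_one_left (mul_nonneg P.lam_pos.le (xi_nonneg z e)) h1

theorem sqMean_le (z : Fin n → Fin K) (e : Sym2 (Fin n)) :
    sqMean q lam z e ≤ q * (1 - q) * (1 + lam / (q * (1 - q))) := by
  have hqb := P.qb_pos
  have : q * (1 - q) * (1 + lam / (q * (1 - q))) = q * (1 - q) + lam := by
    rw [mul_add, mul_div_cancel₀ _ hqb.ne', mul_one]
  rw [this]
  have h1 := xi_le_one z e; have h2 := xi_nonneg z e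
  have h3 := P.lam_pos; have h4 := P.q_pos; have h5 := P.q_le
  have h6 : (1 - 2 * q) * xi z e ≤ 1 := by nlinarith
  unfold sqMean
  nlinarith

theorem posComb_sqMean (e : Sym2 (Fin n)) :
    PosComb (K := K) fun z => sqMean q lam z e :=
  PosComb.affine P.qb_pos.le (mul_nonneg P.lam_pos.le (by linarith [P.q_le])) e

theorem posComb_lam_xi (e : Sym2 (Fin n)) : PosComb (K := K) fun z => lam * xi z e := by
  simpa using PosComb.affine (K := K) le_rfl P.lam_pos.le e

theorem posComb_crossMean (S T : Finset (Sym2 (Fin n))) :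
    PosComb (K := K) (crossMean q lam S T) :=
  (PosComb.prod _ fun e _ => P.posComb_sqMean e).mul (PosComb.prod _ fun e _ => P.posComb_lam_xi e)

/-- Edges of S outside T are reduced to the noise level here and to the signal level in
`lam_pow_mul_Ez_le`. The choice between these two lower bounds is the choice between `gainNoise` and
`gainSignal`. -/
theorem pow_mul_Ez_le (S T : Finset (Sym2 (Fin n))) :
    (q * (1 - q)) ^ (S \ T).card * Ez (fun z : Fin n → Fin K => ∏ e ∈ S ∩ T, sqMean q lam z e) ≤
      Ez (fun z : Fin n → Fin K => ∏ e ∈ S, sqMean q lam z e) := by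
  rw [← Ez_const_mul]
  refine Ez_mono fun z => ?_
  rw [← prod_inter_mul_prod_sdiff S T, mul_comm, ← prod_const]
  exact mul_le_mul_of_nonneg_left
    (prod_le_prod (fun _ _ => P.qb_pos.le) fun e _ => P.qb_le_sqMean z e)
    (prod_nonneg fun e _ => (P.sqMean_pos z e).le)

theorem lam_pow_mul_Ez_le (S T : Finset (Sym2 (Fin n))) :
    lam ^ (S \ T).card *
        Ez (fun z : Fin n → Fin K => (∏ e ∈ S ∩ T, sqMean q lam z e) * xprod (S \ T) z) ≤
      Ez (fun z : Fin n → Fin K => ∏ e ∈ S, sqMean q lam z e) := by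
  rw [← Ez_const_mul]
  refine Ez_mono fun z => ?_
  rw [← prod_inter_mul_prod_sdiff S T, mul_left_comm, ← prod_lam_xi]
  exact mul_le_mul_of_nonneg_left
    (prod_le_prod (fun e _ => mul_nonneg P.lam_pos.le (xi_nonneg z e))
      fun e _ => P.lam_xi_le_sqMean z e)
    (prod_nonneg fun e _ => (P.sqMean_pos z e).le)

end Params

/-- The geometry of two overlapping edge sets: `U` is a set of nodes hanging on the other nodes
through `S` and not touched by `T`. -/
structure HangsOff (S T : Finset (Sym2 (Fin n))) (U : Finset (Fin n)) : Prop where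
  hanging : Hanging S U
  not_touches : ∀ e ∈ T, ¬ Touches U e

theorem Crosses.touches {W : Finset (Fin n)} {e : Sym2 (Fin n)} (h : Crosses W e) :
    Touches W e := by
  obtain ⟨v, w, rfl, hv, _⟩ := h
  exact ⟨v, by simp, hv⟩

theorem Touches.mono {W U : Finset (Fin n)} (h : W ⊆ U) {e : Sym2 (Fin n)} (he : Touches W e) :
    Touches U e := by
  obtain ⟨v, hv, hW⟩ := he
  exact ⟨v, hv, h hW⟩

namespace HangsOff

variable {S T : Finset (Sym2 (Fin n))} {U U₁ U₂ : Finset (Fin n)}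

theorem hanging_sdiff (h : HangsOff S T U) : Hanging (S \ T) U := by
  intro W hW hne
  obtain ⟨e, he, hc⟩ := h.hanging W hW hne
  exact ⟨e, mem_sdiff.2 ⟨he, fun hT => h.not_touches e hT (hc.touches.mono hW)⟩, hc⟩

theorem card_le (h : HangsOff S T U) : U.card ≤ (S \ T).card := h.hanging_sdiff.card_le

theorem prod_congr (h : HangsOff S T U) {z z' : Fin n → Fin K} (hz : ∀ v, v ∉ U → z v = z' v) :
    ∏ e ∈ S ∩ T, sqMean q lam z e = ∏ e ∈ S ∩ T, sqMean q lam z' e := by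
  refine Finset.prod_congr rfl fun e he => ?_
  unfold sqMean
  rw [xi_congr hz (h.not_touches e (mem_inter.1 he).2)]

theorem xprod_congr (h : HangsOff S T U) {z z' : Fin n → Fin K} (hz : ∀ v, v ∉ U → z v = z' v) :
    xprod (T \ S) z = xprod (T \ S) z' :=
  Finset.prod_congr rfl fun e he => xi_congr hz (h.not_touches e (mem_sdiff.1 he).1)

end HangsOff

namespace Params

variable (P : Params n K D q lam c)
include P

theorem hangs_one {S T : Finset (Sym2 (Fin n))} {U : Finset (Fin n)} (h : HangsOff S T U) :
    (K : ℝ) ^ U.card *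
        Ez (fun z : Fin n → Fin K => (∏ e ∈ S ∩ T, sqMean q lam z e) * xprod (S \ T) z) ≤
      Ez (fun z : Fin n → Fin K => ∏ e ∈ S ∩ T, sqMean q lam z e) :=
  Ez_mul_xprod_le P.K_ne h.hanging_sdiff (fun z => prod_nonneg fun e _ => (P.sqMean_pos z e).le)
    fun _ _ hz => h.prod_congr hz

/-- The weight may keep the indicator along T \ S, because T does not touch U and that indicator
ignores the communities averaged out. -/
theorem hangs_two {S T : Finset (Sym2 (Fin n))} {U : Finset (Fin n)} (h : HangsOff S T U) :
    (K : ℝ) ^ U.card *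
        Ez (fun z : Fin n → Fin K => (∏ e ∈ S ∩ T, sqMean q lam z e) * xprod (symmDiff S T) z) ≤
      Ez (fun z : Fin n → Fin K => (∏ e ∈ S ∩ T, sqMean q lam z e) * xprod (T \ S) z) := by
  have := Ez_mul_xprod_le P.K_ne h.hanging_sdiff
    (g := fun z : Fin n → Fin K => (∏ e ∈ S ∩ T, sqMean q lam z e) * xprod (T \ S) z)
    (fun z => mul_nonneg (prod_nonneg fun e _ => (P.sqMean_pos z e).le) (xprod_nonneg _ _))
    fun _ _ hz => by simp only [h.prod_congr hz, h.xprod_congr hz]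
  refine le_trans (le_of_eq ?_) this
  congr 2
  funext z
  rw [show symmDiff S T = (S \ T) ∪ (T \ S) from rfl, xprod_union]
  ring

/-- The squared main estimate in terms of the gains of the two sides. -/
theorem sq_Ez_crossMean_le_gain {S T : Finset (Sym2 (Fin n))} {U₁ U₂ : Finset (Fin n)}
    (h₁ : HangsOff S T U₁) (h₂ : HangsOff T S U₂) {b₁ b₂ : ℝ}
    (hb₁ : b₁ = gainNoise n K q lam (S \ T).card U₁.card ∨
      b₁ = gainSignal n K lam (S \ T).card U₁.card)
    (hb₂ : b₂ = gainNoise n K q lam (T \ S).card U₂.card ∨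
      b₂ = gainSignal n K lam (T \ S).card U₂.card) :
    Ez (crossMean (K := K) q lam S T) ^ 2 * (n : ℝ) ^ (U₁.card + U₂.card) ≤
      b₁ * b₂ * (Ez (fun z : Fin n → Fin K => ∏ e ∈ S, sqMean q lam z e) *
        Ez (fun z : Fin n → Fin K => ∏ e ∈ T, sqMean q lam z e)) := by
  have hqb := P.qb_pos
  have hl := P.lam_pos
  have hK := P.K_pos
  have hn := P.n_pos
  have a1 := P.hangs_one h₁
  have a2 := P.hangs_one h₂
  have a3 := P.hangs_two h₁
  have a4 := P.hangs_two h₂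
  have c1 := P.pow_mul_Ez_le S T
  have c2 := P.pow_mul_Ez_le T S
  have c3 := P.lam_pow_mul_Ez_le S T
  have c4 := P.lam_pow_mul_Ez_le T S
  rw [inter_comm T S] at a2 a4 c2 c4
  rw [symmDiff_comm T S] at a4
  have hN : Ez (crossMean (K := K) q lam S T) = lam ^ ((S \ T).card + (T \ S).card) *
      Ez (fun z : Fin n → Fin K => (∏ e ∈ S ∩ T, sqMean q lam z e) * xprod (symmDiff S T) z) := by
    rw [← Ez_const_mul]
    congr 1
    funext z
    rw [crossMean_eq, show symmDiff S T = (S \ T) ∪ (T \ S) from rfl,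
      card_union_of_disjoint disjoint_sdiff_sdiff]
  rw [hN]
  have hF : ∀ z : Fin n → Fin K, 0 ≤ ∏ e ∈ S ∩ T, sqMean q lam z e :=
    fun z => prod_nonneg fun e _ => (P.sqMean_pos z e).le
  have hF0 : 0 ≤ Ez (fun z : Fin n → Fin K => ∏ e ∈ S ∩ T, sqMean q lam z e) := Ez_nonneg hF
  have hX0 : 0 ≤ Ez (fun z : Fin n → Fin K =>
      (∏ e ∈ S ∩ T, sqMean q lam z e) * xprod (symmDiff S T) z) :=
    Ez_nonneg fun z => mul_nonneg (hF z) (xprod_nonneg _ _)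
  have hX1 : 0 ≤ Ez (fun z : Fin n → Fin K =>
      (∏ e ∈ S ∩ T, sqMean q lam z e) * xprod (S \ T) z) :=
    Ez_nonneg fun z => mul_nonneg (hF z) (xprod_nonneg _ _)
  have hX2 : 0 ≤ Ez (fun z : Fin n → Fin K =>
      (∏ e ∈ S ∩ T, sqMean q lam z e) * xprod (T \ S) z) :=
    Ez_nonneg fun z => mul_nonneg (hF z) (xprod_nonneg _ _)
  set F₀ := Ez (fun z : Fin n → Fin K => ∏ e ∈ S ∩ T, sqMean q lam z e)
  set X := Ez (fun z : Fin n → Fin K =>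
    (∏ e ∈ S ∩ T, sqMean q lam z e) * xprod (symmDiff S T) z)
  set X₁ := Ez (fun z : Fin n → Fin K => (∏ e ∈ S ∩ T, sqMean q lam z e) * xprod (S \ T) z)
  set X₂ := Ez (fun z : Fin n → Fin K => (∏ e ∈ S ∩ T, sqMean q lam z e) * xprod (T \ S) z)
  set D₁ := Ez (fun z : Fin n → Fin K => ∏ e ∈ S, sqMean q lam z e)
  set D₂ := Ez (fun z : Fin n → Fin K => ∏ e ∈ T, sqMean q lam z e)
  unfold gainNoise gainSignal at hb₁ hb₂
  set qb := q * (1 - q)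
  set e₁ := (S \ T).card
  set e₂ := (T \ S).card
  set u₁ := U₁.card
  set u₂ := U₂.card
  have hk₁ : 0 < (K : ℝ) ^ u₁ := by positivity
  have hk₂ : 0 < (K : ℝ) ^ u₂ := by positivity
  -- it suffices to compare the averages
  have finish : ∀ γ₁ γ₂ G₁ G₂ κ : ℝ, 0 < γ₁ → 0 < γ₂ → 0 < κ → 0 ≤ G₁ → 0 ≤ G₂ → γ₁ * G₁ ≤ D₁ →
      γ₂ * G₂ ≤ D₂ → κ * X ^ 2 ≤ G₁ * G₂ →
      b₁ * b₂ = (lam ^ (e₁ + e₂)) ^ 2 / (γ₁ * γ₂) * (n : ℝ) ^ (u₁ + u₂) / κ →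
      (lam ^ (e₁ + e₂) * X) ^ 2 * (n : ℝ) ^ (u₁ + u₂) ≤ b₁ * b₂ * (D₁ * D₂) := by
    intro γ₁ γ₂ G₁ G₂ κ hγ₁ hγ₂ hκ hG₁ hG₂ h1 h2 h3 hb
    have h4 : γ₁ * γ₂ * (κ * X ^ 2) ≤ D₁ * D₂ :=
      calc γ₁ * γ₂ * (κ * X ^ 2) ≤ γ₁ * γ₂ * (G₁ * G₂) := by gcongr
        _ = (γ₁ * G₁) * (γ₂ * G₂) := by ring
        _ ≤ D₁ * D₂ := by gcongr; exact (mul_nonneg hγ₁.le hG₁).trans h1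
    rw [hb]
    calc (lam ^ (e₁ + e₂) * X) ^ 2 * (n : ℝ) ^ (u₁ + u₂)
        = (lam ^ (e₁ + e₂)) ^ 2 / (γ₁ * γ₂) * (n : ℝ) ^ (u₁ + u₂) / κ * (γ₁ * γ₂ * (κ * X ^ 2)) := by
          field_simp
      _ ≤ _ := by gcongr
  -- Each side is compared at the noise or the signal level. `G₁` and `G₂` are the averages left by
  -- these lower bounds. A noise side leaves no indicator of its own edges, so more hanging sets can
  -- be averaged out: κ is K^(2u₁ + 2u₂) when both sides are noise, and each signal side replaces
  -- its exponent 2u by u.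
  rcases hb₁ with hb₁ | hb₁ <;> rcases hb₂ with hb₂ | hb₂
  · refine finish (qb ^ e₁) (qb ^ e₂) F₀ F₀ (((K : ℝ) ^ u₁ * (K : ℝ) ^ u₂) ^ 2) (by positivity)
      (by positivity) (by positivity) hF0 hF0 c1 c2 ?_ ?_
    · have : (K : ℝ) ^ u₁ * (K : ℝ) ^ u₂ * X ≤ F₀ := by nlinarith
      rw [← mul_pow, ← sq]
      exact pow_le_pow_left₀ (by positivity) this 2
    · rw [hb₁, hb₂]; simp only [div_pow, mul_pow, pow_add, ← pow_mul]; field_simp; ring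
  · refine finish (qb ^ e₁) (lam ^ e₂) F₀ X₂ ((K : ℝ) ^ u₂ * ((K : ℝ) ^ u₁) ^ 2) (by positivity)
      (by positivity) (by positivity) hF0 hX2 c1 c4 ?_ ?_
    · calc (K : ℝ) ^ u₂ * ((K : ℝ) ^ u₁) ^ 2 * X ^ 2
          = (K : ℝ) ^ u₂ * (((K : ℝ) ^ u₁ * X) * ((K : ℝ) ^ u₁ * X)) := by ring
        _ ≤ (K : ℝ) ^ u₂ * (X₂ * X₂) := by gcongr
        _ = ((K : ℝ) ^ u₂ * X₂) * X₂ := by ring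
        _ ≤ F₀ * X₂ := by gcongr
    · rw [hb₁, hb₂]; simp only [div_pow, mul_pow, pow_add, ← pow_mul]; field_simp; ring
  · refine finish (lam ^ e₁) (qb ^ e₂) X₁ F₀ ((K : ℝ) ^ u₁ * ((K : ℝ) ^ u₂) ^ 2) (by positivity)
      (by positivity) (by positivity) hX1 hF0 c3 c2 ?_ ?_
    · calc (K : ℝ) ^ u₁ * ((K : ℝ) ^ u₂) ^ 2 * X ^ 2
          = (K : ℝ) ^ u₁ * (((K : ℝ) ^ u₂ * X) * ((K : ℝ) ^ u₂ * X)) := by ring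
        _ ≤ (K : ℝ) ^ u₁ * (X₁ * X₁) := by gcongr
        _ = X₁ * ((K : ℝ) ^ u₁ * X₁) := by ring
        _ ≤ X₁ * F₀ := by gcongr
    · rw [hb₁, hb₂]; simp only [div_pow, mul_pow, pow_add, ← pow_mul]; field_simp; ring
  · refine finish (lam ^ e₁) (lam ^ e₂) X₁ X₂ ((K : ℝ) ^ u₁ * (K : ℝ) ^ u₂) (by positivity)
      (by positivity) (by positivity) hX1 hX2 c3 c4 ?_ ?_
    · calc (K : ℝ) ^ u₁ * (K : ℝ) ^ u₂ * X ^ 2 = ((K : ℝ) ^ u₂ * X) * ((K : ℝ) ^ u₁ * X) := by ring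
        _ ≤ X₁ * X₂ := by gcongr
    · rw [hb₁, hb₂]; simp only [div_pow, mul_pow, pow_add, ← pow_mul]; field_simp; ring

/-- The squared main estimate when an unmatched edge joins two nodes that do not hang. -/
theorem sq_Ez_crossMean_le_dense {S T : Finset (Sym2 (Fin n))} {U₁ : Finset (Fin n)}
    (h₁ : HangsOff S T U₁) (hT : (T \ S).Nonempty) (hdiag : ∀ e ∈ T, ¬ e.IsDiag)
    (hSD : S.card ≤ D) (hTD : T.card ≤ D) (hlam : eps D c ^ 8 < lam) (hKn : n < K ^ 2) :
    Ez (crossMean (K := K) q lam S T) ^ 2 * (n : ℝ) ^ U₁.card ≤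
      4 * eps D c ^ (16 * (symmDiff S T).card) *
        (Ez (fun z : Fin n → Fin K => ∏ e ∈ S, sqMean q lam z e) *
          Ez (fun z : Fin n → Fin K => ∏ e ∈ T, sqMean q lam z e)) := by
  have hqb := P.qb_pos
  have hl := P.lam_pos
  have hK := P.K_pos
  have hn := P.n_pos
  have he := P.eps_pos
  obtain ⟨f, hf⟩ := hT
  induction f with
  | _ i j =>
  have hfT := (mem_sdiff.1 hf).1
  have hi : i ∉ U₁ := fun h => h₁.not_touches _ hfT ⟨i, by simp, h⟩
  have hj : j ∉ U₁ := fun h => h₁.not_touches _ hfT ⟨j, by simp, h⟩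
  have hij : i ≠ j := by simpa using hdiag _ hfT
  -- Neither endpoint of the unmatched edge {i, j} of T lies in `U₁`, so i hangs on j. This extra
  -- hanging node gains 1/K, and after squaring the 1/K² required by `dense_bound`.
  have hhang : Hanging (symmDiff S T) (insert i U₁) := by
    intro W hW hne
    by_cases hiW : i ∈ W
    · refine ⟨s(i, j), mem_symmDiff.2 (Or.inr (mem_sdiff.1 hf)), i, j, rfl, hiW, fun hjW => ?_⟩
      rcases mem_insert.1 (hW hjW) with h | h
      exacts [hij h.symm, hj h]
    · obtain ⟨e, he, hc⟩ := h₁.hanging_sdiff W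
        (fun v hv => (mem_insert.1 (hW hv)).resolve_left fun h => hiW (h ▸ hv)) hne
      exact ⟨e, mem_symmDiff.2 (Or.inl (mem_sdiff.1 he)), hc⟩
  have hx := Ez_xprod_le_of_hanging P.K_ne hhang
  rw [card_insert_of_notMem hi] at hx
  set u := U₁.card
  set d := (symmDiff S T).card with hd
  set m := (S ∩ T).card with hm
  set X := Ez (K := K) (xprod (symmDiff S T)) with hX
  have hX0 : 0 ≤ X := Ez_nonneg fun z => xprod_nonneg _ _
  set M := q * (1 - q) * (1 + lam / (q * (1 - q))) with hM
  have hM0 : 0 < M := by positivity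
  have hN : Ez (crossMean (K := K) q lam S T) ≤ lam ^ d * M ^ m * X := by
    rw [hX, ← Ez_const_mul]
    refine Ez_mono fun z => ?_
    rw [crossMean_eq, mul_assoc]
    refine mul_le_mul_of_nonneg_left (mul_le_mul_of_nonneg_right ?_ (xprod_nonneg _ _))
      (by positivity)
    rw [hm, ← prod_const]
    exact prod_le_prod (fun e _ => (P.sqMean_pos z e).le) fun e _ => P.sqMean_le z e
  have hN0 : 0 ≤ Ez (crossMean (K := K) q lam S T) := Ez_nonneg (P.posComb_crossMean S T).nonneg
  have hX' : X ≤ 1 / (K : ℝ) ^ (u + 1) := by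
    rw [le_div_iff₀ (by positivity)]; linarith
  have hlow : ∀ S : Finset (Sym2 (Fin n)), (q * (1 - q)) ^ S.card ≤
      Ez (fun z : Fin n → Fin K => ∏ e ∈ S, sqMean q lam z e) := by
    intro S
    have := P.pow_mul_Ez_le S ∅
    simpa [Ez_one P.K_ne] using this
  have hcard : S.card + T.card = d + 2 * m := by
    have h1 := card_sdiff_add_card_inter S T
    have h2 := card_sdiff_add_card_inter T S
    rw [inter_comm] at h2
    have h3 : d = (S \ T).card + (T \ S).card := card_union_of_disjoint disjoint_sdiff_sdiff
    omega
  have hdense := P.dense_bound hlam hKn (e := d) (m := m) (u := u) (by omega)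
  calc Ez (crossMean (K := K) q lam S T) ^ 2 * (n : ℝ) ^ u
      ≤ (lam ^ d * M ^ m * (1 / (K : ℝ) ^ (u + 1))) ^ 2 * (n : ℝ) ^ u := by
        gcongr
        exact hN.trans (by gcongr)
    _ = (lam ^ 2 / (q * (1 - q))) ^ d * (1 + lam / (q * (1 - q))) ^ (2 * m) *
      ((n : ℝ) / (K : ℝ) ^ 2) ^ u / (K : ℝ) ^ 2 *
        ((q * (1 - q)) ^ S.card * (q * (1 - q)) ^ T.card) := by
        rw [← pow_add, hcard, hM]
        generalize 1 + lam / (q * (1 - q)) = t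
        generalize q * (1 - q) = qb at hqb
        simp only [div_pow, mul_pow, pow_add, one_pow, pow_one, ← pow_mul]
        field_simp
        ring
    _ ≤ _ := by
        have := pow_pos hqb S.card
        exact mul_le_mul hdense (mul_le_mul (hlow S) (hlow T) (by positivity)
          (this.le.trans (hlow S))) (by positivity) (by positivity)

/-- The squared main estimate. -/
theorem sq_Ez_crossMean_le {S T : Finset (Sym2 (Fin n))} {U₁ U₂ : Finset (Fin n)}
    (h₁ : HangsOff S T U₁) (h₂ : HangsOff T S U₂) (hS : ∀ e ∈ S, ¬ e.IsDiag)
    (hT : ∀ e ∈ T, ¬ e.IsDiag) (hSD : S.card ≤ D) (hTD : T.card ≤ D) :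
    Ez (crossMean (K := K) q lam S T) ^ 2 * (n : ℝ) ^ (U₁.card + U₂.card) ≤
      4 * eps D c ^ (8 * (symmDiff S T).card) *
        (Ez (fun z : Fin n → Fin K => ∏ e ∈ S, sqMean q lam z e) *
          Ez (fun z : Fin n → Fin K => ∏ e ∈ T, sqMean q lam z e)) := by
  have he := P.eps_pos
  have hD0 : ∀ S : Finset (Sym2 (Fin n)),
      0 ≤ Ez (fun z : Fin n → Fin K => ∏ e ∈ S, sqMean q lam z e) :=
    fun S => Ez_nonneg fun z => prod_nonneg fun e _ => (P.sqMean_pos z e).le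
  have hDD := mul_nonneg (hD0 S) (hD0 T)
  have hcard : (symmDiff S T).card = (S \ T).card + (T \ S).card :=
    card_union_of_disjoint disjoint_sdiff_sdiff
  have hS' : (S \ T).card ≤ D := (card_le_card sdiff_subset).trans hSD
  have hT' : (T \ S).card ≤ D := (card_le_card sdiff_subset).trans hTD
  -- combine good gains on both sides
  have combine : ∀ b₁ b₂ : ℝ, 0 ≤ b₁ → 0 ≤ b₂ →
      (b₁ = gainNoise n K q lam (S \ T).card U₁.card ∨
        b₁ = gainSignal n K lam (S \ T).card U₁.card) →
      (b₂ = gainNoise n K q lam (T \ S).card U₂.card ∨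
        b₂ = gainSignal n K lam (T \ S).card U₂.card) →
      b₁ ≤ eps D c ^ (8 * (S \ T).card) → b₂ ≤ eps D c ^ (8 * (T \ S).card) →
      Ez (crossMean (K := K) q lam S T) ^ 2 * (n : ℝ) ^ (U₁.card + U₂.card) ≤
      4 * eps D c ^ (8 * (symmDiff S T).card) *
        (Ez (fun z : Fin n → Fin K => ∏ e ∈ S, sqMean q lam z e) *
          Ez (fun z : Fin n → Fin K => ∏ e ∈ T, sqMean q lam z e)) := by
    intro b₁ b₂ h1 h2 hb₁ hb₂ h3 h4
    refine (P.sq_Ez_crossMean_le_gain h₁ h₂ hb₁ hb₂).trans (mul_le_mul_of_nonneg_right ?_ hDD)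
    rw [hcard, mul_add, pow_add]
    have : b₁ * b₂ ≤ eps D c ^ (8 * (S \ T).card) * eps D c ^ (8 * (T \ S).card) := by gcongr
    have h5 : 0 < eps D c ^ (8 * (S \ T).card) * eps D c ^ (8 * (T \ S).card) := by positivity
    linarith
  have weaken : ∀ k, eps D c ^ (16 * k) ≤ eps D c ^ (8 * k) := fun k => P.eps_pow_le (by omega)
  -- For small λ each side is handled alone: with no unmatched node the signal gain is just λ^e, and
  -- otherwise the signal condition applies.
  by_cases hlam : lam ≤ eps D c ^ 8
  · have side : ∀ e u, u ≤ e → e ≤ D → ∃ b, 0 ≤ b ∧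
        (b = gainNoise n K q lam e u ∨ b = gainSignal n K lam e u) ∧ b ≤ eps D c ^ (8 * e) := by
      intro e u hue heD
      rcases Nat.eq_zero_or_pos u with rfl | hu
      · exact ⟨_, P.gainSignal_nonneg _ _, Or.inr rfl, P.gainSignal_zero hlam e⟩
      · rcases P.signal_nat hu hue heD with h | h
        · exact ⟨_, P.gainNoise_nonneg _ _, Or.inl rfl, h.trans (weaken e)⟩
        · exact ⟨_, P.gainSignal_nonneg _ _, Or.inr rfl, h.trans (weaken e)⟩
    obtain ⟨b₁, p1, p2, p3⟩ := side _ _ h₁.card_le hS'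
    obtain ⟨b₂, q1, q2, q3⟩ := side _ _ h₂.card_le hT'
    exact combine b₁ b₂ p1 q1 p2 q2 p3 q3
  · rw [not_le] at hlam
    -- For large λ the noise gain is small on each side, except possibly on a side with unmatched
    -- edges but no unmatched node when n < K².
    by_cases hgood : K ^ 2 ≤ n ∨ ((1 ≤ U₁.card ∨ (S \ T).card = 0) ∧ (1 ≤ U₂.card ∨ (T \ S).card = 0))
    · have side : ∀ e u, u ≤ e → e ≤ D → (K ^ 2 ≤ n ∨ 1 ≤ u ∨ e = 0) →
          gainNoise n K q lam e u ≤ eps D c ^ (8 * e) := by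
        intro e u hue heD h
        rcases Nat.eq_zero_or_pos u with rfl | hu
        · rcases h with h | h | rfl
          · exact (P.gainNoise_zero hlam h e).trans (weaken e)
          · omega
          · simp [gainNoise]
        · exact (P.gainNoise_le hlam hu hue heD).trans (weaken e)
      refine combine _ _ (P.gainNoise_nonneg _ _) (P.gainNoise_nonneg _ _) (Or.inl rfl) (Or.inl rfl)
        (side _ _ h₁.card_le hS' ?_) (side _ _ h₂.card_le hT' ?_)
      · exact hgood.imp_right And.left
      · exact hgood.imp_right And.right
    · push Not at hgood
      obtain ⟨hKn, hbad⟩ := hgood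
      have w4 : 4 * eps D c ^ (16 * (symmDiff S T).card) ≤
          4 * eps D c ^ (8 * (symmDiff S T).card) := by
        have := weaken (symmDiff S T).card; linarith
      -- The failing side supplies the additional unmatched edge of the dense estimate. As it has no
      -- unmatched node, the power of n involves the other side only.
      by_cases hbad' : 1 ≤ U₁.card ∨ (S \ T).card = 0
      · obtain ⟨hu, hne⟩ := hbad hbad'
        have hu0 : U₂.card = 0 := by omega
        rw [hu0, add_zero]
        exact (P.sq_Ez_crossMean_le_dense h₁ (card_ne_zero.1 hne) hT hSD hTD hlam hKn).trans
          (mul_le_mul_of_nonneg_right w4 hDD)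
      · push Not at hbad'
        have hu0 : U₁.card = 0 := by omega
        rw [hu0, zero_add]
        have := P.sq_Ez_crossMean_le_dense h₂ (card_ne_zero.1 hbad'.2) hS hTD hSD hlam hKn
        rw [symmDiff_comm, mul_comm (Ez fun z : Fin n → Fin K => ∏ e ∈ T, sqMean q lam z e)] at this
        have hc : Ez (crossMean (K := K) q lam T S) = Ez (crossMean (K := K) q lam S T) := by
          congr 1; funext z; unfold crossMean; rw [inter_comm, symmDiff_comm]
        rw [hc] at this
        exact this.trans (mul_le_mul_of_nonneg_right w4 hDD)

/-- The squared mean of a monomial is much smaller than its second moment. -/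
theorem sq_Ez_le {S : Finset (Sym2 (Fin n))} (hne : S.Nonempty) (hS : ∀ e ∈ S, ¬ e.IsDiag)
    (hSD : S.card ≤ D) :
    Ez (fun z : Fin n → Fin K => ∏ e ∈ S, lam * xi z e) ^ 2 ≤
      eps D c ^ 16 * Ez (fun z : Fin n → Fin K => ∏ e ∈ S, sqMean q lam z e) := by
  have hl := P.lam_pos
  have hqb := P.qb_pos
  have hK := P.K_pos
  have hn := P.n_pos
  have he := P.eps_pos
  obtain ⟨f, hf⟩ := hne
  have hcard : 1 ≤ S.card := card_pos.2 ⟨f, hf⟩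
  have hE : Ez (fun z : Fin n → Fin K => ∏ e ∈ S, lam * xi z e) =
      lam ^ S.card * Ez (K := K) (xprod S) := by
    rw [← Ez_const_mul]; congr 1; funext z; exact prod_lam_xi S z
  have hX0 : 0 ≤ Ez (K := K) (xprod S) := Ez_nonneg fun z => xprod_nonneg _ _
  have hXK : Ez (K := K) (xprod S) ≤ 1 / K := by
    have h1 := Ez_xi_le_of_not_isDiag P.K_ne (hS f hf)
    have h2 : Ez (K := K) (xprod S) ≤ Ez (fun z : Fin n → Fin K => xi z f) := by
      refine Ez_mono fun z => ?_
      unfold xprod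
      rw [← mul_prod_erase S _ hf]
      exact mul_le_of_le_one_right (xi_nonneg _ _)
        (prod_le_one (fun _ _ => xi_nonneg _ _) fun _ _ => xi_le_one _ _)
    rw [le_div_iff₀ hK]
    calc _ ≤ Ez (fun z : Fin n → Fin K => xi z f) * K := by gcongr
      _ ≤ 1 := by linarith
  have hD1 : (q * (1 - q)) ^ S.card ≤ Ez (fun z : Fin n → Fin K => ∏ e ∈ S, sqMean q lam z e) := by
    have := P.pow_mul_Ez_le S ∅
    simpa [Ez_one P.K_ne] using this
  have hD2 : lam ^ S.card * Ez (K := K) (xprod S) ≤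
      Ez (fun z : Fin n → Fin K => ∏ e ∈ S, sqMean q lam z e) := by
    have := P.lam_pow_mul_Ez_le S ∅
    simpa using this
  have hD0 : 0 ≤ Ez (fun z : Fin n → Fin K => ∏ e ∈ S, sqMean q lam z e) := by
    exact le_trans (by positivity) hD1
  have hw : eps D c ^ (16 * S.card) ≤ eps D c ^ 16 := P.eps_pow_le (by omega)
  rw [hE]
  -- The signal condition is used at r = |S|, that is u = 1. In the noise case the mean is at most
  -- λ^|S| / K and 1/K² ≤ n/K². In the signal case λ^|S| is already small and one factor of the
  -- square is bounded by the second moment.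
  rcases P.signal_nat le_rfl hcard hSD with h | h
  · unfold gainNoise at h
    rw [pow_one] at h
    calc (lam ^ S.card * Ez (K := K) (xprod S)) ^ 2 ≤ (lam ^ S.card * (1 / K)) ^ 2 := by gcongr
      _ = (lam ^ 2 / (q * (1 - q))) ^ S.card * (1 / (K : ℝ) ^ 2) * (q * (1 - q)) ^ S.card := by
          rw [div_pow]; field_simp; ring
      _ ≤ (lam ^ 2 / (q * (1 - q))) ^ S.card * (n / (K : ℝ) ^ 2) * (q * (1 - q)) ^ S.card := by
          gcongr; linarith [P.K_le', P.two_le_K']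
      _ ≤ eps D c ^ 16 * (q * (1 - q)) ^ S.card := by gcongr; exact h.trans hw
      _ ≤ _ := by gcongr
  · unfold gainSignal at h
    rw [pow_one] at h
    have h1 : lam ^ S.card ≤ eps D c ^ 16 := by
      refine le_trans ?_ (h.trans hw)
      refine le_mul_of_one_le_right (by positivity) ?_
      rw [le_div_iff₀ hK, one_mul]; exact P.K_le'
    have h2 : Ez (K := K) (xprod S) ≤ 1 := by
      refine hXK.trans ?_
      rw [div_le_one hK]; linarith [P.two_le_K']
    calc (lam ^ S.card * Ez (K := K) (xprod S)) ^ 2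
        = (lam ^ S.card * Ez (K := K) (xprod S)) * (lam ^ S.card * Ez (K := K) (xprod S)) := sq _
      _ ≤ (eps D c ^ 16 * 1) * Ez (fun z : Fin n → Fin K => ∏ e ∈ S, sqMean q lam z e) := by gcongr
      _ = _ := by rw [mul_one]

end Params

/-! ### The expectation operator -/

/-- The conditional probability of the edge set `A` given `z`. -/
def edgeWeight (q lam : ℝ) (z : Fin n → Fin K) (A : Finset (Sym2 (Fin n))) : ℝ :=
  ∏ e ∈ pairs n, if e ∈ A then edgeProb q lam z e else 1 - edgeProb q lam z e

/-- The conditional expectation given `z`. -/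
def condE (q lam : ℝ) (f : Finset (Sym2 (Fin n)) → ℝ) (z : Fin n → Fin K) : ℝ :=
  ∑ A ∈ (pairs n).powerset, edgeWeight q lam z A * f A

/-- The monomial attached to `S`. -/
def mono (q : ℝ) (S A : Finset (Sym2 (Fin n))) : ℝ := ∏ e ∈ S, Y q A e

theorem prod_ite_mem_powerset {A : Finset (Sym2 (Fin n))} (hA : A ⊆ pairs n)
    (a b : Sym2 (Fin n) → ℝ) :
    (∏ e ∈ pairs n, if e ∈ A then a e else b e) = (∏ e ∈ A, a e) * ∏ e ∈ pairs n \ A, b e := by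
  rw [prod_ite, filter_mem_eq_inter, inter_eq_right.2 hA, ← sdiff_eq_filter]

theorem expect_eq (f : Finset (Sym2 (Fin n)) → ℝ) :
    expect n K q lam f = Ez (K := K) (condE q lam f) := by
  unfold expect Ez condE
  refine sum_congr rfl fun z _ => ?_
  congr 1
  refine sum_congr rfl fun A hA => ?_
  rw [edgeWeight, prod_ite_mem_powerset (mem_powerset.1 hA)]

/-- Independence of the edges given z: the sum over edge sets is the expansion of a product of
two-term sums. -/
theorem condE_prod (z : Fin n → Fin K) (a b : Sym2 (Fin n) → ℝ) :
    condE q lam (fun A => ∏ e ∈ pairs n, if e ∈ A then a e else b e) z =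
      ∏ e ∈ pairs n, (edgeProb q lam z e * a e + (1 - edgeProb q lam z e) * b e) := by
  unfold condE
  rw [prod_add]
  refine sum_congr rfl fun A hA => ?_
  rw [edgeWeight, ← prod_mul_distrib, ← prod_ite_mem_powerset (mem_powerset.1 hA)]
  refine prod_congr rfl fun e _ => ?_
  split_ifs <;> rfl

theorem mono_eq {S A : Finset (Sym2 (Fin n))} (hS : S ⊆ pairs n) :
    mono q S A = ∏ e ∈ pairs n, if e ∈ S then Y q A e else 1 := by
  rw [mono, prod_ite_mem_powerset hS]; simp

theorem condE_mono_mul_mono (z : Fin n → Fin K) {S T : Finset (Sym2 (Fin n))} (hS : S ⊆ pairs n)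
    (hT : T ⊆ pairs n) :
    condE q lam (fun A => mono q S A * mono q T A) z = crossMean q lam S T z := by
  have h : (fun A => mono q S A * mono q T A) = fun A => ∏ e ∈ pairs n, if e ∈ A then
      (if e ∈ S then 1 - q else 1) * (if e ∈ T then 1 - q else 1) else
      (if e ∈ S then 0 - q else 1) * (if e ∈ T then 0 - q else 1) := by
    funext A
    rw [mono_eq hS, mono_eq hT, ← prod_mul_distrib]
    refine prod_congr rfl fun e _ => ?_
    unfold Y
    split_ifs <;> rfl
  rw [h, condE_prod]
  have h2 : crossMean q lam S T z = ∏ e ∈ pairs n,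
      (if e ∈ S ∩ T then sqMean q lam z e else 1) *
        (if e ∈ symmDiff S T then lam * xi z e else 1) := by
    rw [prod_mul_distrib, prod_ite_mem_powerset (inter_subset_left.trans hS),
      prod_ite_mem_powerset]
    · simp [crossMean]
    · intro e he
      rcases mem_symmDiff.1 he with h | h
      exacts [hS h.1, hT h.1]
  rw [h2]
  refine prod_congr rfl fun e _ => ?_
  have hp : edgeProb q lam z e = q + lam * xi z e := rfl
  by_cases h1 : e ∈ S <;> by_cases h2 : e ∈ T <;>
    simp only [h1, h2, mem_inter, mem_symmDiff, hp, sqMean, if_true, if_false, and_true,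
      and_false, not_true, not_false_iff, or_self, or_false, false_or] <;> ring

theorem expect_mono_mul_mono {S T : Finset (Sym2 (Fin n))} (hS : S ⊆ pairs n)
    (hT : T ⊆ pairs n) :
    expect n K q lam (fun A => mono q S A * mono q T A) = Ez (crossMean (K := K) q lam S T) := by
  rw [expect_eq]
  congr 1
  funext z
  exact condE_mono_mul_mono z hS hT

theorem crossMean_self (S : Finset (Sym2 (Fin n))) (z : Fin n → Fin K) :
    crossMean q lam S S z = ∏ e ∈ S, sqMean q lam z e := by
  simp [crossMean]

theorem crossMean_empty (S : Finset (Sym2 (Fin n))) (z : Fin n → Fin K) :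
    crossMean q lam S ∅ z = ∏ e ∈ S, lam * xi z e := by
  rw [crossMean, inter_empty, prod_empty, one_mul,
    show symmDiff S (∅ : Finset (Sym2 (Fin n))) = S from symmDiff_bot S]

theorem expect_mono {S : Finset (Sym2 (Fin n))} (hS : S ⊆ pairs n) :
    expect n K q lam (mono q S) = Ez (fun z : Fin n → Fin K => ∏ e ∈ S, lam * xi z e) := by
  have := expect_mono_mul_mono (K := K) (q := q) (lam := lam) hS (empty_subset _)
  simp only [mono, prod_empty, mul_one] at this
  exact this.trans (congrArg Ez (funext fun z => crossMean_empty S z))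

theorem expect_mono_sq {S : Finset (Sym2 (Fin n))} (hS : S ⊆ pairs n) :
    expect n K q lam (fun A => mono q S A ^ 2) =
      Ez (fun z : Fin n → Fin K => ∏ e ∈ S, sqMean q lam z e) := by
  simp only [sq]
  rw [expect_mono_mul_mono hS hS]
  exact congrArg Ez (funext fun z => crossMean_self S z)

theorem condE_one (z : Fin n → Fin K) : condE q lam (fun _ => 1) z = 1 := by
  have := condE_mono_mul_mono (q := q) (lam := lam) z (empty_subset _) (empty_subset _)
  simpa [mono, crossMean] using this

theorem expect_one (hK : K ≠ 0) : expect n K q lam (fun _ => 1) = 1 := by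
  rw [expect_eq, show condE q lam (fun _ => 1) = fun _ : Fin n → Fin K => (1 : ℝ) from
    funext condE_one, Ez_one hK]

theorem expect_add (f g : Finset (Sym2 (Fin n)) → ℝ) :
    expect n K q lam (fun A => f A + g A) = expect n K q lam f + expect n K q lam g := by
  simp only [expect_eq, ← Ez_add]
  congr 1
  funext z
  simp [condE, mul_add, sum_add_distrib]

theorem expect_const_mul (a : ℝ) (f : Finset (Sym2 (Fin n)) → ℝ) :
    expect n K q lam (fun A => a * f A) = a * expect n K q lam f := by
  simp only [expect_eq, ← Ez_const_mul]
  congr 1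
  funext z
  simp only [condE, mul_sum]
  exact sum_congr rfl fun _ _ => by ring

theorem expect_const (hK : K ≠ 0) (a : ℝ) : expect n K q lam (fun _ => a) = a := by
  have := expect_const_mul (n := n) (K := K) (q := q) (lam := lam) a fun _ => 1
  simpa [expect_one hK] using this

theorem expect_sub (f g : Finset (Sym2 (Fin n)) → ℝ) :
    expect n K q lam (fun A => f A - g A) = expect n K q lam f - expect n K q lam g := by
  have h := expect_add (K := K) (q := q) (lam := lam) f fun A => -1 * g A
  rw [expect_const_mul] at h
  simpa [sub_eq_add_neg] using h

theorem expect_sum {ι : Type*} (s : Finset ι) (f : ι → Finset (Sym2 (Fin n)) → ℝ) :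
    expect n K q lam (fun A => ∑ i ∈ s, f i A) = ∑ i ∈ s, expect n K q lam (f i) := by
  classical
  induction s using Finset.induction_on with
  | empty =>
    have := expect_const_mul (n := n) (K := K) (q := q) (lam := lam) 0 fun _ => 1
    simpa using this
  | insert a s ha ih => simp only [sum_insert ha, expect_add, ih]

theorem edgeProb_mem (hq : 0 ≤ q) (hlam : 0 ≤ lam) (h : q + lam ≤ 1) (z : Fin n → Fin K)
    (e : Sym2 (Fin n)) : 0 ≤ edgeProb q lam z e ∧ edgeProb q lam z e ≤ 1 := by
  unfold edgeProb
  split_ifs <;> constructor <;> linarith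

theorem Params.expect_nonneg (P : Params n K D q lam c) {f : Finset (Sym2 (Fin n)) → ℝ}
    (hf : ∀ A, 0 ≤ f A) : 0 ≤ expect n K q lam f := by
  rw [expect_eq]
  refine Ez_nonneg fun z => sum_nonneg fun A _ => mul_nonneg (prod_nonneg fun e _ => ?_) (hf A)
  have := edgeProb_mem P.q_pos.le P.lam_pos.le (by linarith [P.q_lam, P.lam_pos]) z e
  split_ifs <;> linarith

/-! ### Independence of local functions -/

/-- `f` depends only on the edges inside `V`. -/
def LocalOn (V : Finset (Fin n)) (f : Finset (Sym2 (Fin n)) → ℝ) : Prop :=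
  ∀ A B, (∀ e, (∀ v ∈ e, v ∈ V) → (e ∈ A ↔ e ∈ B)) → f A = f B

namespace LocalOn

variable {V W : Finset (Fin n)} {f g : Finset (Sym2 (Fin n)) → ℝ}

theorem mono' (hf : LocalOn V f) (h : V ⊆ W) : LocalOn W f :=
  fun A B hAB => hf A B fun e he => hAB e fun v hv => h (he v hv)

theorem mul (hf : LocalOn V f) (hg : LocalOn V g) : LocalOn V fun A => f A * g A :=
  fun A B h => by simp only [hf A B h, hg A B h]

theorem pow (hf : LocalOn V f) (k : ℕ) : LocalOn V fun A => f A ^ k :=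
  fun A B h => by simp only [hf A B h]

theorem sub_const (hf : LocalOn V f) (a : ℝ) : LocalOn V fun A => f A - a :=
  fun A B h => by simp only [hf A B h]

theorem prod {ι : Type*} (s : Finset ι) {f : ι → Finset (Sym2 (Fin n)) → ℝ}
    (hf : ∀ i ∈ s, LocalOn V (f i)) : LocalOn V fun A => ∏ i ∈ s, f i A :=
  fun A B h => prod_congr rfl fun i hi => hf i hi A B h

end LocalOn

theorem localOn_mono {S : Finset (Sym2 (Fin n))} {V : Finset (Fin n)}
    (h : ∀ e ∈ S, ∀ v ∈ e, v ∈ V) : LocalOn V (mono q S) := by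
  intro A B hAB
  refine prod_congr rfl fun e he => ?_
  unfold Y
  simp only [hAB e (h e he)]

/-- `A` with its part in `T` replaced by the one of `B`. -/
def exchange (T A B : Finset (Sym2 (Fin n))) : Finset (Sym2 (Fin n)) := (B ∩ T) ∪ (A \ T)

theorem mem_exchange {T A B : Finset (Sym2 (Fin n))} {e : Sym2 (Fin n)} :
    e ∈ exchange T A B ↔ if e ∈ T then e ∈ B else e ∈ A := by
  unfold exchange
  split_ifs with h <;> simp [h]

theorem exchange_exchange (T A B : Finset (Sym2 (Fin n))) :
    exchange T (exchange T A B) (exchange T B A) = A := by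
  ext e
  simp only [mem_exchange]
  split_ifs <;> rfl

theorem edgeWeight_exchange {T A B : Finset (Sym2 (Fin n))} {z z' : Fin n → Fin K}
    (h : ∀ e ∈ T, edgeProb q lam z e = edgeProb q lam z' e) :
    edgeWeight q lam z (exchange T A B) * edgeWeight q lam z' (exchange T B A) =
      edgeWeight q lam z A * edgeWeight q lam z' B := by
  unfold edgeWeight
  rw [← prod_mul_distrib, ← prod_mul_distrib]
  refine prod_congr rfl fun e _ => ?_
  simp only [mem_exchange]
  by_cases hT : e ∈ T
  · simp only [hT, if_true, h e hT]
    rw [mul_comm]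
  · simp only [hT, if_false]

/-- Two independent edge sets, drawn under z and z', may swap their parts in T when their edge
probabilities agree on T: the swap is a weight-preserving involution. Independence of local
functions is derived from this symmetry. -/
theorem sum_exchange {T : Finset (Sym2 (Fin n))} {z z' : Fin n → Fin K}
    (h : ∀ e ∈ T, edgeProb q lam z e = edgeProb q lam z' e)
    (F : Finset (Sym2 (Fin n)) → Finset (Sym2 (Fin n)) → ℝ) :
    ∑ p ∈ (pairs n).powerset ×ˢ (pairs n).powerset,
        edgeWeight q lam z p.1 * edgeWeight q lam z' p.2 * F (exchange T p.1 p.2) (exchange T p.2 p.1) =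
      ∑ p ∈ (pairs n).powerset ×ˢ (pairs n).powerset,
        edgeWeight q lam z p.1 * edgeWeight q lam z' p.2 * F p.1 p.2 := by
  have hmem : ∀ p ∈ (pairs n).powerset ×ˢ (pairs n).powerset,
      (exchange T p.1 p.2, exchange T p.2 p.1) ∈ (pairs n).powerset ×ˢ (pairs n).powerset := by
    intro p hp
    simp only [mem_product, mem_powerset] at hp ⊢
    refine ⟨fun e he => ?_, fun e he => ?_⟩ <;> rw [mem_exchange] at he <;> split_ifs at he
    exacts [hp.2 he, hp.1 he, hp.1 he, hp.2 he]
  refine sum_nbij' (fun p => (exchange T p.1 p.2, exchange T p.2 p.1))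
    (fun p => (exchange T p.1 p.2, exchange T p.2 p.1)) hmem hmem ?_ ?_ ?_
  · intro p _; simp only [exchange_exchange]
  · intro p _; simp only [exchange_exchange]
  · intro p _; simp only [edgeWeight_exchange h]

theorem sum_edgeWeight_mul (z z' : Fin n → Fin K) (f g : Finset (Sym2 (Fin n)) → ℝ) :
    ∑ p ∈ (pairs n).powerset ×ˢ (pairs n).powerset,
        edgeWeight q lam z p.1 * edgeWeight q lam z' p.2 * (f p.1 * g p.2) =
      condE q lam f z * condE q lam g z' := by
  unfold condE
  rw [sum_mul_sum, sum_product]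
  exact sum_congr rfl fun _ _ => sum_congr rfl fun _ _ => by ring

/-- The pairs inside `V`. -/
def within (V : Finset (Fin n)) : Finset (Sym2 (Fin n)) := {e | ∀ v ∈ e, v ∈ V}

theorem LocalOn.exchange_within {V : Finset (Fin n)} {f : Finset (Sym2 (Fin n)) → ℝ}
    (hf : LocalOn V f) (A B : Finset (Sym2 (Fin n))) : f (exchange (within V) A B) = f B := by
  refine hf _ _ fun e he => ?_
  rw [mem_exchange, if_pos]
  simpa [within] using he

theorem LocalOn.exchange_within_of_disjoint {V W : Finset (Fin n)}
    {f : Finset (Sym2 (Fin n)) → ℝ} (hf : LocalOn W f) (h : Disjoint V W)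
    (A B : Finset (Sym2 (Fin n))) : f (exchange (within V) A B) = f A := by
  refine hf _ _ fun e he => ?_
  rw [mem_exchange, if_neg]
  induction e with
  | _ i j =>
    intro hV
    simp only [within, mem_filter, mem_univ, true_and] at hV
    exact Finset.disjoint_left.1 h (hV i (by simp)) (he i (by simp))

/-- The product of expectations evaluates f on one copy and g on another. Swapping the pairs inside
V brings f to the copy of g and leaves g unaffected. -/
theorem condE_mul {V W : Finset (Fin n)} {f g : Finset (Sym2 (Fin n)) → ℝ} (hf : LocalOn V f)
    (hg : LocalOn W g) (h : Disjoint V W) (z : Fin n → Fin K) :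
    condE q lam (fun A => f A * g A) z = condE q lam f z * condE q lam g z := by
  rw [← sum_edgeWeight_mul, ← sum_exchange (T := within V) (fun _ _ => rfl) fun A B => f A * g B]
  have := sum_edgeWeight_mul (q := q) (lam := lam) z z (fun _ => 1) fun A => f A * g A
  rw [condE_one, one_mul] at this
  rw [← this]
  refine sum_congr rfl fun p _ => ?_
  rw [hf.exchange_within, hg.exchange_within_of_disjoint h, one_mul]

/-- The same swap between copies drawn under z and z': the edge probabilities inside V coincide. -/
theorem LocalOn.condE_congr {V : Finset (Fin n)} {f : Finset (Sym2 (Fin n)) → ℝ}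
    (hf : LocalOn V f) {z z' : Fin n → Fin K} (h : ∀ v ∈ V, z v = z' v) :
    condE q lam f z = condE q lam f z' := by
  have hp : ∀ e ∈ within V, edgeProb q lam z e = edgeProb q lam z' e := by
    intro e he
    simp only [within, mem_filter, mem_univ, true_and] at he
    unfold edgeProb
    rw [Sym2.map_congr fun v hv => h v (he v hv)]
  have h1 := sum_edgeWeight_mul (q := q) (lam := lam) z z' f fun _ => 1
  have h2 := sum_edgeWeight_mul (q := q) (lam := lam) z z' (fun _ => 1) f
  rw [condE_one, mul_one] at h1
  rw [condE_one, one_mul] at h2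
  rw [← h1, ← h2, ← sum_exchange hp fun A B => f A * 1]
  refine sum_congr rfl fun p _ => ?_
  rw [hf.exchange_within, mul_one, one_mul]

/-- The swap argument for assignments: two copies exchange their values on V. -/
theorem Ez_mul_of_disjoint (hK : K ≠ 0) {V : Finset (Fin n)} {F G : (Fin n → Fin K) → ℝ}
    (hF : ∀ z z', (∀ v ∈ V, z v = z' v) → F z = F z')
    (hG : ∀ z z', (∀ v, v ∉ V → z v = z' v) → G z = G z') :
    Ez (fun z => F z * G z) = Ez F * Ez G := by
  classical
  let mix : (Fin n → Fin K) → (Fin n → Fin K) → (Fin n → Fin K) :=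
    fun z z' v => if v ∈ V then z' v else z v
  have hmm : ∀ z z', mix (mix z z') (mix z' z) = z := by
    intro z z'; funext v; simp only [mix]; split_ifs <;> rfl
  have hprod : ∀ F G : (Fin n → Fin K) → ℝ, Ez F * Ez G =
      ∑ p : (Fin n → Fin K) × (Fin n → Fin K),
        (1 / (K : ℝ)) ^ n * (1 / (K : ℝ)) ^ n * (F p.1 * G p.2) := by
    intro F G
    unfold Ez
    rw [sum_mul_sum, Fintype.sum_prod_type]
    exact sum_congr rfl fun _ _ => sum_congr rfl fun _ _ => by ring
  have h1 := hprod (fun _ => 1) fun z => F z * G z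
  rw [Ez_one hK, one_mul] at h1
  rw [h1, hprod]
  refine sum_nbij' (fun p => (mix p.1 p.2, mix p.2 p.1)) (fun p => (mix p.1 p.2, mix p.2 p.1))
    (by simp) (by simp) ?_ ?_ ?_
  · intro p _; simp only [hmm]
  · intro p _; simp only [hmm]
  · intro p _
    simp only [one_mul]
    rw [hF (mix p.1 p.2) p.2 fun v hv => by simp [mix, hv],
      hG (mix p.2 p.1) p.2 fun v hv => by simp [mix, hv]]

theorem expect_mul (hK : K ≠ 0) {V W : Finset (Fin n)} {f g : Finset (Sym2 (Fin n)) → ℝ}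
    (hf : LocalOn V f) (hg : LocalOn W g) (h : Disjoint V W) :
    expect n K q lam (fun A => f A * g A) = expect n K q lam f * expect n K q lam g := by
  simp only [expect_eq]
  rw [← Ez_mul_of_disjoint hK (V := V) (fun z z' hz => hf.condE_congr hz) fun z z' hz =>
    hg.condE_congr fun v hv => hz v fun hV => Finset.disjoint_left.1 h hV hv]
  congr 1
  funext z
  exact condE_mul hf hg h z

theorem expect_prod (hK : K ≠ 0) {ι : Type*} (s : Finset ι) {V : ι → Finset (Fin n)}
    {f : ι → Finset (Sym2 (Fin n)) → ℝ} (hf : ∀ i ∈ s, LocalOn (V i) (f i))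
    (hV : (s : Set ι).PairwiseDisjoint V) :
    expect n K q lam (fun A => ∏ i ∈ s, f i A) = ∏ i ∈ s, expect n K q lam (f i) := by
  classical
  induction s using Finset.induction_on with
  | empty => simp [expect_one hK]
  | insert a s ha ih =>
    simp only [prod_insert ha]
    rw [expect_mul hK (hf a (by simp)) (W := s.biUnion V), ih]
    · exact fun i hi => hf i (by simp [hi])
    · exact hV.subset (by simp)
    · exact LocalOn.prod _ fun i hi => (hf i (by simp [hi])).mono' (subset_biUnion_of_mem V hi)
    · rw [disjoint_biUnion_right]
      intro i hi
      exact hV (by simp) (by simp [hi]) (by rintro rfl; exact ha hi)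

/-! ### Connected parts of an edge set -/

/-- The nodes covered by the edges of `S`. -/
def verts (S : Finset (Sym2 (Fin n))) : Finset (Fin n) := {v | ∃ e ∈ S, v ∈ e}

theorem mem_verts {S : Finset (Sym2 (Fin n))} {v : Fin n} : v ∈ verts S ↔ ∃ e ∈ S, v ∈ e := by
  simp [verts]

theorem card_verts_le (S : Finset (Sym2 (Fin n))) : (verts S).card ≤ 2 * S.card := by
  have h : verts S ⊆ S.biUnion fun e => e.toFinset := by
    intro v hv
    obtain ⟨e, he, hve⟩ := mem_verts.1 hv
    exact mem_biUnion.2 ⟨e, he, by simpa using hve⟩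
  refine (card_le_card h).trans ((card_biUnion_le_card_mul _ _ 2 fun e _ => ?_).trans
    (mul_comm _ _).le)
  rw [Sym2.card_toFinset]
  split_ifs <;> omega

/-- `𝓟` is the family of the connected parts of `S`. -/
structure IsParts (S : Finset (Sym2 (Fin n))) (𝓟 : Finset (Finset (Sym2 (Fin n)))) : Prop where
  nonempty : ∀ p ∈ 𝓟, p.Nonempty
  subset : ∀ p ∈ 𝓟, p ⊆ S
  cover : ∀ e ∈ S, ∃ p ∈ 𝓟, e ∈ p
  disjoint : (𝓟 : Set (Finset (Sym2 (Fin n)))).PairwiseDisjoint verts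
  connected : ∀ p ∈ 𝓟, ∀ W, (∀ e ∈ S, ¬ Crosses W e) → ¬ Disjoint (verts p) W → verts p ⊆ W

theorem mem_of_not_crosses {W : Finset (Fin n)} {e : Sym2 (Fin n)} (h : ¬ Crosses W e)
    {v w : Fin n} (hv : v ∈ e) (hvW : v ∈ W) (hw : w ∈ e) : w ∈ W := by
  by_contra hwW
  have hne : v ≠ w := by rintro rfl; exact hwW hvW
  exact h ⟨v, w, (Sym2.mem_and_mem_iff hne).1 ⟨hv, hw⟩, hvW, hwW⟩

theorem Crosses.exists_mem {W : Finset (Fin n)} {e : Sym2 (Fin n)} (h : Crosses W e) :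
    (∃ v ∈ e, v ∈ W) ∧ ∃ w ∈ e, w ∉ W := by
  obtain ⟨v, w, rfl, hv, hw⟩ := h
  exact ⟨⟨v, by simp, hv⟩, w, by simp, hw⟩

namespace IsParts

variable {S T : Finset (Sym2 (Fin n))} {𝓟 𝓠 : Finset (Finset (Sym2 (Fin n)))}

theorem mem_of_touches (h : IsParts S 𝓟) {p : Finset (Sym2 (Fin n))} (hp : p ∈ 𝓟)
    {e : Sym2 (Fin n)} (he : e ∈ S) (ht : Touches (verts p) e) : e ∈ p := by
  obtain ⟨p', hp', hep'⟩ := h.cover e he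
  obtain ⟨v, hv, hvp⟩ := ht
  by_cases hpp : p' = p
  · exact hpp ▸ hep'
  · exact (Finset.disjoint_left.1 (h.disjoint hp' hp hpp) (mem_verts.2 ⟨e, hep', hv⟩) hvp).elim

theorem not_crosses (h : IsParts S 𝓟) {p : Finset (Sym2 (Fin n))} (hp : p ∈ 𝓟)
    {e : Sym2 (Fin n)} (he : e ∈ S) : ¬ Crosses (verts p) e := by
  intro hc
  obtain ⟨⟨v, hv, hvp⟩, w, hw, hwp⟩ := hc.exists_mem
  exact hwp (mem_verts.2 ⟨e, h.mem_of_touches hp he ⟨v, hv, hvp⟩, hw⟩)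

theorem touches_of_mem {p : Finset (Sym2 (Fin n))} {e : Sym2 (Fin n)} (he : e ∈ p) :
    Touches (verts p) e := by
  obtain ⟨v, hv⟩ : ∃ v, v ∈ e := by
    induction e with
    | _ i j => exact ⟨i, by simp⟩
  exact ⟨v, hv, mem_verts.2 ⟨e, he, hv⟩⟩

/-- A part of `S` which is not touched by the symmetric difference of `S` and `T` is a part
of `T`. -/
theorem mem_of_not_touches (hS : IsParts S 𝓟) (hT : IsParts T 𝓠) {p : Finset (Sym2 (Fin n))}
    (hp : p ∈ 𝓟) (h : ∀ e ∈ symmDiff S T, ¬ Touches (verts p) e) : p ∈ 𝓠 := by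
  have hST : ∀ e, Touches (verts p) e → (e ∈ S ↔ e ∈ T) := by
    intro e he
    have := fun h' => h e h' he
    rw [mem_symmDiff] at this
    tauto
  obtain ⟨e, he⟩ := hS.nonempty p hp
  have het := touches_of_mem he
  obtain ⟨p', hp', hep'⟩ := hT.cover e ((hST e het).1 (hS.subset p hp he))
  have hTp : ∀ f ∈ T, Touches (verts p) f → f ∈ p :=
    fun f hf ht => hS.mem_of_touches hp ((hST f ht).2 hf) ht
  have hsub : verts p' ⊆ verts p := by
    refine hT.connected p' hp' _ (fun f hf hc => ?_) fun hd => ?_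
    · exact hS.not_crosses hp (hS.subset p hp (hTp f hf hc.touches)) hc
    · obtain ⟨v, hv, hvp⟩ := het
      exact Finset.disjoint_left.1 hd (mem_verts.2 ⟨e, hep', hv⟩) hvp
  have hsub' : verts p ⊆ verts p' := by
    refine hS.connected p hp _ (fun f hf hc => ?_) fun hd => ?_
    · exact hT.not_crosses hp' ((hST f (hc.touches.mono hsub)).1 hf) hc
    · obtain ⟨v, hv, hvp⟩ := het
      exact Finset.disjoint_left.1 hd hvp (mem_verts.2 ⟨e, hep', hv⟩)
  have : p = p' := by
    ext f
    constructor
    · intro hf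
      have ht := touches_of_mem hf
      exact hT.mem_of_touches hp' ((hST f ht).1 (hS.subset p hp hf)) (ht.mono hsub')
    · intro hf
      exact hTp f (hT.subset p' hp' hf) ((touches_of_mem hf).mono hsub)
  exact this ▸ hp'

theorem unique (hS : IsParts S 𝓟) (hS' : IsParts S 𝓠) : 𝓟 = 𝓠 := by
  refine Subset.antisymm (fun p hp => hS.mem_of_not_touches hS' hp ?_)
    fun p hp => hS'.mem_of_not_touches hS hp ?_ <;> simp

theorem disjoint_edges (h : IsParts S 𝓟) : (𝓟 : Set (Finset (Sym2 (Fin n)))).PairwiseDisjoint id := by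
  intro p hp p' hp' hne
  refine Finset.disjoint_left.2 fun e he he' => ?_
  obtain ⟨v, hv, hvp⟩ := touches_of_mem (show e ∈ p from he)
  exact Finset.disjoint_left.1 (h.disjoint hp hp' hne) hvp (mem_verts.2 ⟨e, he', hv⟩)

theorem biUnion_eq (h : IsParts S 𝓟) : 𝓟.biUnion id = S := by
  ext e
  simp only [mem_biUnion, id]
  exact ⟨fun ⟨p, hp, he⟩ => h.subset p hp he, h.cover e⟩

theorem card_le (h : IsParts S 𝓟) : 𝓟.card ≤ S.card := by
  have := card_le_card_biUnion h.disjoint_edges h.nonempty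
  rwa [h.biUnion_eq] at this

/-- A part of S that is not a part of T contains a node touched by the symmetric difference. Parts
have disjoint node sets, so a choice of such nodes is injective, and k edges touch at most 2k nodes.
-/
theorem card_sdiff_le (hS : IsParts S 𝓟) (hT : IsParts T 𝓠) :
    (𝓟 \ 𝓠).card ≤ 2 * (symmDiff S T).card := by
  refine le_trans ?_ (card_verts_le _)
  have h : ∀ p ∈ 𝓟 \ 𝓠, ∃ v, v ∈ verts p ∧ v ∈ verts (symmDiff S T) := by
    intro p hp
    rw [mem_sdiff] at hp
    by_contra hno
    push Not at hno
    refine hp.2 (hS.mem_of_not_touches hT hp.1 fun e he ⟨v, hv, hvp⟩ => ?_)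
    exact hno v hvp (mem_verts.2 ⟨e, he, hv⟩)
  rcases (𝓟 \ 𝓠).eq_empty_or_nonempty with h0 | ⟨p₀, hp₀⟩
  · simp [h0]
  have : Nonempty (Fin n) := ⟨(h p₀ hp₀).choose⟩
  choose! φ hφ using h
  refine card_le_card_of_injOn φ (fun p hp => (hφ p hp).2) fun p hp p' hp' heq => ?_
  by_contra hne
  rw [mem_coe] at hp hp'
  refine Finset.disjoint_left.1 (hS.disjoint (mem_sdiff.1 hp).1 (mem_sdiff.1 hp').1 hne)
    (hφ p hp).1 ?_
  rw [heq]
  exact (hφ p' hp').1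

end IsParts

/-! ### Corrected monomials -/

/-- The corrected monomial of a family of parts. -/
def corr (n K : ℕ) (q lam : ℝ) (𝓟 : Finset (Finset (Sym2 (Fin n)))) (A : Finset (Sym2 (Fin n))) :
    ℝ :=
  ∏ p ∈ 𝓟, (mono q p A - expect n K q lam (mono q p))

theorem localOn_verts (p : Finset (Sym2 (Fin n))) : LocalOn (verts p) (mono q p) :=
  localOn_mono fun e he _ hv => mem_verts.2 ⟨e, he, hv⟩

theorem localOn_corr {V : Finset (Fin n)} {𝓟 : Finset (Finset (Sym2 (Fin n)))}
    (h : ∀ p ∈ 𝓟, verts p ⊆ V) : LocalOn V (corr n K q lam 𝓟) :=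
  LocalOn.prod _ fun p hp => ((localOn_verts p).sub_const _).mono' (h p hp)

theorem localOn_prod_mono {V : Finset (Fin n)} {𝓟 : Finset (Finset (Sym2 (Fin n)))}
    (h : ∀ p ∈ 𝓟, verts p ⊆ V) : LocalOn V fun A => ∏ p ∈ 𝓟, mono q p A :=
  LocalOn.prod _ fun p hp => (localOn_verts p).mono' (h p hp)

theorem mono_biUnion {𝓟 : Finset (Finset (Sym2 (Fin n)))}
    (h : (𝓟 : Set (Finset (Sym2 (Fin n)))).PairwiseDisjoint id) (A : Finset (Sym2 (Fin n))) :
    mono q (𝓟.biUnion id) A = ∏ p ∈ 𝓟, mono q p A := by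
  unfold mono
  rw [prod_biUnion h]
  rfl

theorem expect_centered (hK : K ≠ 0) (f : Finset (Sym2 (Fin n)) → ℝ) :
    expect n K q lam (fun A => f A - expect n K q lam f) = 0 := by
  rw [expect_sub, expect_const hK, sub_self]

theorem expect_centered_sq (hK : K ≠ 0) (f : Finset (Sym2 (Fin n)) → ℝ) :
    expect n K q lam (fun A => (f A - expect n K q lam f) ^ 2) =
      expect n K q lam (fun A => f A ^ 2) - expect n K q lam f ^ 2 := by
  have : (fun A => (f A - expect n K q lam f) ^ 2) = fun A =>
      (f A ^ 2 - 2 * expect n K q lam f * f A) + expect n K q lam f ^ 2 := by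
    funext A; ring
  rw [this, expect_add, expect_sub, expect_const_mul, expect_const hK]
  ring

/-- The product of two corrected monomials is centered if a part of the first one is not touched
by the second one. -/
theorem expect_corr_mul_corr_eq_zero (hK : K ≠ 0) {S T : Finset (Sym2 (Fin n))}
    {𝓟 𝓠 : Finset (Finset (Sym2 (Fin n)))} (hS : IsParts S 𝓟) (hT : IsParts T 𝓠)
    {W : Finset (Fin n)} (hW : ∀ e ∈ S, ¬ Crosses W e) (hWT : ∀ e ∈ T, ¬ Touches W e)
    {e : Sym2 (Fin n)} (he : e ∈ S) (heW : Touches W e) :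
    expect n K q lam (fun A => corr n K q lam 𝓟 A * corr n K q lam 𝓠 A) = 0 := by
  obtain ⟨p, hp, hep⟩ := hS.cover e he
  have hpW : verts p ⊆ W := by
    refine hS.connected p hp W hW fun hd => ?_
    obtain ⟨v, hv, hvW⟩ := heW
    exact Finset.disjoint_left.1 hd (mem_verts.2 ⟨e, hep, hv⟩) hvW
  -- The part containing e lies inside W, since no edge of S crosses W. Its centered factor is local
  -- on its nodes, and all other factors avoid these nodes.
  have hsplit : (fun A => corr n K q lam 𝓟 A * corr n K q lam 𝓠 A) = fun A =>
      (mono q p A - expect n K q lam (mono q p)) *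
        (corr n K q lam (𝓟.erase p) A * corr n K q lam 𝓠 A) := by
    funext A
    unfold corr
    rw [← mul_prod_erase 𝓟 _ hp, mul_assoc]
  rw [hsplit, expect_mul hK (V := verts p) (W := (verts p)ᶜ) ((localOn_verts p).sub_const _) ?_
    disjoint_compl_right, expect_centered hK, zero_mul]
  refine LocalOn.mul (LocalOn.prod _ fun p' hp' => ?_) (LocalOn.prod _ fun p' hp' => ?_)
  · refine ((localOn_verts p').sub_const _).mono' fun v hv => ?_
    rw [mem_compl]
    exact fun hvp => Finset.disjoint_left.1
      (hS.disjoint hp (mem_erase.1 hp').2 (mem_erase.1 hp').1.symm) hvp hv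
  · refine ((localOn_verts p').sub_const _).mono' fun v hv => ?_
    rw [mem_compl]
    intro hvp
    obtain ⟨f, hf, hvf⟩ := mem_verts.1 hv
    exact hWT f (hT.subset p' hp' hf) ⟨v, hvf, hpW hvp⟩

theorem expect_corr_sq (hK : K ≠ 0) {𝓟 : Finset (Finset (Sym2 (Fin n)))}
    (h : (𝓟 : Set (Finset (Sym2 (Fin n)))).PairwiseDisjoint verts) :
    expect n K q lam (fun A => corr n K q lam 𝓟 A ^ 2) =
      ∏ p ∈ 𝓟, (expect n K q lam (fun A => mono q p A ^ 2) - expect n K q lam (mono q p) ^ 2) := by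
  unfold corr
  simp only [← prod_pow]
  rw [expect_prod hK 𝓟 (V := verts) (fun p _ => ((localOn_verts p).sub_const _).pow 2) h]
  exact prod_congr rfl fun p _ => expect_centered_sq hK _

theorem expect_prod_mono_sq (hK : K ≠ 0) {𝓟 : Finset (Finset (Sym2 (Fin n)))}
    (h : (𝓟 : Set (Finset (Sym2 (Fin n)))).PairwiseDisjoint verts) :
    expect n K q lam (fun A => (∏ p ∈ 𝓟, mono q p A) ^ 2) =
      ∏ p ∈ 𝓟, expect n K q lam (fun A => mono q p A ^ 2) := by
  simp only [← prod_pow]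
  exact expect_prod hK 𝓟 (V := verts) (fun p _ => (localOn_verts p).pow 2) h

namespace Params

variable (P : Params n K D q lam c)
include P

theorem variance_nonneg (f : Finset (Sym2 (Fin n)) → ℝ) :
    0 ≤ expect n K q lam (fun A => f A ^ 2) - expect n K q lam f ^ 2 := by
  rw [← expect_centered_sq P.K_ne]
  exact P.expect_nonneg fun A => sq_nonneg _

theorem expect_corr_sq_le {𝓟 : Finset (Finset (Sym2 (Fin n)))}
    (h : (𝓟 : Set (Finset (Sym2 (Fin n)))).PairwiseDisjoint verts) :
    expect n K q lam (fun A => corr n K q lam 𝓟 A ^ 2) ≤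
      expect n K q lam (fun A => (∏ p ∈ 𝓟, mono q p A) ^ 2) := by
  rw [expect_corr_sq P.K_ne h, expect_prod_mono_sq P.K_ne h]
  exact prod_le_prod (fun p _ => P.variance_nonneg _) fun p _ => sub_le_self _ (sq_nonneg _)

/-- The second moment of a corrected monomial is close to the second moment of the monomial. -/
theorem le_expect_corr_sq {S : Finset (Sym2 (Fin n))} {𝓟 : Finset (Finset (Sym2 (Fin n)))}
    (h : IsParts S 𝓟) (hS : S ⊆ pairs n) (hSD : S.card ≤ D) :
    (1 - D * eps D c ^ 16) * expect n K q lam (fun A => mono q S A ^ 2) ≤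
      expect n K q lam (fun A => corr n K q lam 𝓟 A ^ 2) := by
  have he := P.eps_pos
  have he1 := P.eps_le_one
  have h16 : eps D c ^ 16 ≤ 1 := pow_le_one₀ he.le he1
  rw [expect_corr_sq P.K_ne h.disjoint, ← h.biUnion_eq]
  simp only [mono_biUnion h.disjoint_edges]
  rw [expect_prod_mono_sq P.K_ne h.disjoint]
  have hstep : ∀ p ∈ 𝓟, (1 - eps D c ^ 16) * expect n K q lam (fun A => mono q p A ^ 2) ≤
      expect n K q lam (fun A => mono q p A ^ 2) - expect n K q lam (mono q p) ^ 2 := by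
    intro p hp
    have hpS := (h.subset p hp).trans hS
    have := P.sq_Ez_le (h.nonempty p hp) (fun e he => by simpa [pairs] using hpS he)
      ((card_le_card (h.subset p hp)).trans hSD)
    rw [← expect_mono hpS, ← expect_mono_sq hpS] at this
    linarith
  have hnn : ∀ p ∈ 𝓟, 0 ≤ (1 - eps D c ^ 16) * expect n K q lam (fun A => mono q p A ^ 2) :=
    fun p _ => mul_nonneg (by linarith) (P.expect_nonneg fun A => sq_nonneg _)
  refine le_trans ?_ (prod_le_prod hnn hstep)
  rw [prod_mul_distrib, prod_const]
  refine mul_le_mul_of_nonneg_right ?_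
    (prod_nonneg fun p _ => P.expect_nonneg fun A => sq_nonneg _)
  -- Bernoulli's inequality, applied to at most |S| ≤ D parts.
  have hb := one_add_mul_le_pow (a := -(eps D c ^ 16)) (by linarith) 𝓟.card
  have hc : (𝓟.card : ℝ) ≤ D := by exact_mod_cast h.card_le.trans hSD
  have : (𝓟.card : ℝ) * eps D c ^ 16 ≤ D * eps D c ^ 16 := by gcongr
  rw [sub_eq_add_neg 1 (eps D c ^ 16)]
  linarith

theorem Ez_prod_lam_xi_nonneg (S : Finset (Sym2 (Fin n))) :
    0 ≤ Ez (fun z : Fin n → Fin K => ∏ e ∈ S, lam * xi z e) :=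
  Ez_nonneg fun z => prod_nonneg fun e _ => mul_nonneg P.lam_pos.le (xi_nonneg z e)

theorem posComb_prod_lam_xi (S : Finset (Sym2 (Fin n))) :
    PosComb (K := K) fun z => ∏ e ∈ S, lam * xi z e :=
  PosComb.prod _ fun e _ => P.posComb_lam_xi e

theorem prod_Ez_le {𝓟 : Finset (Finset (Sym2 (Fin n)))}
    (h : (𝓟 : Set (Finset (Sym2 (Fin n)))).PairwiseDisjoint id) :
    ∏ p ∈ 𝓟, Ez (fun z : Fin n → Fin K => ∏ e ∈ p, lam * xi z e) ≤
      Ez (fun z : Fin n → Fin K => ∏ e ∈ 𝓟.biUnion id, lam * xi z e) := by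
  classical
  induction 𝓟 using Finset.induction_on with
  | empty => simp [Ez_one P.K_ne]
  | insert p s hp ih =>
    rw [prod_insert hp, biUnion_insert]
    have hd : Disjoint p (s.biUnion id) := by
      rw [disjoint_biUnion_right]
      intro i hi
      exact h (by simp) (by simp [hi]) (by rintro rfl; exact hp hi)
    simp only [id, prod_union hd]
    refine le_trans ?_ (PosComb.Ez_mul_le P.K_ne (P.posComb_prod_lam_xi p)
      (P.posComb_prod_lam_xi (s.biUnion id)))
    exact mul_le_mul_of_nonneg_left (ih (h.subset (by simp))) (P.Ez_prod_lam_xi_nonneg p)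

/-- Edge by edge, the two sides can differ only on S ∩ T outside S' ∩ T'. There (λξ)² replaces the
second moment, which dominates it. -/
theorem crossMean_mul_le {S S' T T' : Finset (Sym2 (Fin n))} (hS : S' ⊆ S) (hT : T' ⊆ T)
    (z : Fin n → Fin K) :
    crossMean q lam S' T' z * ((∏ e ∈ S \ S', lam * xi z e) * ∏ e ∈ T \ T', lam * xi z e) ≤
      crossMean q lam S T z := by
  have h1 : ∀ (S : Finset (Sym2 (Fin n))) (a : Sym2 (Fin n) → ℝ),
      ∏ e ∈ S, a e = ∏ e, if e ∈ S then a e else 1 := fun S a => by simp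
  have hw := fun e => (P.sqMean_pos z e).le
  have hx : ∀ e, 0 ≤ lam * xi z e := fun e => mul_nonneg P.lam_pos.le (xi_nonneg z e)
  unfold crossMean
  rw [h1 (S' ∩ T'), h1 (symmDiff S' T'), h1 (S \ S'), h1 (T \ T'), h1 (S ∩ T), h1 (symmDiff S T)]
  simp only [← prod_mul_distrib]
  refine prod_le_prod (fun e _ => ?_) fun e _ => ?_
  · have := hw e; have := hx e
    split_ifs <;> positivity
  · have hSe := @hS e
    have hTe := @hT e
    have h2 := P.lam_sq_xi_le_sqMean z e
    by_cases a1 : e ∈ S <;> by_cases a2 : e ∈ T <;> by_cases a3 : e ∈ S' <;> by_cases a4 : e ∈ T' <;>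
      simp [a1, a2, a3, a4, mem_symmDiff] at hSe hTe h2 ⊢ <;> exact h2

/-- Controls one term of the expansion of the corrected products: by positive association, pulling
parts out of the expectation and keeping only their means cannot increase the value. -/
theorem expect_mul_prod_le {S T : Finset (Sym2 (Fin n))}
    {𝓟 𝓠 𝓟' 𝓠' : Finset (Finset (Sym2 (Fin n)))} (hS : IsParts S 𝓟) (hT : IsParts T 𝓠)
    (hSn : S ⊆ pairs n) (hTn : T ⊆ pairs n) {𝓐 𝓑 : Finset (Finset (Sym2 (Fin n)))}
    (h𝓐 : 𝓐 ⊆ 𝓟) (h𝓑 : 𝓑 ⊆ 𝓠) (h𝓟' : 𝓟' ⊆ 𝓐) (h𝓠' : 𝓠' ⊆ 𝓑) :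
    expect n K q lam (fun A => (∏ p ∈ 𝓟', mono q p A) * ∏ p ∈ 𝓠', mono q p A) *
      ((∏ p ∈ 𝓐 \ 𝓟', expect n K q lam (mono q p)) * ∏ p ∈ 𝓑 \ 𝓠', expect n K q lam (mono q p)) ≤
    expect n K q lam (fun A => (∏ p ∈ 𝓐, mono q p A) * ∏ p ∈ 𝓑, mono q p A) := by
  have key : ∀ {S : Finset (Sym2 (Fin n))} {𝓟 𝓐 : Finset (Finset (Sym2 (Fin n)))}, IsParts S 𝓟 →
      S ⊆ pairs n → 𝓐 ⊆ 𝓟 → (𝓐 : Set (Finset (Sym2 (Fin n)))).PairwiseDisjoint id ∧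
        𝓐.biUnion id ⊆ pairs n := by
    intro S 𝓟 𝓐 h hS hA
    exact ⟨h.disjoint_edges.subset (by exact_mod_cast hA), fun e he => by
      obtain ⟨p, hp, hep⟩ := mem_biUnion.1 he
      exact hS (h.subset p (hA hp) hep)⟩
  have hdiff : ∀ {S : Finset (Sym2 (Fin n))} {𝓟 𝓐 𝓟' : Finset (Finset (Sym2 (Fin n)))},
      IsParts S 𝓟 → S ⊆ pairs n → 𝓐 ⊆ 𝓟 → 𝓟' ⊆ 𝓐 →
      ∏ p ∈ 𝓐 \ 𝓟', expect n K q lam (mono q p) ≤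
        Ez (fun z : Fin n → Fin K => ∏ e ∈ 𝓐.biUnion id \ 𝓟'.biUnion id, lam * xi z e) := by
    intro S 𝓟 𝓐 𝓟' h hS hA hP
    have h1 := P.prod_Ez_le (key h hS (sdiff_subset.trans hA : 𝓐 \ 𝓟' ⊆ 𝓟)).1
    have h2 : (𝓐 \ 𝓟').biUnion id = 𝓐.biUnion id \ 𝓟'.biUnion id := by
      ext e
      simp only [mem_biUnion, mem_sdiff, id]
      constructor
      · rintro ⟨p, ⟨hp, hp'⟩, he⟩
        refine ⟨⟨p, hp, he⟩, ?_⟩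
        rintro ⟨p', hp'', he'⟩
        have hne : p ≠ p' := by rintro rfl; exact hp' hp''
        exact Finset.disjoint_left.1 (h.disjoint_edges (hA hp) (hA (hP hp'')) hne) he he'
      · rintro ⟨⟨p, hp, he⟩, hno⟩
        exact ⟨p, ⟨hp, fun hp' => hno ⟨p, hp', he⟩⟩, he⟩
    rw [h2] at h1
    refine le_trans (le_of_eq (prod_congr rfl fun p hp => ?_)) h1
    exact expect_mono ((h.subset p (hA (mem_sdiff.1 hp).1)).trans hS)
  have e1 : ∀ {𝓟' 𝓠' : Finset (Finset (Sym2 (Fin n)))}, 𝓟' ⊆ 𝓟 → 𝓠' ⊆ 𝓠 →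
      expect n K q lam (fun A => (∏ p ∈ 𝓟', mono q p A) * ∏ p ∈ 𝓠', mono q p A) =
        Ez (crossMean (K := K) q lam (𝓟'.biUnion id) (𝓠'.biUnion id)) := by
    intro 𝓟' 𝓠' h1 h2
    rw [← expect_mono_mul_mono (key hS hSn h1).2 (key hT hTn h2).2]
    simp only [mono_biUnion (key hS hSn h1).1, mono_biUnion (key hT hTn h2).1]
  rw [e1 (h𝓟'.trans h𝓐) (h𝓠'.trans h𝓑), e1 h𝓐 h𝓑]
  have hc0 : 0 ≤ Ez (crossMean (K := K) q lam (𝓟'.biUnion id) (𝓠'.biUnion id)) :=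
    Ez_nonneg (P.posComb_crossMean _ _).nonneg
  have hm0 : ∀ p ∈ 𝓑 \ 𝓠', 0 ≤ expect n K q lam (mono q p) := fun p hp => by
    rw [expect_mono ((hT.subset p (h𝓑 (mem_sdiff.1 hp).1)).trans hTn)]
    exact P.Ez_prod_lam_xi_nonneg p
  calc _ ≤ Ez (crossMean (K := K) q lam (𝓟'.biUnion id) (𝓠'.biUnion id)) *
        (Ez (fun z : Fin n → Fin K => ∏ e ∈ 𝓐.biUnion id \ 𝓟'.biUnion id, lam * xi z e) *
          Ez (fun z : Fin n → Fin K => ∏ e ∈ 𝓑.biUnion id \ 𝓠'.biUnion id, lam * xi z e)) :=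
        mul_le_mul_of_nonneg_left (mul_le_mul (hdiff hS hSn h𝓐 h𝓟') (hdiff hT hTn h𝓑 h𝓠')
          (prod_nonneg hm0) (P.Ez_prod_lam_xi_nonneg _)) hc0
    _ ≤ Ez (crossMean (K := K) q lam (𝓟'.biUnion id) (𝓠'.biUnion id)) *
        Ez (fun z : Fin n → Fin K => (∏ e ∈ 𝓐.biUnion id \ 𝓟'.biUnion id, lam * xi z e) *
          ∏ e ∈ 𝓑.biUnion id \ 𝓠'.biUnion id, lam * xi z e) :=
        mul_le_mul_of_nonneg_left (PosComb.Ez_mul_le P.K_ne (P.posComb_prod_lam_xi _)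
          (P.posComb_prod_lam_xi _)) hc0
    _ ≤ _ := PosComb.Ez_mul_le P.K_ne (P.posComb_crossMean _ _)
        ((P.posComb_prod_lam_xi _).mul (P.posComb_prod_lam_xi _))
    _ ≤ _ := Ez_mono fun z => P.crossMean_mul_le (biUnion_subset_biUnion_of_subset_left _ h𝓟')
        (biUnion_subset_biUnion_of_subset_left _ h𝓠') z

/-- Expanding the subtracted means gives one term for each pair of subfamilies, each dominated by
the uncorrected expectation through `expect_mul_prod_le`. -/
theorem abs_expect_corr_mul_corr_le_two_pow {S T : Finset (Sym2 (Fin n))}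
    {𝓟 𝓠 𝓐 𝓑 : Finset (Finset (Sym2 (Fin n)))} (hS : IsParts S 𝓟) (hT : IsParts T 𝓠)
    (hSn : S ⊆ pairs n) (hTn : T ⊆ pairs n) (h𝓐 : 𝓐 ⊆ 𝓟) (h𝓑 : 𝓑 ⊆ 𝓠) :
    |expect n K q lam (fun A => corr n K q lam 𝓐 A * corr n K q lam 𝓑 A)| ≤
      2 ^ (𝓐.card + 𝓑.card) *
        expect n K q lam (fun A => (∏ p ∈ 𝓐, mono q p A) * ∏ p ∈ 𝓑, mono q p A) := by
  have hexp : ∀ (𝓐 : Finset (Finset (Sym2 (Fin n)))) A, corr n K q lam 𝓐 A =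
      ∑ t ∈ 𝓐.powerset, (∏ p ∈ t, mono q p A) * ∏ p ∈ 𝓐 \ t, -expect n K q lam (mono q p) := by
    intro 𝓐 A
    unfold corr
    simp only [sub_eq_add_neg]
    exact prod_add _ _ _
  have h1 : (fun A => corr n K q lam 𝓐 A * corr n K q lam 𝓑 A) = fun A =>
      ∑ t ∈ 𝓐.powerset ×ˢ 𝓑.powerset,
        ((∏ p ∈ 𝓐 \ t.1, -expect n K q lam (mono q p)) *
          ∏ p ∈ 𝓑 \ t.2, -expect n K q lam (mono q p)) *
        ((∏ p ∈ t.1, mono q p A) * ∏ p ∈ t.2, mono q p A) := by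
    funext A
    rw [hexp, hexp, sum_mul_sum, sum_product]
    exact sum_congr rfl fun _ _ => sum_congr rfl fun _ _ => by ring
  rw [h1, expect_sum]
  have hnn : ∀ {S : Finset (Sym2 (Fin n))} {𝓟 𝓐 : Finset (Finset (Sym2 (Fin n)))}, IsParts S 𝓟 →
      S ⊆ pairs n → 𝓐 ⊆ 𝓟 → ∀ t, |∏ p ∈ 𝓐 \ t, -expect n K q lam (mono q p)| =
        ∏ p ∈ 𝓐 \ t, expect n K q lam (mono q p) := by
    intro S 𝓟 𝓐 h hS hA t
    rw [abs_prod]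
    refine prod_congr rfl fun p hp => ?_
    rw [abs_neg, abs_of_nonneg]
    rw [expect_mono ((h.subset p (hA (mem_sdiff.1 hp).1)).trans hS)]
    exact P.Ez_prod_lam_xi_nonneg p
  have hcross : ∀ t ∈ 𝓐.powerset ×ˢ 𝓑.powerset,
      |expect n K q lam (fun A => ((∏ p ∈ 𝓐 \ t.1, -expect n K q lam (mono q p)) *
          ∏ p ∈ 𝓑 \ t.2, -expect n K q lam (mono q p)) *
        ((∏ p ∈ t.1, mono q p A) * ∏ p ∈ t.2, mono q p A))| ≤
      expect n K q lam (fun A => (∏ p ∈ 𝓐, mono q p A) * ∏ p ∈ 𝓑, mono q p A) := by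
    intro t ht
    simp only [mem_product, mem_powerset] at ht
    have hle := P.expect_mul_prod_le hS hT hSn hTn h𝓐 h𝓑 ht.1 ht.2
    have h0 : 0 ≤ expect n K q lam (fun A => (∏ p ∈ t.1, mono q p A) * ∏ p ∈ t.2, mono q p A) := by
      have hd : ∀ {S : Finset (Sym2 (Fin n))} {𝓟 𝓐 : Finset (Finset (Sym2 (Fin n)))},
          IsParts S 𝓟 → S ⊆ pairs n → 𝓐 ⊆ 𝓟 →
          (𝓐 : Set (Finset (Sym2 (Fin n)))).PairwiseDisjoint id ∧ 𝓐.biUnion id ⊆ pairs n := by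
        intro S 𝓟 𝓐 h hS hA
        exact ⟨h.disjoint_edges.subset (by exact_mod_cast hA), fun e he => by
          obtain ⟨p, hp, hep⟩ := mem_biUnion.1 he
          exact hS (h.subset p (hA hp) hep)⟩
      have d1 := hd hS hSn (ht.1.trans h𝓐)
      have d2 := hd hT hTn (ht.2.trans h𝓑)
      simp only [← mono_biUnion d1.1, ← mono_biUnion d2.1]
      rw [expect_mono_mul_mono d1.2 d2.2]
      exact Ez_nonneg (P.posComb_crossMean _ _).nonneg
    rw [expect_const_mul, abs_mul, abs_mul, hnn hS hSn h𝓐, hnn hT hTn h𝓑, abs_of_nonneg h0, mul_comm]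
    exact hle
  refine (abs_sum_le_sum_abs _ _).trans ((sum_le_card_nsmul _ _ _ hcross).trans (le_of_eq ?_))
  rw [card_product, card_powerset, card_powerset, nsmul_eq_mul, pow_add]
  push_cast
  ring

/-- The correlation of two corrected monomials, in terms of the monomials. -/
theorem abs_expect_corr_mul_corr_le {S T : Finset (Sym2 (Fin n))}
    {𝓟 𝓠 : Finset (Finset (Sym2 (Fin n)))} (hS : IsParts S 𝓟) (hT : IsParts T 𝓠)
    (hSn : S ⊆ pairs n) (hTn : T ⊆ pairs n) :
    |expect n K q lam (fun A => corr n K q lam 𝓟 A * corr n K q lam 𝓠 A)| ≤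
      16 ^ (symmDiff S T).card * Ez (crossMean (K := K) q lam S T) := by
  -- The common parts appear squared and are independent of the others, and centering only decreases
  -- their second moment. A factor 2 is thus paid only for parts belonging to one family, at most
  -- 4|S Δ T| of them.
  have hsplit : ∀ A, corr n K q lam 𝓟 A * corr n K q lam 𝓠 A = corr n K q lam (𝓟 ∩ 𝓠) A ^ 2 *
      (corr n K q lam (𝓟 \ 𝓠) A * corr n K q lam (𝓠 \ 𝓟) A) := by
    intro A
    unfold corr
    rw [← prod_inter_mul_prod_sdiff 𝓟 𝓠, ← prod_inter_mul_prod_sdiff 𝓠 𝓟, inter_comm 𝓠 𝓟]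
    ring
  have hsplit' : ∀ A, mono q S A * mono q T A = (∏ p ∈ 𝓟 ∩ 𝓠, mono q p A) ^ 2 *
      ((∏ p ∈ 𝓟 \ 𝓠, mono q p A) * ∏ p ∈ 𝓠 \ 𝓟, mono q p A) := by
    intro A
    rw [← hS.biUnion_eq, ← hT.biUnion_eq, mono_biUnion hS.disjoint_edges,
      mono_biUnion hT.disjoint_edges, ← prod_inter_mul_prod_sdiff 𝓟 𝓠,
      ← prod_inter_mul_prod_sdiff 𝓠 𝓟, inter_comm 𝓠 𝓟]
    ring
  set V := (𝓟 ∩ 𝓠).biUnion verts with hV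
  have hin : ∀ p ∈ 𝓟 ∩ 𝓠, verts p ⊆ V := fun p hp => subset_biUnion_of_mem verts hp
  have hout : ∀ p, p ∈ 𝓟 \ 𝓠 ∨ p ∈ 𝓠 \ 𝓟 → verts p ⊆ Vᶜ := by
    intro p hp v hv
    rw [mem_compl, hV, mem_biUnion]
    rintro ⟨p', hp', hv'⟩
    rw [mem_inter] at hp'
    rcases hp with hp | hp <;> rw [mem_sdiff] at hp
    · have hne : p ≠ p' := by rintro rfl; exact hp.2 hp'.2
      exact Finset.disjoint_left.1 (hS.disjoint hp.1 hp'.1 hne) hv hv'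
    · have hne : p ≠ p' := by rintro rfl; exact hp.2 hp'.1
      exact Finset.disjoint_left.1 (hT.disjoint hp.1 hp'.2 hne) hv hv'
  have hQ : ((𝓟 ∩ 𝓠 : Finset _) : Set (Finset (Sym2 (Fin n)))).PairwiseDisjoint verts :=
    hS.disjoint.subset (by simp)
  rw [← expect_mono_mul_mono hSn hTn]
  simp only [hsplit, hsplit']
  have hPout : ∀ p ∈ 𝓟 \ 𝓠, verts p ⊆ Vᶜ := fun p hp => hout p (Or.inl hp)
  have hQout : ∀ p ∈ 𝓠 \ 𝓟, verts p ⊆ Vᶜ := fun p hp => hout p (Or.inr hp)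
  rw [expect_mul P.K_ne ((localOn_corr hin).pow 2)
      ((localOn_corr hPout).mul (localOn_corr hQout)) disjoint_compl_right,
    expect_mul P.K_ne ((localOn_prod_mono hin).pow 2)
      ((localOn_prod_mono hPout).mul (localOn_prod_mono hQout)) disjoint_compl_right, abs_mul,
    abs_of_nonneg (P.expect_nonneg fun A => sq_nonneg _)]
  have h1 := P.expect_corr_sq_le hQ
  have h2 := P.abs_expect_corr_mul_corr_le_two_pow hS hT hSn hTn
    (sdiff_subset : 𝓟 \ 𝓠 ⊆ 𝓟) (sdiff_subset : 𝓠 \ 𝓟 ⊆ 𝓠)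
  have h4 : (2 : ℝ) ^ ((𝓟 \ 𝓠).card + (𝓠 \ 𝓟).card) ≤ 16 ^ (symmDiff S T).card := by
    have c1 := hS.card_sdiff_le hT
    have c2 := hT.card_sdiff_le hS
    rw [symmDiff_comm] at c2
    calc (2 : ℝ) ^ ((𝓟 \ 𝓠).card + (𝓠 \ 𝓟).card) ≤ 2 ^ (4 * (symmDiff S T).card) :=
          pow_le_pow_right₀ (by norm_num) (by omega)
      _ = 16 ^ (symmDiff S T).card := by rw [pow_mul]; norm_num
  have h0 : 0 ≤ expect n K q lam (fun A => corr n K q lam (𝓟 ∩ 𝓠) A ^ 2) :=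
    P.expect_nonneg fun A => sq_nonneg _
  set R := expect n K q lam (fun A => (∏ p ∈ 𝓟 \ 𝓠, mono q p A) * ∏ p ∈ 𝓠 \ 𝓟, mono q p A)
  have hR : 0 ≤ R := by
    have := (abs_nonneg _).trans h2
    exact nonneg_of_mul_nonneg_right this (by positivity)
  have hE := h0.trans h1
  calc _ ≤ expect n K q lam (fun A => (∏ p ∈ 𝓟 ∩ 𝓠, mono q p A) ^ 2) *
        (2 ^ ((𝓟 \ 𝓠).card + (𝓠 \ 𝓟).card) * R) := mul_le_mul h1 h2 (abs_nonneg _) hE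
    _ ≤ expect n K q lam (fun A => (∏ p ∈ 𝓟 ∩ 𝓠, mono q p A) ^ 2) *
        (16 ^ (symmDiff S T).card * R) := by gcongr
    _ = _ := by ring

end Params

namespace Template

/-! ### Images of templates -/

/-- The image of the edge set of `G` under an injection of its nodes. -/
def imgEdges (G : Template) {X : Type*} (π : Fin G.order ↪ X) : Finset (Sym2 X) :=
  G.edges.map π.sym2Map

section imgEdges

variable {X : Type*} {G H : Template} {α : Fin G.order ↪ X} {β : Fin H.order ↪ X}

theorem mem_edges {a b : Fin G.order} : s(a, b) ∈ G.edges ↔ G.graph.Adj a b := by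
  simp [edges]

theorem mem_imgEdges {e : Sym2 X} :
    e ∈ G.imgEdges α ↔ ∃ a b, G.graph.Adj a b ∧ e = s(α a, α b) := by
  simp only [imgEdges, mem_map]
  constructor
  · rintro ⟨e, he, rfl⟩
    induction e with
    | _ a b => exact ⟨a, b, mem_edges.1 he, rfl⟩
  · rintro ⟨a, b, h, rfl⟩
    exact ⟨s(a, b), mem_edges.2 h, rfl⟩

theorem mk_mem_imgEdges {a b : Fin G.order} :
    s(α a, α b) ∈ G.imgEdges α ↔ G.graph.Adj a b := by
  rw [mem_imgEdges]
  constructor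
  · rintro ⟨a', b', h, he⟩
    rcases Sym2.eq_iff.1 he with ⟨h1, h2⟩ | ⟨h1, h2⟩
    · rwa [α.injective h1, α.injective h2]
    · rw [α.injective h1, α.injective h2]; exact h.symm
  · exact fun h => ⟨a, b, h, rfl⟩

theorem card_imgEdges : (G.imgEdges α).card = G.edges.card := card_map _

theorem not_isDiag_of_mem_imgEdges {e : Sym2 X} (he : e ∈ G.imgEdges α) : ¬ e.IsDiag := by
  obtain ⟨a, b, h, rfl⟩ := mem_imgEdges.1 he
  simpa using h.ne

theorem mem_range_of_mem_imgEdges {e : Sym2 X} (he : e ∈ G.imgEdges α) {x : X} (hx : x ∈ e) :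
    ∃ a, α a = x := by
  obtain ⟨a, b, h, rfl⟩ := mem_imgEdges.1 he
  rcases Sym2.mem_iff.1 hx with rfl | rfl
  exacts [⟨a, rfl⟩, ⟨b, rfl⟩]

/-- Every node is sent to the image of a distinguished node or belongs to an edge. -/
theorem exists_edge (hG : G.Admissible D) (a : Fin G.order) (h₁ : a ≠ G.v₁) (h₂ : a ≠ G.v₂) :
    ∃ e ∈ G.imgEdges α, α a ∈ e := by
  obtain ⟨w, hw⟩ := hG.1 a h₁ h₂
  exact ⟨_, mk_mem_imgEdges.2 hw, by simp⟩

theorem exists_eq_of_imgEdges_eq (hG : G.Admissible D) (h₁ : α G.v₁ = β H.v₁)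
    (h₂ : α G.v₂ = β H.v₂) (h : G.imgEdges α = H.imgEdges β) (a : Fin G.order) :
    ∃ b, β b = α a := by
  by_cases ha₁ : a = G.v₁
  · exact ⟨_, ha₁ ▸ h₁.symm⟩
  by_cases ha₂ : a = G.v₂
  · exact ⟨_, ha₂ ▸ h₂.symm⟩
  obtain ⟨e, he, hae⟩ := exists_edge (α := α) hG a ha₁ ha₂
  exact mem_range_of_mem_imgEdges (h ▸ he) hae

/-- Two admissible templates with the same image are equivalent. -/
theorem exists_iso_of_imgEdges_eq (hG : G.Admissible D) (hH : H.Admissible D)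
    (h₁ : α G.v₁ = β H.v₁) (h₂ : α G.v₂ = β H.v₂) (h : G.imgEdges α = H.imgEdges β) :
    ∃ σ : G.graph ≃g H.graph, (σ G.v₁ = H.v₁ ∧ σ G.v₂ = H.v₂) ∧ ∀ a, β (σ a) = α a := by
  choose f hf using exists_eq_of_imgEdges_eq hG h₁ h₂ h
  choose g hg using exists_eq_of_imgEdges_eq hH h₁.symm h₂.symm h.symm
  refine ⟨⟨⟨f, g, fun a => α.injective (by rw [hg, hf]), fun b => β.injective (by rw [hf, hg])⟩, ?_⟩,
    ⟨β.injective ?_, β.injective ?_⟩, hf⟩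
  · intro a b
    simp only [Equiv.coe_fn_mk]
    rw [← mk_mem_imgEdges (α := β), ← mk_mem_imgEdges (α := α), hf, hf, h]
  · exact (hf _).trans h₁
  · exact (hf _).trans h₂

end imgEdges

theorem order_le {G : Template} (hG : G.Admissible D) : G.order ≤ 2 * D + 2 := by
  have h : (univ : Finset (Fin G.order)) ⊆ insert G.v₁ (insert G.v₂ (verts G.edges)) := by
    intro a _
    by_cases h₁ : a = G.v₁
    · simp [h₁]
    by_cases h₂ : a = G.v₂
    · simp [h₂]
    obtain ⟨w, hw⟩ := hG.1 a h₁ h₂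
    exact mem_insert_of_mem (mem_insert_of_mem (mem_verts.2 ⟨_, mem_edges.2 hw, by simp⟩))
  have h1 := card_le_card h
  have h2 := card_insert_le G.v₁ (insert G.v₂ (verts G.edges))
  have h3 := card_insert_le G.v₂ (verts G.edges)
  have h4 := card_verts_le G.edges
  have h5 := hG.2.2
  rw [card_univ, Fintype.card_fin] at h1
  omega

/-! ### Edit distance -/

section editDist

variable {X : Type*} [DecidableEq X] {G H : Template} {α : Fin G.order ↪ X} {β : Fin H.order ↪ X}

/-- The node matching induced by two injections. -/
def inducedMatching (α : Fin G.order ↪ X) (β : Fin H.order ↪ X) :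
    Finset (Fin G.order × Fin H.order) := {p | α p.1 = β p.2}

theorem mem_inducedMatching {p : Fin G.order × Fin H.order} :
    p ∈ inducedMatching α β ↔ α p.1 = β p.2 := by simp [inducedMatching]

theorem isMatching_inducedMatching (h₁ : α G.v₁ = β H.v₁) (h₂ : α G.v₂ = β H.v₂) :
    IsMatching G H (inducedMatching α β) := by
  refine ⟨fun a ha b hb => ?_, mem_inducedMatching.2 h₁, mem_inducedMatching.2 h₂⟩
  rw [mem_inducedMatching] at ha hb
  rw [← α.injective.eq_iff, ha, hb, β.injective.eq_iff]

theorem edgeMatched_inducedMatching {e : Sym2 (Fin G.order)} {f : Sym2 (Fin H.order)} :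
    EdgeMatched (inducedMatching α β) e f ↔ α.sym2Map e = β.sym2Map f := by
  constructor
  · rintro ⟨a, ha, b, hb, rfl, rfl⟩
    rw [mem_inducedMatching] at ha hb
    simp [ha, hb]
  · induction e with
    | _ a a' =>
    induction f with
    | _ b b' =>
      intro h
      simp only [Function.Embedding.sym2Map_apply, Sym2.map_mk, Sym2.eq_iff] at h
      rcases h with ⟨h1, h2⟩ | ⟨h1, h2⟩
      · exact ⟨(a, b), mem_inducedMatching.2 h1, (a', b'), mem_inducedMatching.2 h2, rfl, rfl⟩
      · exact ⟨(a, b'), mem_inducedMatching.2 h1, (a', b), mem_inducedMatching.2 h2, rfl,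
          Sym2.eq_swap⟩

theorem symmDiffCard_inducedMatching :
    symmDiffCard G H (inducedMatching α β) = (symmDiff (G.imgEdges α) (H.imgEdges β)).card := by
  have h : symmDiff (G.imgEdges α) (H.imgEdges β) =
      (G.imgEdges α \ H.imgEdges β) ∪ (H.imgEdges β \ G.imgEdges α) := rfl
  rw [h, card_union_of_disjoint disjoint_sdiff_sdiff, symmDiffCard]
  congr 1
  · rw [← card_map α.sym2Map]
    congr 1
    ext e
    simp only [mem_map, mem_filter, mem_sdiff, imgEdges, edgeMatched_inducedMatching]
    constructor
    · rintro ⟨e, ⟨he, hno⟩, rfl⟩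
      exact ⟨⟨e, he, rfl⟩, fun ⟨f, hf, hef⟩ => hno ⟨f, hf, hef.symm⟩⟩
    · rintro ⟨⟨e, he, rfl⟩, hno⟩
      exact ⟨e, ⟨he, fun ⟨f, hf, hef⟩ => hno ⟨f, hf, hef.symm⟩⟩, rfl⟩
  · rw [← card_map β.sym2Map]
    congr 1
    ext e
    simp only [mem_map, mem_filter, mem_sdiff, imgEdges, edgeMatched_inducedMatching]
    constructor
    · rintro ⟨e, ⟨he, hno⟩, rfl⟩
      exact ⟨⟨e, he, rfl⟩, fun ⟨f, hf, hef⟩ => hno ⟨f, hf, hef⟩⟩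
    · rintro ⟨⟨e, he, rfl⟩, hno⟩
      exact ⟨e, ⟨he, fun ⟨f, hf, hef⟩ => hno ⟨f, hf, hef⟩⟩, rfl⟩

theorem editDist_le (h₁ : α G.v₁ = β H.v₁) (h₂ : α G.v₂ = β H.v₂) :
    editDist G H ≤ (symmDiff (G.imgEdges α) (H.imgEdges β)).card :=
  Nat.sInf_le ⟨_, isMatching_inducedMatching h₁ h₂, symmDiffCard_inducedMatching⟩

end editDist

/-- The edit distance is realized by two injections. -/
theorem exists_card_symmDiff_eq_editDist {G H : Template} {m : ℕ} (hm : H.order ≤ m) :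
    ∃ β : Fin H.order ↪ Fin G.order ⊕ Fin m,
      Function.Embedding.inl G.v₁ = β H.v₁ ∧ Function.Embedding.inl G.v₂ = β H.v₂ ∧
      (symmDiff (G.imgEdges Function.Embedding.inl) (H.imgEdges β)).card = editDist G H := by
  classical
  have hne : {k | ∃ M, IsMatching G H M ∧ symmDiffCard G H M = k}.Nonempty := by
    let α : Fin G.order ↪ ℕ := Fin.valEmbedding
    let β : Fin H.order ↪ ℕ := Fin.valEmbedding
    exact ⟨_, _, isMatching_inducedMatching (α := α) (β := β) rfl rfl, rfl⟩
  obtain ⟨M, hM, hcard⟩ := Nat.sInf_mem hne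
  -- A matched node of H is sent to its partner in G, an unmatched one to a private copy of itself,
  -- so this embedding induces exactly M.
  let f : Fin H.order → Fin G.order ⊕ Fin m := fun b =>
    if h : ∃ a, (a, b) ∈ M then Sum.inl h.choose else Sum.inr (Fin.castLE hm b)
  have hf : ∀ a b, f b = Sum.inl a ↔ (a, b) ∈ M := by
    intro a b
    simp only [f]
    split_ifs with h
    · rw [Sum.inl.injEq]
      constructor
      · rintro rfl; exact h.choose_spec
      · intro hab; exact (hM.1 _ h.choose_spec _ hab).2 rfl
    · simp only [false_iff]
      exact fun hab => h ⟨a, hab⟩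
  have hinj : Function.Injective f := by
    intro b b' hbb
    rcases hfb : f b with a | x
    · have h1 := (hf a b).1 hfb
      have h2 := (hf a b').1 (hbb ▸ hfb)
      exact (hM.1 _ h1 _ h2).1 rfl
    · have h1 : ¬ ∃ a, (a, b) ∈ M := by
        rintro ⟨a, ha⟩; rw [(hf a b).2 ha] at hfb; exact absurd hfb (by simp)
      have h2 : ¬ ∃ a, (a, b') ∈ M := by
        rintro ⟨a, ha⟩; rw [hbb, (hf a b').2 ha] at hfb; exact absurd hfb (by simp)
      simp only [f, h1, h2, dite_false, Sum.inr.injEq] at hbb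
      exact Fin.castLE_injective hm hbb
  refine ⟨⟨f, hinj⟩, ((hf _ _).2 hM.2.1).symm, ((hf _ _).2 hM.2.2).symm, ?_⟩
  rw [← symmDiffCard_inducedMatching]
  have : inducedMatching (G := G) (H := H) Function.Embedding.inl ⟨f, hinj⟩ = M := by
    ext p
    rw [mem_inducedMatching]
    exact eq_comm.trans (hf p.1 p.2)
  rw [this]
  exact hcard

/-! ### The parts of a labeled template -/

section parts

variable {G : Template} {π : Fin G.order ↪ Fin n}

/-- The images of the connected components of `G` that contain an edge. -/
def imgParts (G : Template) (π : Fin G.order ↪ Fin n) : Finset (Finset (Sym2 (Fin n))) :=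
  G.edgeComponents.image fun c => (G.componentEdges c).map π.sym2Map

theorem mem_componentEdges {c : G.graph.ConnectedComponent} {a b : Fin G.order} :
    s(a, b) ∈ G.componentEdges c ↔
      G.graph.Adj a b ∧ G.graph.connectedComponentMk a = c := by
  simp only [componentEdges, mem_filter, mem_edges]
  constructor
  · exact fun h => ⟨h.1, h.2 a (by simp)⟩
  · refine fun h => ⟨h.1, fun v hv => ?_⟩
    rcases Sym2.mem_iff.1 hv with rfl | rfl
    · exact h.2
    · rw [← h.2]
      exact SimpleGraph.ConnectedComponent.sound h.1.symm.reachable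

theorem mk_eq_of_mem_verts {c : G.graph.ConnectedComponent} {x : Fin n}
    (hx : x ∈ verts ((G.componentEdges c).map π.sym2Map)) :
    ∃ a, π a = x ∧ G.graph.connectedComponentMk a = c := by
  obtain ⟨e, he, hxe⟩ := mem_verts.1 hx
  obtain ⟨e, hec, rfl⟩ := mem_map.1 he
  induction e with
  | _ a b =>
    have h1 := mem_componentEdges.1 hec
    rw [Sym2.eq_swap] at hec
    have h2 := mem_componentEdges.1 hec
    rcases Sym2.mem_iff.1 hxe with rfl | rfl
    exacts [⟨a, rfl, h1.2⟩, ⟨b, rfl, h2.2⟩]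

theorem isParts_imgParts : IsParts (G.imgEdges π) (G.imgParts π) where
  nonempty := by
    intro p hp
    obtain ⟨c, hc, rfl⟩ := mem_image.1 hp
    simpa [edgeComponents] using hc
  subset := by
    intro p hp
    obtain ⟨c, hc, rfl⟩ := mem_image.1 hp
    intro e he
    obtain ⟨f, hf, rfl⟩ := mem_map.1 he
    induction f with
    | _ a b => exact mem_map.2 ⟨_, mem_edges.2 (mem_componentEdges.1 hf).1, rfl⟩
  cover := by
    intro e he
    obtain ⟨a, b, hab, rfl⟩ := mem_imgEdges.1 he
    have h : s(a, b) ∈ G.componentEdges (G.graph.connectedComponentMk a) :=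
      mem_componentEdges.2 ⟨hab, rfl⟩
    refine ⟨_, mem_image.2 ⟨G.graph.connectedComponentMk a, ?_, rfl⟩, mem_map.2 ⟨_, h, rfl⟩⟩
    simp only [edgeComponents, mem_filter, mem_univ, true_and]
    exact ⟨_, h⟩
  disjoint := by
    intro p hp p' hp' hne
    obtain ⟨c, hc, rfl⟩ := mem_image.1 hp
    obtain ⟨c', hc', rfl⟩ := mem_image.1 hp'
    refine Finset.disjoint_left.2 fun x hx hx' => ?_
    obtain ⟨a, rfl, ha⟩ := mk_eq_of_mem_verts hx
    obtain ⟨a', haa, ha'⟩ := mk_eq_of_mem_verts hx'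
    rw [π.injective haa] at ha'
    exact hne (by rw [← ha, ← ha'])
  connected := by
    intro p hp W hW hd x hx
    obtain ⟨c, hc, rfl⟩ := mem_image.1 hp
    rw [Finset.not_disjoint_iff] at hd
    obtain ⟨y, hy, hyW⟩ := hd
    obtain ⟨a, rfl, ha⟩ := mk_eq_of_mem_verts hx
    obtain ⟨b, rfl, hb⟩ := mk_eq_of_mem_verts hy
    have hreach : G.graph.Reachable b a := SimpleGraph.ConnectedComponent.exact (hb.trans ha.symm)
    obtain ⟨w⟩ := hreach
    clear hx hy ha hb
    induction w with
    | nil => exact hyW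
    | cons h _ ih =>
      exact ih (mem_of_not_crosses (hW _ (mk_mem_imgEdges.2 h)) (Sym2.mem_mk_left _ _) hyW
        (Sym2.mem_mk_right _ _))

theorem edgePoly_eq {m : ℕ} (S : Finset (Sym2 (Fin m))) (π : Fin m ↪ Fin n)
    (A : Finset (Sym2 (Fin n))) : edgePoly q S π A = mono q (S.map π.sym2Map) A := by
  rw [mono, prod_map]; rfl

theorem corrected_eq (A : Finset (Sym2 (Fin n))) :
    corrected n K q lam G π A = corr n K q lam (G.imgParts π) A := by
  unfold corr imgParts corrected
  rw [prod_image]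
  · refine prod_congr rfl fun c _ => ?_
    rw [edgePoly_eq, show edgePoly q (G.componentEdges c) π = mono q ((G.componentEdges c).map
      π.sym2Map) from funext fun A => edgePoly_eq _ _ A]
  · intro c hc c' hc' h
    simp only [edgeComponents, coe_filter, mem_univ, true_and, Set.mem_ofPred_eq] at hc
    obtain ⟨e, he⟩ := hc
    have he' : e ∈ G.componentEdges c' := by
      rw [← map_injective π.sym2Map h]; exact he
    induction e with
    | _ a b => rw [← (mem_componentEdges.1 he).2, ← (mem_componentEdges.1 he').2]

theorem imgEdges_subset_pairs : G.imgEdges π ⊆ pairs n := by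
  intro e he
  simpa [pairs] using not_isDiag_of_mem_imgEdges he

/-- The second moment of the monomial of `G` for the labeling `π`. -/
theorem expect_mono_imgEdges_sq (π : Fin G.order ↪ Fin n) :
    expect n K q lam (fun A => mono q (G.imgEdges π) A ^ 2) =
      Ez (fun z : Fin n → Fin K => ∏ e ∈ G.edges, sqMean q lam z (π.sym2Map e)) := by
  rw [expect_mono_sq imgEdges_subset_pairs]
  simp only [imgEdges, prod_map]

/-- Some permutation of the n nodes carries π to π', and the uniform law of z is invariant under
permutations of the nodes. -/
theorem expect_mono_imgEdges_sq_congr (π π' : Fin G.order ↪ Fin n) :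
    expect n K q lam (fun A => mono q (G.imgEdges π) A ^ 2) =
      expect n K q lam (fun A => mono q (G.imgEdges π') A ^ 2) := by
  classical
  obtain ⟨τ, hτ⟩ : ∃ τ : Equiv.Perm (Fin n), ∀ a, τ (π a) = π' a := by
    let e : {x // ∃ a, π a = x} ≃ {x // ∃ a, π' a = x} :=
      ((Equiv.ofInjective π π.injective).symm.trans (Equiv.ofInjective π' π'.injective))
    refine ⟨e.extendSubtype, fun a => ?_⟩
    rw [Equiv.extendSubtype_apply_of_mem e _ ⟨a, rfl⟩]
    have : (Equiv.ofInjective π π.injective).symm ⟨π a, a, rfl⟩ = a :=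
      Equiv.ofInjective_symm_apply π.injective a
    change ((Equiv.ofInjective π' π'.injective)
      ((Equiv.ofInjective π π.injective).symm ⟨π a, a, rfl⟩) : Fin n) = π' a
    rw [this]
    rfl
  rw [expect_mono_imgEdges_sq, expect_mono_imgEdges_sq]
  unfold Ez
  rw [← (Equiv.arrowCongr τ.symm (Equiv.refl (Fin K))).sum_comp]
  refine sum_congr rfl fun z _ => ?_
  congr 1
  refine prod_congr rfl fun e _ => ?_
  have : (π.sym2Map e).map ((Equiv.arrowCongr τ.symm (Equiv.refl (Fin K))) z) =
      (π'.sym2Map e).map z := by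
    induction e with
    | _ a b => simp [hτ]
  unfold sqMean xi
  rw [this]

end parts

end Template

namespace Template

/-! ### Labelings -/

theorem mem_labelings {G : Template} {π : Fin G.order ↪ Fin n} :
    π ∈ labelings n G ↔ (π G.v₁ : ℕ) = 0 ∧ (π G.v₂ : ℕ) = 1 := by
  simp [labelings]

theorem card_embeddings_fix (m N : ℕ) :
    (univ.filter fun π : Fin (m + 2) ↪ Fin (N + 2) => (π 0 : ℕ) = 0 ∧ (π 1 : ℕ) = 1).card =
      N.descFactorial m := by
  have hc : Fintype.card (Fin m ↪ Fin N) = N.descFactorial m := by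
    rw [Fintype.card_embedding_eq, Fintype.card_fin, Fintype.card_fin]
  rw [← hc, ← card_univ]
  symm
  let F : (Fin m ↪ Fin N) → (Fin (m + 2) → Fin (N + 2)) := fun φ =>
    Fin.cons 0 (Fin.cons 1 fun k => (φ k).succ.succ)
  have hF : ∀ φ, Function.Injective (F φ) := by
    intro φ
    refine Fin.cons_injective_iff.2 ⟨?_, Fin.cons_injective_iff.2 ⟨?_, fun a b h => ?_⟩⟩
    · rintro ⟨k, hk⟩
      refine Fin.cases (fun h => ?_) (fun k h => ?_) k hk <;> simp [Fin.ext_iff] at h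
    · rintro ⟨k, hk⟩
      simp [Fin.ext_iff] at hk
    · exact φ.injective (Fin.succ_injective _ (Fin.succ_injective _ h))
  refine card_bij (fun φ _ => ⟨F φ, hF φ⟩) ?_ ?_ ?_
  · intro φ _
    simp only [mem_filter, mem_univ, true_and, Function.Embedding.coeFn_mk]
    exact ⟨rfl, rfl⟩
  · intro φ _ ψ _ h
    ext k
    have := DFunLike.congr_fun h k.succ.succ
    simpa [F, Fin.cons_succ, Fin.ext_iff] using this
  · intro π hπ
    simp only [mem_filter, mem_univ, true_and] at hπ
    have hge : ∀ k : Fin m, 2 ≤ (π k.succ.succ : ℕ) := by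
      intro k
      by_contra hlt
      have h01 : (π k.succ.succ : ℕ) = 0 ∨ (π k.succ.succ : ℕ) = 1 := by omega
      rcases h01 with h | h
      · exact absurd (π.injective (Fin.ext (h.trans hπ.1.symm))) (by simp [Fin.ext_iff])
      · exact absurd (π.injective (Fin.ext (h.trans hπ.2.symm))) (by simp [Fin.ext_iff])
    refine ⟨⟨fun k => ⟨π k.succ.succ - 2, by have := (π k.succ.succ).2; have := hge k; omega⟩,
      fun a b h => ?_⟩, mem_univ _, ?_⟩
    · have h1 := hge a
      have h2 := hge b
      simp only [Fin.ext_iff] at h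
      have := π.injective (Fin.ext (by omega : (π a.succ.succ : ℕ) = π b.succ.succ))
      simpa using this
    · ext k
      refine Fin.cases ?_ (fun k => Fin.cases ?_ (fun k => ?_) k) k
      · exact hπ.1.symm
      · exact hπ.2.symm
      · have := hge k
        change (π k.succ.succ : ℕ) - 2 + 1 + 1 = π k.succ.succ
        omega

theorem card_labelings {G : Template} (h : G.order ≤ n) :
    ((labelings n G).card : ℝ) = ((n - 2).factorial : ℝ) / ((n - G.order).factorial : ℝ) := by
  obtain ⟨r, hr, g⟩ := G
  obtain ⟨m, rfl⟩ : ∃ m, r = m + 2 := ⟨r - 2, by omega⟩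
  simp only at h
  obtain ⟨N, rfl⟩ : ∃ N, n = N + 2 := ⟨n - 2, by omega⟩
  have h1 : (labelings (N + 2) ⟨m + 2, hr, g⟩).card = N.descFactorial m :=
    card_embeddings_fix m N
  have h2 := Nat.factorial_mul_descFactorial (by omega : m ≤ N)
  rw [h1, eq_div_iff (by positivity)]
  simp only [Nat.add_sub_cancel, Nat.add_sub_add_right]
  rw [mul_comm]
  exact_mod_cast h2

section pair

variable {G H : Template} {α α' : Fin G.order ↪ Fin n} {β β' ρ : Fin H.order ↪ Fin n}

theorem labelings_v₁ (hα : α ∈ labelings n G) (hβ : β ∈ labelings n H) : α G.v₁ = β H.v₁ :=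
  Fin.ext ((mem_labelings.1 hα).1.trans (mem_labelings.1 hβ).1.symm)

theorem labelings_v₂ (hα : α ∈ labelings n G) (hβ : β ∈ labelings n H) : α G.v₂ = β H.v₂ :=
  Fin.ext ((mem_labelings.1 hα).2.trans (mem_labelings.1 hβ).2.symm)

/-- The edges that are in exactly one of the two labeled templates. -/
def diffEdges (α : Fin G.order ↪ Fin n) (β : Fin H.order ↪ Fin n) : Finset (Sym2 (Fin n)) :=
  symmDiff (G.imgEdges α) (H.imgEdges β)

/-- The shadow of a pair of labelings: for every node touched by an unmatched edge, its two
preimages, if any. -/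
def shadow (α : Fin G.order ↪ Fin n) (β : Fin H.order ↪ Fin n) :
    Finset (Option (Fin G.order) × Option (Fin H.order)) :=
  (verts (diffEdges α β)).image fun x => (Function.partialInv α x, Function.partialInv β x)

theorem partialInv_eq_some {x : Fin n} {a : Fin G.order} :
    Function.partialInv α x = some a ↔ α a = x :=
  α.injective.isPartialInv a x

theorem partialInv_eq_none {x : Fin n} :
    Function.partialInv α x = none ↔ ∀ a, α a ≠ x := by
  rw [Option.eq_none_iff_forall_ne_some]
  exact forall_congr' fun a => not_congr partialInv_eq_some

theorem mem_shadow_some_some {a : Fin G.order} {b : Fin H.order} :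
    (some a, some b) ∈ shadow α β ↔ α a = β b ∧ α a ∈ verts (diffEdges α β) := by
  simp only [shadow, mem_image, Prod.mk.injEq, partialInv_eq_some]
  constructor
  · rintro ⟨x, hx, rfl, h⟩; exact ⟨h.symm, hx⟩
  · rintro ⟨h, hx⟩; exact ⟨_, hx, rfl, h.symm⟩

theorem mem_shadow_none_some {b : Fin H.order} :
    (none, some b) ∈ shadow α β ↔ (∀ a, α a ≠ β b) ∧ β b ∈ verts (diffEdges α β) := by
  simp only [shadow, mem_image, Prod.mk.injEq, partialInv_eq_some, partialInv_eq_none]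
  constructor
  · rintro ⟨x, hx, h, rfl⟩; exact ⟨h, hx⟩
  · rintro ⟨h, hx⟩; exact ⟨_, hx, h, rfl⟩

theorem exists_mem_shadow_some_right {b : Fin H.order} :
    (∃ o, (o, some b) ∈ shadow α β) ↔ β b ∈ verts (diffEdges α β) := by
  simp only [shadow, mem_image, Prod.mk.injEq, partialInv_eq_some]
  constructor
  · rintro ⟨o, x, hx, _, rfl⟩; exact hx
  · intro h; exact ⟨_, _, h, rfl, rfl⟩

theorem exists_mem_shadow_some_left {a : Fin G.order} :
    (∃ o, (some a, o) ∈ shadow α β) ↔ α a ∈ verts (diffEdges α β) := by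
  simp only [shadow, mem_image, Prod.mk.injEq, partialInv_eq_some]
  constructor
  · rintro ⟨o, x, hx, rfl, _⟩; exact hx
  · intro h; exact ⟨_, _, h, rfl, rfl⟩

theorem shadow_swap : shadow β α = (shadow α β).map (Equiv.prodComm _ _).toEmbedding := by
  ext ⟨o, o'⟩
  simp only [shadow, diffEdges, symmDiff_comm (H.imgEdges β), mem_image, mem_map,
    Equiv.coe_toEmbedding, Equiv.prodComm_apply, Prod.exists, Prod.swap_prod_mk, Prod.mk.injEq]
  constructor
  · rintro ⟨x, hx, h1, h2⟩; exact ⟨o', o, ⟨x, hx, h2, h1⟩, rfl, rfl⟩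
  · rintro ⟨_, _, ⟨x, hx, h2, h1⟩, rfl, rfl⟩; exact ⟨x, hx, h1, h2⟩

theorem card_shadow_le : (shadow α β).card ≤ 2 * (diffEdges α β).card :=
  card_image_le.trans (card_verts_le _)

theorem shadow_nonempty (h : (diffEdges α β).Nonempty) : (shadow α β).Nonempty := by
  obtain ⟨e, he⟩ := h
  obtain ⟨v, hv, hvd⟩ := IsParts.touches_of_mem he
  exact ⟨_, mem_image_of_mem _ hvd⟩

theorem shadow_eq_empty_iff : shadow α β = ∅ ↔ G.imgEdges α = H.imgEdges β := by
  constructor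
  · intro h
    by_contra hne
    refine (shadow_nonempty (α := α) (β := β) ?_).ne_empty h
    rw [nonempty_iff_ne_empty]
    intro h0
    exact hne (symmDiff_eq_bot.1 h0)
  · intro h
    have : diffEdges α β = ∅ := by
      unfold diffEdges; rw [h]; exact symmDiff_self _
    simp [shadow, this, verts]

/-- An unmatched node is touched by an unmatched edge. -/
theorem mem_verts_of_forall_ne (hH : H.Admissible D) (hα : α ∈ labelings n G)
    (hβ : β ∈ labelings n H) {b : Fin H.order} (h : ∀ a, α a ≠ β b) :
    β b ∈ verts (diffEdges α β) := by
  obtain ⟨e, he, hbe⟩ := exists_edge (α := β) hH b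
    (by rintro rfl; exact h _ (labelings_v₁ hα hβ)) (by rintro rfl; exact h _ (labelings_v₂ hα hβ))
  refine mem_verts.2 ⟨e, mem_symmDiff.2 (Or.inr ⟨he, fun he' => ?_⟩), hbe⟩
  obtain ⟨a, ha⟩ := mem_range_of_mem_imgEdges he' hbe
  exact h a ha

theorem mem_shadow_none_some' (hH : H.Admissible D) (hα : α ∈ labelings n G)
    (hβ : β ∈ labelings n H) {b : Fin H.order} :
    (none, some b) ∈ shadow α β ↔ ∀ a, α a ≠ β b :=
  mem_shadow_none_some.trans ⟨And.left, fun h => ⟨h, mem_verts_of_forall_ne hH hα hβ h⟩⟩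

theorem mem_imgEdges_iff_of_notMem_verts {e : Sym2 (Fin n)} {x : Fin n} (hx : x ∈ e)
    (h : x ∉ verts (diffEdges α β)) : e ∈ G.imgEdges α ↔ e ∈ H.imgEdges β := by
  by_contra hne
  refine h (mem_verts.2 ⟨e, mem_symmDiff.2 ?_, hx⟩)
  tauto

/-- The labeling `β` with the nodes in the shadow relabeled by themselves. -/
def shadowLabel (s : Finset (Option (Fin G.order) × Option (Fin H.order)))
    (β : Fin H.order ↪ Fin n) : Fin H.order ↪ Fin n ⊕ Fin H.order := by
  classical
  exact ⟨fun b => if ∃ o, (o, some b) ∈ s then Sum.inr b else Sum.inl (β b), fun b b' h => by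
    simp only at h
    split_ifs at h
    · exact Sum.inr_injective h
    · exact β.injective (Sum.inl_injective h)⟩

variable {s : Finset (Option (Fin G.order) × Option (Fin H.order))}

theorem shadowLabel_of_mem {b : Fin H.order} (h : ∃ o, (o, some b) ∈ s) :
    shadowLabel s β b = Sum.inr b := if_pos h

theorem shadowLabel_of_notMem {b : Fin H.order} (h : ¬ ∃ o, (o, some b) ∈ s) :
    shadowLabel s β b = Sum.inl (β b) := if_neg h

/-- An edge of H at a node outside the shadow is matched, so it is the image of an edge of G. As ρ
has the same shadow, that edge of G is also matched under ρ, hence comes from an edge of H. If the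
other endpoint lies in the shadow, its partner in G is recorded in s and is the same for β and ρ. -/
theorem shadowLabel_mk_mem (hβs : shadow α β = s)
    (hρs : shadow α ρ = s) {b b' : Fin H.order} (hb : ¬ ∃ o, (o, some b) ∈ s)
    (hbb : H.graph.Adj b b') :
    s(shadowLabel s β b, shadowLabel s β b') ∈ H.imgEdges (shadowLabel s ρ) := by
  have hbv : β b ∉ verts (diffEdges α β) := by
    rwa [← exists_mem_shadow_some_right, hβs]
  have he : s(β b, β b') ∈ G.imgEdges α :=
    (mem_imgEdges_iff_of_notMem_verts (by simp) hbv).2 (mk_mem_imgEdges.2 hbb)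
  obtain ⟨a, ha⟩ := mem_range_of_mem_imgEdges he (Sym2.mem_mk_left _ _)
  obtain ⟨a', ha'⟩ := mem_range_of_mem_imgEdges he (Sym2.mem_mk_right _ _)
  have hav : α a ∉ verts (diffEdges α ρ) := by
    rw [← exists_mem_shadow_some_left, hρs, ← hβs, exists_mem_shadow_some_left, ha]
    exact hbv
  have he' : s(α a, α a') ∈ H.imgEdges ρ := by
    rw [← mem_imgEdges_iff_of_notMem_verts (Sym2.mem_mk_left _ _) hav, ha, ha']
    exact he
  obtain ⟨b₁, hb₁⟩ := mem_range_of_mem_imgEdges he' (Sym2.mem_mk_left _ _)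
  obtain ⟨b₂, hb₂⟩ := mem_range_of_mem_imgEdges he' (Sym2.mem_mk_right _ _)
  have hadj : H.graph.Adj b₁ b₂ := by
    rw [← mk_mem_imgEdges (α := ρ), hb₁, hb₂]; exact he'
  have h1 : shadowLabel s ρ b₁ = shadowLabel s β b := by
    rw [shadowLabel_of_notMem hb, shadowLabel_of_notMem, hb₁, ha]
    rw [← hρs, exists_mem_shadow_some_right, hb₁]
    exact hav
  have h2 : shadowLabel s ρ b₂ = shadowLabel s β b' := by
    by_cases hb' : ∃ o, (o, some b') ∈ s
    · have hv : β b' ∈ verts (diffEdges α β) := by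
        rwa [← exists_mem_shadow_some_right, hβs]
      have hmem : (some a', some b') ∈ s := by
        rw [← hβs]; exact mem_shadow_some_some.2 ⟨ha', ha' ▸ hv⟩
      have h3 : α a' = ρ b' := by
        rw [← hρs] at hmem; exact (mem_shadow_some_some.1 hmem).1
      have h4 : b₂ = b' := ρ.injective (hb₂.trans h3)
      rw [h4, shadowLabel_of_mem hb', shadowLabel_of_mem hb']
    · rw [shadowLabel_of_notMem hb', shadowLabel_of_notMem, hb₂, ha']
      rw [← hρs, exists_mem_shadow_some_right, hb₂, ← exists_mem_shadow_some_left, hρs, ← hβs,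
        exists_mem_shadow_some_left, ha', ← exists_mem_shadow_some_right, hβs]
      exact hb'
  rw [← h1, ← h2]
  exact mk_mem_imgEdges.2 hadj

/-- By symmetry the two relabeled images coincide: the relabeled copy of H depends on β only through
its shadow. -/
theorem imgEdges_shadowLabel_subset (hβs : shadow α β = s) (hρs : shadow α ρ = s) :
    H.imgEdges (shadowLabel s β) ⊆ H.imgEdges (shadowLabel s ρ) := by
  intro e he
  obtain ⟨b, b', hbb, rfl⟩ := mem_imgEdges.1 he
  by_cases hb : ∃ o, (o, some b) ∈ s
  · by_cases hb' : ∃ o, (o, some b') ∈ s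
    · rw [shadowLabel_of_mem hb, shadowLabel_of_mem hb', ← shadowLabel_of_mem (β := ρ) hb,
        ← shadowLabel_of_mem (β := ρ) hb']
      exact mk_mem_imgEdges.2 hbb
    · rw [Sym2.eq_swap]
      exact shadowLabel_mk_mem hβs hρs hb' hbb.symm
  · exact shadowLabel_mk_mem hβs hρs hb hbb

/-- The number of labelings of `H` with a given shadow, for a given labeling of `G`. -/
theorem card_filter_shadow_le (hH : H.Admissible D) (α : Fin G.order ↪ Fin n)
    (s : Finset (Option (Fin G.order) × Option (Fin H.order))) :
    ((labelings n H).filter fun β => shadow α β = s).card ≤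
      H.autCard * n ^ (univ.filter fun b => (none, some b) ∈ s).card := by
  classical
  rcases ((labelings n H).filter fun β => shadow α β = s).eq_empty_or_nonempty with h0 | ⟨ρ, hρ⟩
  · simp [h0]
  rw [mem_filter] at hρ
  obtain ⟨hρL, hρs⟩ := hρ
  let Aut := {σ : H.graph ≃g H.graph // σ H.v₁ = H.v₁ ∧ σ H.v₂ = H.v₂}
  have hfin : Finite Aut := by
    have : Finite (H.graph ≃g H.graph) :=
      Finite.of_injective (fun σ : H.graph ≃g H.graph => (σ : Fin H.order → Fin H.order))
        DFunLike.coe_injective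
    exact Subtype.finite
  have : Fintype Aut := Fintype.ofFinite _
  have hcard : H.autCard * n ^ (univ.filter fun b => (none, some b) ∈ s).card =
      (univ : Finset (Aut × ({b // (none, some b) ∈ s} → Fin n))).card := by
    rw [card_univ, Fintype.card_prod, Fintype.card_fun, Fintype.card_fin,
      ← Nat.card_eq_fintype_card (α := Aut), Fintype.card_subtype]
    rfl
  rw [hcard]
  -- Two labelings with shadow s have equal relabeled images, so their relabelings differ by an
  -- automorphism of H fixing `v₁` and `v₂`.
  have hiso : ∀ β ∈ (labelings n H).filter (fun β => shadow α β = s), ∃ σ : Aut, ∀ b,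
      shadowLabel s ρ (σ.1 b) = shadowLabel s β b := by
    intro β hβ
    rw [mem_filter] at hβ
    have hv : ∀ v, β v = ρ v → shadowLabel s β v = shadowLabel s ρ v := by
      intro v hv
      by_cases h : ∃ o, (o, some v) ∈ s
      · rw [shadowLabel_of_mem h, shadowLabel_of_mem h]
      · rw [shadowLabel_of_notMem h, shadowLabel_of_notMem h, hv]
    obtain ⟨σ, hσ, h⟩ := exists_iso_of_imgEdges_eq hH hH (hv _ (labelings_v₁ hβ.1 hρL))
      (hv _ (labelings_v₂ hβ.1 hρL))
      (Subset.antisymm (imgEdges_shadowLabel_subset hβ.2 hρs)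
        (imgEdges_shadowLabel_subset hρs hβ.2))
    exact ⟨⟨σ, hσ⟩, h⟩
  have : Nonempty Aut := ⟨(hiso ρ (mem_filter.2 ⟨hρL, hρs⟩)).choose⟩
  choose! σ hσ using hiso
  -- The automorphism determines β outside the shadow, and α determines it at shadow nodes with a
  -- partner in G. Only the values at unmatched nodes remain to be recorded.
  refine card_le_card_of_injOn (fun β => (σ β, fun b => β b.1)) (fun _ _ => mem_univ _) ?_
  intro β hβ β' hβ' heq
  rw [Prod.mk.injEq] at heq
  obtain ⟨h1, h2⟩ := heq
  rw [mem_coe] at hβ hβ'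
  have hlab : ∀ b, shadowLabel s β b = shadowLabel s β' b := fun b => by
    rw [← hσ β hβ, ← hσ β' hβ', h1]
  rw [mem_filter] at hβ hβ'
  ext b
  congr 1
  by_cases hb : ∃ o, (o, some b) ∈ s
  · obtain ⟨o, ho⟩ := hb
    cases o with
    | none => exact congrFun h2 ⟨b, ho⟩
    | some a =>
      have h3 := ho
      rw [← hβ.2] at ho
      rw [← hβ'.2] at h3
      exact (mem_shadow_some_some.1 ho).1.symm.trans (mem_shadow_some_some.1 h3).1
  · have := hlab b
    rw [shadowLabel_of_notMem hb, shadowLabel_of_notMem hb] at this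
    exact Sum.inl_injective this

/-- The pairs of labelings with shadow `s`. -/
def shadowPairs (n : ℕ) (s : Finset (Option (Fin G.order) × Option (Fin H.order))) :
    Finset ((Fin G.order ↪ Fin n) × (Fin H.order ↪ Fin n)) :=
  {p ∈ labelings n G ×ˢ labelings n H | shadow p.1 p.2 = s}

theorem mem_shadowPairs {p : (Fin G.order ↪ Fin n) × (Fin H.order ↪ Fin n)} :
    p ∈ shadowPairs n s ↔ (p.1 ∈ labelings n G ∧ p.2 ∈ labelings n H) ∧ shadow p.1 p.2 = s := by
  simp [shadowPairs]

theorem card_shadowPairs_le_left (hH : H.Admissible D)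
    (s : Finset (Option (Fin G.order) × Option (Fin H.order))) :
    (shadowPairs n s).card ≤ (labelings n G).card * (H.autCard *
      n ^ (univ.filter fun b => (none, some b) ∈ s).card) := by
  rw [mul_comm]
  refine card_le_mul_card_image_of_maps_to (f := Prod.fst)
    (fun p hp => (mem_shadowPairs.1 hp).1.1) _ fun α _ =>
    le_trans ?_ (card_filter_shadow_le hH α s)
  refine card_le_card_of_injOn Prod.snd (fun p hp => ?_) fun p hp p' hp' h => ?_
  · rw [mem_coe, mem_filter, mem_shadowPairs] at hp
    obtain ⟨⟨⟨_, h2⟩, h3⟩, rfl⟩ := hp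
    exact mem_filter.2 ⟨h2, h3⟩
  · rw [mem_coe, mem_filter] at hp hp'
    exact Prod.ext (hp.2.trans hp'.2.symm) h

theorem card_shadowPairs_le_right (hG : G.Admissible D)
    (s : Finset (Option (Fin G.order) × Option (Fin H.order))) :
    (shadowPairs n s).card ≤ (labelings n H).card * (G.autCard *
      n ^ (univ.filter fun a => (some a, none) ∈ s).card) := by
  have h := card_shadowPairs_le_left (n := n) (G := H) hG (s.map (Equiv.prodComm _ _).toEmbedding)
  have h1 : (univ.filter fun a : Fin G.order => (none, some a) ∈
      s.map (Equiv.prodComm _ _).toEmbedding) = univ.filter fun a => (some a, none) ∈ s := by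
    ext a
    simp
  rw [h1] at h
  refine le_trans (card_le_card_of_injOn Prod.swap (fun p hp => ?_)
    Prod.swap_injective.injOn) h
  obtain ⟨⟨h2, h3⟩, rfl⟩ := mem_shadowPairs.1 hp
  exact mem_shadowPairs.2 ⟨⟨h3, h2⟩, shadow_swap⟩

end pair

end Template

/-- The sum equals (1 + y)^|X| ≤ e. It serves both for the sum over shadows and for the sum over
templates. -/
theorem sum_pow_card_le {X : Type*} [Fintype X] {y : ℝ} (hy : 0 ≤ y)
    (h : (Fintype.card X : ℝ) * y ≤ 1) : ∑ s : Finset X, y ^ s.card ≤ 3 := by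
  have h1 := Finset.sum_pow_mul_eq_add_pow y 1 (univ : Finset X)
  simp only [one_pow, mul_one, powerset_univ, card_univ] at h1
  rw [h1]
  calc (y + 1) ^ Fintype.card X ≤ Real.exp y ^ Fintype.card X :=
        pow_le_pow_left₀ (by positivity) (Real.add_one_le_exp y) _
    _ = Real.exp (Fintype.card X * y) := (Real.exp_nat_mul _ _).symm
    _ ≤ Real.exp 1 := Real.exp_le_exp.2 h
    _ ≤ 3 := by linarith [Real.exp_one_lt_d9]

namespace Template

/-! ### The correlation of a pair of labeled templates -/

/-- The correlation of the corrected monomials of a pair of labeled templates. -/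
def pairCorr (n K : ℕ) (q lam : ℝ) {G H : Template}
    (p : (Fin G.order ↪ Fin n) × (Fin H.order ↪ Fin n)) : ℝ :=
  expect n K q lam fun A => corrected n K q lam G p.1 A * corrected n K q lam H p.2 A

/-- The common second moment of the monomials of the labeled templates. -/
def secondMoment (n K : ℕ) (q lam : ℝ) (G : Template) (h : G.order ≤ n) : ℝ :=
  expect n K q lam fun A => edgePoly q G.edges (Fin.castLEEmb h) A ^ 2

section pair

variable {G H : Template} {α : Fin G.order ↪ Fin n} {β : Fin H.order ↪ Fin n}

theorem secondMoment_eq (h : G.order ≤ n) (α : Fin G.order ↪ Fin n) :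
    secondMoment n K q lam G h = expect n K q lam (fun A => mono q (G.imgEdges α) A ^ 2) := by
  rw [secondMoment, expect_mono_imgEdges_sq_congr α (Fin.castLEEmb h)]
  simp only [edgePoly_eq]
  rfl

/-- The nodes of the first labeled template that are not nodes of the second one. -/
def unmatched (α : Fin G.order ↪ Fin n) (β : Fin H.order ↪ Fin n) : Finset (Fin n) :=
  (univ.filter fun a => ∀ b, β b ≠ α a).map α

theorem mem_unmatched {x : Fin n} : x ∈ unmatched α β ↔ ∃ a, (∀ b, β b ≠ α a) ∧ α a = x := by
  simp [unmatched]

theorem card_unmatched_left (hG : G.Admissible D) (hα : α ∈ labelings n G)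
    (hβ : β ∈ labelings n H) :
    (unmatched α β).card = (univ.filter fun a => (some a, none) ∈ shadow α β).card := by
  rw [unmatched, card_map]
  congr 1
  ext a
  simp only [mem_filter, mem_univ, true_and]
  rw [← mem_shadow_none_some' hG hβ hα, shadow_swap]
  simp

theorem card_unmatched_right (hH : H.Admissible D) (hα : α ∈ labelings n G)
    (hβ : β ∈ labelings n H) :
    (unmatched β α).card = (univ.filter fun b => (none, some b) ∈ shadow α β).card := by
  rw [unmatched, card_map]
  congr 1
  ext b
  simp only [mem_filter, mem_univ, true_and]
  rw [mem_shadow_none_some' hH hα hβ]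

theorem not_touches_unmatched {e : Sym2 (Fin n)} (he : e ∈ H.imgEdges β) :
    ¬ Touches (unmatched α β) e := by
  rintro ⟨v, hv, hvU⟩
  obtain ⟨a, ha, rfl⟩ := mem_unmatched.1 hvU
  obtain ⟨b, hb⟩ := mem_range_of_mem_imgEdges he hv
  exact ha b hb

/-- If a nonempty set of unmatched nodes is crossed by no edge, a whole component of the labeled G
lies inside it, away from H, and its centered factor kills the correlation. -/
theorem hangsOff_or_eq_zero (hK : K ≠ 0) (hG : G.Admissible D) (hα : α ∈ labelings n G)
    (hβ : β ∈ labelings n H) :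
    HangsOff (G.imgEdges α) (H.imgEdges β) (unmatched α β) ∨
      expect n K q lam (fun A => corr n K q lam (G.imgParts α) A * corr n K q lam (H.imgParts β) A)
        = 0 := by
  by_cases h : Hanging (G.imgEdges α) (unmatched α β)
  · exact Or.inl ⟨h, fun e he => not_touches_unmatched he⟩
  · right
    unfold Hanging at h
    push Not at h
    obtain ⟨W, hWU, ⟨x, hx⟩, hW⟩ := h
    obtain ⟨a, ha, rfl⟩ := mem_unmatched.1 (hWU hx)
    obtain ⟨e, he, hae⟩ := exists_edge (α := α) hG a
      (by rintro rfl; exact ha _ (labelings_v₁ hβ hα))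
      (by rintro rfl; exact ha _ (labelings_v₂ hβ hα))
    exact expect_corr_mul_corr_eq_zero hK isParts_imgParts isParts_imgParts hW
      (fun f hf ht => not_touches_unmatched hf (ht.mono hWU)) he ⟨_, hae, hx⟩

theorem pairCorr_eq (p : (Fin G.order ↪ Fin n) × (Fin H.order ↪ Fin n)) :
    pairCorr n K q lam p = expect n K q lam
      (fun A => corr n K q lam (G.imgParts p.1) A * corr n K q lam (H.imgParts p.2) A) := by
  unfold pairCorr
  simp only [corrected_eq]

theorem pairCorr_comm : pairCorr n K q lam (α, β) = pairCorr n K q lam (β, α) := by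
  simp only [pairCorr, mul_comm]

theorem autCard_pos (G : Template) : 0 < G.autCard := by
  have hfin : Finite {σ : G.graph ≃g G.graph // σ G.v₁ = G.v₁ ∧ σ G.v₂ = G.v₂} := by
    have : Finite (G.graph ≃g G.graph) :=
      Finite.of_injective (fun σ : G.graph ≃g G.graph => (σ : Fin G.order → Fin G.order))
        DFunLike.coe_injective
    exact Subtype.finite
  have : Nonempty {σ : G.graph ≃g G.graph // σ G.v₁ = G.v₁ ∧ σ G.v₂ = G.v₂} :=
    ⟨⟨SimpleGraph.Iso.refl, rfl, rfl⟩⟩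
  exact Nat.card_pos

theorem expect_Psi_mul_Psi (hGn : G.order ≤ n) (hHn : H.order ≤ n) :
    expect n K q lam (fun A => Psi n K q lam G hGn A * Psi n K q lam H hHn A) =
      (∑ s : Finset (Option (Fin G.order) × Option (Fin H.order)),
        ∑ p ∈ shadowPairs n s, pairCorr n K q lam p) /
      (√(varianceProxy n K q lam G hGn) * √(varianceProxy n K q lam H hHn)) := by
  have h1 : (fun A => Psi n K q lam G hGn A * Psi n K q lam H hHn A) = fun A =>
      (√(varianceProxy n K q lam G hGn) * √(varianceProxy n K q lam H hHn))⁻¹ *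
        ∑ p ∈ labelings n G ×ˢ labelings n H,
          corrected n K q lam G p.1 A * corrected n K q lam H p.2 A := by
    funext A
    rw [sum_product]
    dsimp only
    rw [← sum_mul_sum]
    unfold Psi
    rw [div_mul_div_comm, div_eq_mul_inv, mul_comm]
  rw [h1, expect_const_mul, expect_sum, mul_comm, div_eq_mul_inv]
  congr 1
  exact (sum_fiberwise_of_maps_to (fun _ _ => mem_univ _) _).symm

/-- The upper bound is the general count. For the lower bound, each automorphism σ turns α into the
pair (α, α ∘ σ), whose two images are equal. -/
theorem card_shadowPairs_empty (hG : G.Admissible D) :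
    (shadowPairs n (∅ : Finset (Option (Fin G.order) × Option (Fin G.order)))).card =
      (labelings n G).card * G.autCard := by
  refine le_antisymm (by simpa using card_shadowPairs_le_left (n := n) (G := G) hG ∅) ?_
  let Aut := {σ : G.graph ≃g G.graph // σ G.v₁ = G.v₁ ∧ σ G.v₂ = G.v₂}
  have hfin : Finite Aut := by
    have : Finite (G.graph ≃g G.graph) :=
      Finite.of_injective (fun σ : G.graph ≃g G.graph => (σ : Fin G.order → Fin G.order))
        DFunLike.coe_injective
    exact Subtype.finite
  have : Fintype Aut := Fintype.ofFinite _
  have hcard : (labelings n G).card * G.autCard =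
      (labelings n G ×ˢ (univ : Finset Aut)).card := by
    rw [card_product, card_univ, ← Nat.card_eq_fintype_card]; rfl
  rw [hcard]
  have himg : ∀ (α : Fin G.order ↪ Fin n) (σ : Aut),
      G.imgEdges (σ.1.toEquiv.toEmbedding.trans α) ⊆ G.imgEdges α := by
    intro α σ e he
    obtain ⟨a, b, hab, rfl⟩ := mem_imgEdges.1 he
    exact mem_imgEdges.2 ⟨_, _, σ.1.map_adj_iff.2 hab, rfl⟩
  refine card_le_card_of_injOn (fun x => (x.1, x.2.1.toEquiv.toEmbedding.trans x.1))
    (fun x hx => ?_) ?_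
  · rw [mem_coe, mem_product] at hx
    have h0 := mem_labelings.1 hx.1
    refine mem_shadowPairs.2 ⟨⟨hx.1, mem_labelings.2 ⟨?_, ?_⟩⟩, shadow_eq_empty_iff.2 ?_⟩
    · change (x.1 (x.2.1 G.v₁) : ℕ) = 0
      rw [x.2.2.1]; exact h0.1
    · change (x.1 (x.2.1 G.v₂) : ℕ) = 1
      rw [x.2.2.2]; exact h0.2
    · exact (eq_of_subset_of_card_le (himg x.1 x.2) (by rw [card_imgEdges, card_imgEdges])).symm
  · rintro ⟨α, σ⟩ _ ⟨α', σ'⟩ _ h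
    simp only [Prod.mk.injEq] at h
    obtain ⟨rfl, h⟩ := h
    refine Prod.ext rfl (Subtype.ext (RelIso.ext fun a => ?_))
    exact α.injective (DFunLike.congr_fun h a)

end pair

end Template

/-! ### Entries of the Gram matrix -/

open Template

namespace Params

variable (P : Params n K D q lam c)
include P

section pair

variable {G H : Template} {α : Fin G.order ↪ Fin n} {β : Fin H.order ↪ Fin n}

theorem secondMoment_pos (h : G.order ≤ n) : 0 < secondMoment n K q lam G h := by
  rw [secondMoment_eq h (Fin.castLEEmb h), expect_mono_sq imgEdges_subset_pairs]
  have := P.pow_mul_Ez_le (G.imgEdges (Fin.castLEEmb h)) ∅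
  simp only [inter_empty, prod_empty, Ez_one P.K_ne, mul_one] at this
  exact (pow_pos P.qb_pos _).trans_le this

/-- The main bound on the correlation of two labeled templates. -/
theorem abs_pairCorr_le (hG : G.Admissible D) (hH : H.Admissible D) (hα : α ∈ labelings n G)
    (hβ : β ∈ labelings n H) (hGn : G.order ≤ n) (hHn : H.order ≤ n) :
    |pairCorr n K q lam (α, β)| * √((n : ℝ) ^ ((unmatched α β).card + (unmatched β α).card)) ≤
      2 * (16 * eps D c ^ 4) ^ (diffEdges α β).card *
        √(secondMoment n K q lam G hGn * secondMoment n K q lam H hHn) := by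
  have he := P.eps_pos
  have hzero : pairCorr n K q lam (α, β) = 0 →
      |pairCorr n K q lam (α, β)| * √((n : ℝ) ^ ((unmatched α β).card + (unmatched β α).card)) ≤
      2 * (16 * eps D c ^ 4) ^ (diffEdges α β).card *
        √(secondMoment n K q lam G hGn * secondMoment n K q lam H hHn) := by
    intro h
    rw [h, abs_zero, zero_mul]
    positivity
  rcases hangsOff_or_eq_zero (q := q) (lam := lam) P.K_ne hG hα hβ with h₁ | h₁
  swap
  · exact hzero (by rw [pairCorr_eq]; exact h₁)
  rcases hangsOff_or_eq_zero (q := q) (lam := lam) P.K_ne hH hβ hα with h₂ | h₂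
  swap
  · exact hzero (by rw [pairCorr_comm, pairCorr_eq]; exact h₂)
  have hsq := P.sq_Ez_crossMean_le h₁ h₂ (fun e he => not_isDiag_of_mem_imgEdges he)
    (fun e he => not_isDiag_of_mem_imgEdges he) (card_imgEdges.trans_le hG.2.2)
    (card_imgEdges.trans_le hH.2.2)
  rw [← expect_mono_sq imgEdges_subset_pairs, ← expect_mono_sq imgEdges_subset_pairs,
    ← secondMoment_eq hGn, ← secondMoment_eq hHn] at hsq
  have hT := P.abs_expect_corr_mul_corr_le (isParts_imgParts (G := G) (π := α))
    (isParts_imgParts (G := H) (π := β)) imgEdges_subset_pairs imgEdges_subset_pairs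
  have hX0 : 0 ≤ Ez (crossMean (K := K) q lam (G.imgEdges α) (H.imgEdges β)) :=
    Ez_nonneg (P.posComb_crossMean _ _).nonneg
  have hsqrt : Ez (crossMean (K := K) q lam (G.imgEdges α) (H.imgEdges β)) *
      √((n : ℝ) ^ ((unmatched α β).card + (unmatched β α).card)) ≤
      2 * eps D c ^ (4 * (diffEdges α β).card) *
        √(secondMoment n K q lam G hGn * secondMoment n K q lam H hHn) := by
    have := Real.sqrt_le_sqrt hsq
    rw [Real.sqrt_mul (sq_nonneg _), Real.sqrt_sq hX0, Real.sqrt_mul (by positivity)] at this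
    have h4 : √(4 * eps D c ^ (8 * (symmDiff (G.imgEdges α) (H.imgEdges β)).card)) =
        2 * eps D c ^ (4 * (diffEdges α β).card) := by
      rw [show 4 * eps D c ^ (8 * (symmDiff (G.imgEdges α) (H.imgEdges β)).card) =
        (2 * eps D c ^ (4 * (diffEdges α β).card)) ^ 2 by
          rw [mul_pow, ← pow_mul]; unfold diffEdges; ring_nf]
      exact Real.sqrt_sq (by positivity)
    rwa [h4] at this
  rw [pairCorr_eq]
  calc _ ≤ 16 ^ (diffEdges α β).card * Ez (crossMean (K := K) q lam (G.imgEdges α) (H.imgEdges β)) *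
        √((n : ℝ) ^ ((unmatched α β).card + (unmatched β α).card)) := by
        gcongr; exact hT
    _ = 16 ^ (diffEdges α β).card * (Ez (crossMean (K := K) q lam (G.imgEdges α) (H.imgEdges β)) *
        √((n : ℝ) ^ ((unmatched α β).card + (unmatched β α).card))) := by ring
    _ ≤ 16 ^ (diffEdges α β).card * (2 * eps D c ^ (4 * (diffEdges α β).card) *
        √(secondMoment n K q lam G hGn * secondMoment n K q lam H hHn)) := by gcongr
    _ = _ := by rw [mul_pow, ← pow_mul]; ring

/-- The four powers of `eps` per unmatched edge are spent as follows: one absorbs 16, one pays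
D^(-12), that is D^(-6) for each of the at most 2d elements of the shadow, and two remain as decay
in the edit distance. -/
theorem gain_pow_le {d m k : ℕ} (hm : m ≤ d) (hk : k ≤ 2 * d) :
    (16 * eps D c ^ 4) ^ d ≤ eps D c ^ (2 * m) * (((D : ℝ) ^ 6)⁻¹) ^ k := by
  have he := P.eps_pos
  have hD := P.D_pos
  have h1 : 16 * eps D c ≤ 1 := by linarith [P.eps_le]
  have h2 : eps D c ≤ (((D : ℝ) ^ 6)⁻¹) ^ 2 := by
    rw [inv_pow, ← pow_mul, ← one_div, le_div_iff₀ (by positivity)]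
    exact P.eps_mul_le (by norm_num)
  have hy : ((D : ℝ) ^ 6)⁻¹ ≤ 1 := inv_le_one_of_one_le₀ (one_le_pow₀ (by linarith [P.two_le_D']))
  calc (16 * eps D c ^ 4) ^ d = ((16 * eps D c) * (eps D c * eps D c ^ 2)) ^ d := by ring
    _ ≤ (1 * ((((D : ℝ) ^ 6)⁻¹) ^ 2 * eps D c ^ 2)) ^ d := by gcongr
    _ = eps D c ^ (2 * d) * (((D : ℝ) ^ 6)⁻¹) ^ (2 * d) := by
        rw [one_mul, mul_pow, ← pow_mul, ← pow_mul, mul_comm]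
    _ ≤ _ := by
        refine mul_le_mul (P.eps_pow_le (by omega))
          (pow_le_pow_of_le_one (by positivity) hy hk) (by positivity) (by positivity)

/-- The number of pairs is bounded with n^(u₂) when counted from G and with n^(u₁) when counted from
H. The geometric mean of these bounds cancels the factor √(n^(u₁+u₂)) of `abs_pairCorr_le` and
rebuilds the normalisation. -/
theorem sum_abs_pairCorr_le (hG : G.Admissible D) (hH : H.Admissible D) (hGn : G.order ≤ n)
    (hHn : H.order ≤ n) {s : Finset (Option (Fin G.order) × Option (Fin H.order))}
    (hs : s.Nonempty) :
    ∑ p ∈ shadowPairs n s, |pairCorr n K q lam p| ≤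
      √(varianceProxy n K q lam G hGn) * √(varianceProxy n K q lam H hHn) *
        (2 * eps D c ^ (2 * max (editDist G H) 1) * (((D : ℝ) ^ 6)⁻¹) ^ s.card) := by
  have he := P.eps_pos
  have hn := P.n_pos
  set u₁ := (univ.filter fun a => (some a, none) ∈ s).card with hu₁
  set u₂ := (univ.filter fun b => (none, some b) ∈ s).card with hu₂
  set B := 2 * eps D c ^ (2 * max (editDist G H) 1) * (((D : ℝ) ^ 6)⁻¹) ^ s.card with hB
  have hB0 : 0 ≤ B := by positivity
  set mG := secondMoment n K q lam G hGn with hmG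
  set mH := secondMoment n K q lam H hHn with hmH
  have hmG0 : 0 < mG := P.secondMoment_pos hGn
  have hmH0 : 0 < mH := P.secondMoment_pos hHn
  have hterm : ∀ p ∈ shadowPairs n s,
      |pairCorr n K q lam p| ≤ B * √(mG * mH) / √((n : ℝ) ^ (u₁ + u₂)) := by
    rintro ⟨α, β⟩ hp
    obtain ⟨⟨hα, hβ⟩, hsh⟩ := mem_shadowPairs.1 hp
    simp only at hα hβ hsh
    have h1 := P.abs_pairCorr_le hG hH hα hβ hGn hHn
    rw [card_unmatched_left hG hα hβ, card_unmatched_right hH hα hβ, hsh] at h1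
    rw [le_div_iff₀ (Real.sqrt_pos.2 (by positivity))]
    refine h1.trans (mul_le_mul_of_nonneg_right ?_ (Real.sqrt_nonneg _))
    rw [hB, mul_assoc]
    refine mul_le_mul_of_nonneg_left (P.gain_pow_le ?_ ?_) (by norm_num)
    · refine max_le (editDist_le (labelings_v₁ hα hβ) (labelings_v₂ hα hβ)) ?_
      rw [Nat.one_le_iff_ne_zero]
      intro h0
      have := card_shadow_le (α := α) (β := β)
      rw [h0, hsh] at this
      have := hs.card_pos
      omega
    · rw [← hsh]; exact card_shadow_le
  have hcard : ((shadowPairs n s).card : ℝ) ≤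
      √(((labelings n G).card * G.autCard) * ((labelings n H).card * H.autCard)) *
        √((n : ℝ) ^ (u₁ + u₂)) := by
    have h1 : ((shadowPairs n s).card : ℝ) ≤ (labelings n G).card * (H.autCard * (n : ℝ) ^ u₂) := by
      exact_mod_cast card_shadowPairs_le_left hH s
    have h2 : ((shadowPairs n s).card : ℝ) ≤ (labelings n H).card * (G.autCard * (n : ℝ) ^ u₁) := by
      exact_mod_cast card_shadowPairs_le_right hG s
    rw [← Real.sqrt_mul (by positivity)]
    refine Real.le_sqrt_of_sq_le ?_
    calc ((shadowPairs n s).card : ℝ) ^ 2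
        = (shadowPairs n s).card * (shadowPairs n s).card := sq _
      _ ≤ ((labelings n G).card * (H.autCard * (n : ℝ) ^ u₂)) *
          ((labelings n H).card * (G.autCard * (n : ℝ) ^ u₁)) := by gcongr
      _ = _ := by rw [pow_add]; ring
  have hV : ∀ (G : Template) (h : G.order ≤ n), varianceProxy n K q lam G h =
      (labelings n G).card * G.autCard * secondMoment n K q lam G h := by
    intro G h
    rw [card_labelings h]; rfl
  calc ∑ p ∈ shadowPairs n s, |pairCorr n K q lam p|
      ≤ (shadowPairs n s).card * (B * √(mG * mH) / √((n : ℝ) ^ (u₁ + u₂))) := by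
        rw [← nsmul_eq_mul]; exact sum_le_card_nsmul _ _ _ hterm
    _ ≤ (√(((labelings n G).card * G.autCard) * ((labelings n H).card * H.autCard)) *
        √((n : ℝ) ^ (u₁ + u₂))) * (B * √(mG * mH) / √((n : ℝ) ^ (u₁ + u₂))) := by gcongr
    _ = √(((labelings n G).card * G.autCard) * ((labelings n H).card * H.autCard)) *
        √(mG * mH) * B := by
        have : √((n : ℝ) ^ (u₁ + u₂)) ≠ 0 := (Real.sqrt_pos.2 (by positivity)).ne'
        field_simp
    _ = _ := by
        rw [hV, hV, ← Real.sqrt_mul (by positivity), ← Real.sqrt_mul (by positivity)]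
        congr 2
        ring

theorem varianceProxy_pos (h : G.order ≤ n) : 0 < varianceProxy n K q lam G h := by
  have := P.secondMoment_pos (K := K) h
  have h2 := autCard_pos G
  unfold secondMoment at this
  unfold varianceProxy
  positivity

/-- Shadows are subsets of a set with at most (2D + 3)² ≤ D^6 elements. The weight D^(-6) per
element thus makes the sum over all shadows at most 3. -/
theorem sum_shadow_le (hG : G.Admissible D) (hH : H.Admissible D) (hGn : G.order ≤ n)
    (hHn : H.order ≤ n) :
    |∑ s ∈ (univ : Finset (Finset (Option (Fin G.order) × Option (Fin H.order)))).erase ∅,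
        ∑ p ∈ shadowPairs n s, pairCorr n K q lam p| ≤
      √(varianceProxy n K q lam G hGn) * √(varianceProxy n K q lam H hHn) *
        (6 * eps D c ^ (2 * max (editDist G H) 1)) := by
  have he := P.eps_pos
  have hD := P.D_pos
  set V := √(varianceProxy n K q lam G hGn) * √(varianceProxy n K q lam H hHn) with hV
  have hV0 : 0 ≤ V := by positivity
  have hy : (0 : ℝ) ≤ ((D : ℝ) ^ 6)⁻¹ := by positivity
  have hX : (Fintype.card (Option (Fin G.order) × Option (Fin H.order)) : ℝ) * ((D : ℝ) ^ 6)⁻¹ ≤ 1 := by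
    rw [← div_eq_mul_inv, div_le_one (by positivity)]
    have h1 := order_le hG
    have h2 := order_le hH
    have h3 : Fintype.card (Option (Fin G.order) × Option (Fin H.order)) ≤ D ^ 6 := by
      simp only [Fintype.card_prod, Fintype.card_option, Fintype.card_fin]
      have hD2 := P.two_le_D
      have h4 : 2 * D + 3 ≤ D ^ 3 := by
        obtain ⟨k, rfl⟩ := Nat.exists_eq_add_of_le hD2
        ring_nf
        nlinarith [sq_nonneg k, Nat.zero_le (k ^ 3)]
      calc (G.order + 1) * (H.order + 1) ≤ (2 * D + 3) * (2 * D + 3) :=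
            Nat.mul_le_mul (by omega) (by omega)
        _ ≤ D ^ 3 * D ^ 3 := Nat.mul_le_mul h4 h4
        _ = D ^ 6 := by ring
    exact_mod_cast h3
  calc _ ≤ ∑ s ∈ (univ : Finset (Finset (Option (Fin G.order) × Option (Fin H.order)))).erase ∅,
        V * (2 * eps D c ^ (2 * max (editDist G H) 1) * (((D : ℝ) ^ 6)⁻¹) ^ s.card) := by
        refine (abs_sum_le_sum_abs _ _).trans (sum_le_sum fun s hs => ?_)
        exact (abs_sum_le_sum_abs _ _).trans (P.sum_abs_pairCorr_le hG hH hGn hHn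
          (nonempty_iff_ne_empty.2 (mem_erase.1 hs).1))
    _ ≤ ∑ s : Finset (Option (Fin G.order) × Option (Fin H.order)),
        V * (2 * eps D c ^ (2 * max (editDist G H) 1) * (((D : ℝ) ^ 6)⁻¹) ^ s.card) :=
        sum_le_sum_of_subset_of_nonneg (erase_subset _ _) fun _ _ _ => by positivity
    _ = V * (2 * eps D c ^ (2 * max (editDist G H) 1) *
        ∑ s : Finset (Option (Fin G.order) × Option (Fin H.order)), (((D : ℝ) ^ 6)⁻¹) ^ s.card) := by
        rw [mul_sum, mul_sum]
    _ ≤ V * (2 * eps D c ^ (2 * max (editDist G H) 1) * 3) := by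
        gcongr; exact sum_pow_card_le hy hX
    _ = _ := by ring

/-- The entries of the Gram matrix for non-equivalent templates. -/
theorem abs_expect_Psi_mul_Psi_le (hG : G.Admissible D) (hH : H.Admissible D) (hGn : G.order ≤ n)
    (hHn : H.order ≤ n) (hne : ¬ G.Equivalent H) :
    |expect n K q lam (fun A => Psi n K q lam G hGn A * Psi n K q lam H hHn A)| ≤
      6 * eps D c ^ (2 * max (editDist G H) 1) := by
  have hV : 0 < √(varianceProxy n K q lam G hGn) * √(varianceProxy n K q lam H hHn) :=
    mul_pos (Real.sqrt_pos.2 (P.varianceProxy_pos hGn)) (Real.sqrt_pos.2 (P.varianceProxy_pos hHn))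
  -- An empty shadow means equal images, which forces the templates to be equivalent.
  have hempty : shadowPairs n (∅ : Finset (Option (Fin G.order) × Option (Fin H.order))) = ∅ := by
    rw [eq_empty_iff_forall_notMem]
    rintro ⟨α, β⟩ hp
    obtain ⟨⟨hα, hβ⟩, hsh⟩ := mem_shadowPairs.1 hp
    obtain ⟨σ, hσ, _⟩ := exists_iso_of_imgEdges_eq hG hH (labelings_v₁ hα hβ) (labelings_v₂ hα hβ)
      (shadow_eq_empty_iff.1 hsh)
    exact hne ⟨σ, hσ⟩
  rw [expect_Psi_mul_Psi, abs_div, abs_of_pos hV, div_le_iff₀ hV, mul_comm,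
    ← add_sum_erase _ _ (mem_univ (∅ : Finset (Option (Fin G.order) × Option (Fin H.order)))),
    hempty, sum_empty, zero_add]
  exact P.sum_shadow_le hG hH hGn hHn

/-- The diagonal entries of the Gram matrix. -/
theorem abs_expect_Psi_sq_sub_one_le (hG : G.Admissible D) (hGn : G.order ≤ n) :
    |expect n K q lam (fun A => Psi n K q lam G hGn A * Psi n K q lam G hGn A) - 1| ≤
      7 * eps D c ^ (2 * max (editDist G G) 1) := by
  have he := P.eps_pos
  have hd : editDist G G = 0 := by
    have := editDist_le (G := G) (H := G) (α := Function.Embedding.refl _)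
      (β := Function.Embedding.refl _) rfl rfl
    rwa [symmDiff_self, bot_eq_empty, card_empty, Nat.le_zero] at this
  have hV0 := P.varianceProxy_pos (K := K) hGn
  have hV : √(varianceProxy n K q lam G hGn) * √(varianceProxy n K q lam G hGn) =
      varianceProxy n K q lam G hGn := Real.mul_self_sqrt hV0.le
  have hrest := P.sum_shadow_le hG hG hGn hGn
  rw [expect_Psi_mul_Psi,
    ← add_sum_erase _ _ (mem_univ (∅ : Finset (Option (Fin G.order) × Option (Fin G.order))))]
  rw [hV] at hrest ⊢
  set R := ∑ s ∈ (univ : Finset (Finset (Option (Fin G.order) × Option (Fin G.order)))).erase ∅,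
        ∑ p ∈ shadowPairs n s, pairCorr n K q lam p
  set m := secondMoment n K q lam G hGn with hm
  have hm0 : 0 < m := P.secondMoment_pos hGn
  have hVm : varianceProxy n K q lam G hGn =
      (shadowPairs n (∅ : Finset (Option (Fin G.order) × Option (Fin G.order)))).card * m := by
    rw [card_shadowPairs_empty hG]
    push_cast
    rw [card_labelings hGn]; rfl
  -- The two labelings have the same image, hence the same parts, and the correlation is the second
  -- moment of a single corrected monomial.
  have hterm : ∀ p ∈ shadowPairs n (∅ : Finset (Option (Fin G.order) × Option (Fin G.order))),
      (1 - D * eps D c ^ 16) * m ≤ pairCorr n K q lam p ∧ pairCorr n K q lam p ≤ m := by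
    rintro ⟨α, β⟩ hp
    have hsh := shadow_eq_empty_iff.1 (mem_shadowPairs.1 hp).2
    have hparts : G.imgParts β = G.imgParts α :=
      (hsh ▸ isParts_imgParts : IsParts (G.imgEdges α) (G.imgParts β)).unique isParts_imgParts
    rw [pairCorr_eq]
    simp only [hparts, ← sq]
    rw [hm, secondMoment_eq hGn α]
    refine ⟨P.le_expect_corr_sq isParts_imgParts imgEdges_subset_pairs
      (card_imgEdges.trans_le hG.2.2), ?_⟩
    have h := isParts_imgParts (G := G) (π := α)
    have := P.expect_corr_sq_le h.disjoint
    simp only [← mono_biUnion h.disjoint_edges] at this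
    rwa [h.biUnion_eq] at this
  set S := ∑ p ∈ shadowPairs n (∅ : Finset (Option (Fin G.order) × Option (Fin G.order))),
    pairCorr n K q lam p
  set V := varianceProxy n K q lam G hGn
  have hS1 : (1 - D * eps D c ^ 16) * V ≤ S := by
    have := card_nsmul_le_sum _ _ _ fun p hp => (hterm p hp).1
    rw [nsmul_eq_mul] at this
    rw [hVm]; linarith
  have hS2 : S ≤ V := by
    have := sum_le_card_nsmul _ _ _ fun p hp => (hterm p hp).2
    rw [nsmul_eq_mul] at this
    rwa [hVm]
  -- The empty shadow misses 1 by at most this quantity. With the 6 ε² of the other shadows this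
  -- gives the constant 7.
  have h16 : D * eps D c ^ 16 ≤ eps D c ^ 2 := by
    have h1 := P.eps_mul_le (k := 1) (by norm_num)
    have h2 : eps D c ^ 15 ≤ eps D c ^ 2 := P.eps_pow_le (by norm_num)
    calc D * eps D c ^ 16 = (eps D c * (D : ℝ) ^ 1) * eps D c ^ 15 := by ring
      _ ≤ 1 * eps D c ^ 2 := by gcongr
      _ = _ := one_mul _
  rw [hd] at hrest ⊢
  simp only [Nat.zero_max, mul_one] at hrest ⊢
  rw [div_sub_one hV0.ne', abs_div, abs_of_pos hV0, div_le_iff₀ hV0]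
  have h3 : D * eps D c ^ 16 * V ≤ eps D c ^ 2 * V := by gcongr
  rw [abs_le] at hrest ⊢
  constructor <;> nlinarith

end pair

end Params

/-! ### Row sums and the operator norm -/

/-- **Schur's test** for real matrices. -/
theorem norm_toEuclideanCLM_le_of_sum_abs_le {ι : Type*} [Fintype ι] [DecidableEq ι]
    (A : Matrix ι ι ℝ) {R : ℝ} (hR : 0 ≤ R) (hrow : ∀ i, ∑ j, |A i j| ≤ R)
    (hcol : ∀ j, ∑ i, |A i j| ≤ R) :
    ‖Matrix.toEuclideanCLM (n := ι) (𝕜 := ℝ) A‖ ≤ R := by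
  refine ContinuousLinearMap.opNorm_le_bound _ hR fun x => ?_
  refine (sq_le_sq₀ (by positivity) (by positivity)).1 ?_
  rw [mul_pow, EuclideanSpace.real_norm_sq_eq, EuclideanSpace.real_norm_sq_eq]
  have hentry (i : ι) : (Matrix.toEuclideanCLM (n := ι) (𝕜 := ℝ) A x) i ^ 2 ≤
      R * ∑ j, |A i j| * x j ^ 2 := by
    have h1 : (Matrix.toEuclideanCLM (n := ι) (𝕜 := ℝ) A x) i = ∑ j, A i j * x j := rfl
    rw [h1]
    -- Cauchy–Schwarz with weights |A i j|.
    have h2 : (∑ j, A i j * x j) ^ 2 ≤ (∑ j, |A i j|) * ∑ j, |A i j| * x j ^ 2 := by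
      refine Finset.sum_sq_le_sum_mul_sum_of_sq_le_mul _ (fun j _ => abs_nonneg _)
        (fun j _ => by positivity) fun j _ => ?_
      rw [mul_pow, ← sq_abs (A i j)]
      exact le_of_eq (by ring)
    exact h2.trans (mul_le_mul_of_nonneg_right (hrow i) (sum_nonneg fun j _ => by positivity))
  calc ∑ i, (Matrix.toEuclideanCLM (n := ι) (𝕜 := ℝ) A x) i ^ 2
      ≤ ∑ i, R * ∑ j, |A i j| * x j ^ 2 := sum_le_sum fun i _ => hentry i
    _ = R * ∑ j, (∑ i, |A i j|) * x j ^ 2 := by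
        rw [← mul_sum, sum_comm]
        simp only [sum_mul]
    _ ≤ R * ∑ j, R * x j ^ 2 := by
        gcongr with j _
        exact hcol j
    _ = R ^ 2 * ∑ j, x j ^ 2 := by rw [← mul_sum]; ring

namespace Template

/-- The templates at a small edit distance from a given one are few. -/
theorem sum_eps_pow_editDist_le (P : Params n K D q lam c) {𝒢 : Finset Template}
    (hadm : ∀ H ∈ 𝒢, Admissible D H) (heq : ∀ G ∈ 𝒢, ∀ H ∈ 𝒢, G.Equivalent H → G = H)
    {G : Template} (hG : G.Admissible D) : ∑ H ∈ 𝒢, eps D c ^ editDist G H ≤ 3 := by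
  -- H is encoded by its symmetric difference with G in an optimal matching, drawn on the nodes of G
  -- and 2D + 2 spare nodes, enough for all nodes of H. Symmetric difference with a fixed set is
  -- injective, so the code determines H up to equivalence, and its size is the edit distance.
  have hcode (H : Template) : ∃ s : Finset (Sym2 (Fin G.order ⊕ Fin (2 * D + 2))), H ∈ 𝒢 →
      ∃ β : Fin H.order ↪ Fin G.order ⊕ Fin (2 * D + 2),
        Function.Embedding.inl G.v₁ = β H.v₁ ∧ Function.Embedding.inl G.v₂ = β H.v₂ ∧
        symmDiff (G.imgEdges Function.Embedding.inl) (H.imgEdges β) = s ∧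
        s.card = editDist G H := by
    by_cases hH : H ∈ 𝒢
    · obtain ⟨β, h₁, h₂, h₃⟩ := exists_card_symmDiff_eq_editDist (G := G) (order_le (hadm H hH))
      exact ⟨_, fun _ => ⟨β, h₁, h₂, rfl, h₃⟩⟩
    · exact ⟨∅, fun h => absurd h hH⟩
  choose code hcode using hcode
  have hinj : Set.InjOn code 𝒢 := by
    intro H₁ h₁ H₂ h₂ h
    obtain ⟨β₁, a₁, b₁, c₁, -⟩ := hcode H₁ h₁
    obtain ⟨β₂, a₂, b₂, c₂, -⟩ := hcode H₂ h₂
    rw [← c₁, ← c₂] at h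
    obtain ⟨σ, hσ, -⟩ := exists_iso_of_imgEdges_eq (hadm H₁ h₁) (hadm H₂ h₂) (a₁.symm.trans a₂)
      (b₁.symm.trans b₂) (symmDiff_right_injective _ h)
    exact heq H₁ h₁ H₂ h₂ ⟨σ, hσ⟩
  have hε := P.eps_pos.le
  calc ∑ H ∈ 𝒢, eps D c ^ editDist G H = ∑ H ∈ 𝒢, eps D c ^ (code H).card :=
        sum_congr rfl fun H hH => by
          obtain ⟨-, -, -, -, h⟩ := hcode H hH
          rw [h]
    _ = ∑ s ∈ 𝒢.image code, eps D c ^ s.card := (sum_image (f := fun s => eps D c ^ s.card) hinj).symm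
    _ ≤ ∑ s : Finset (Sym2 (Fin G.order ⊕ Fin (2 * D + 2))), eps D c ^ s.card :=
        sum_le_sum_of_subset_of_nonneg (subset_univ _) fun _ _ _ => by positivity
    _ ≤ 3 := by
        refine sum_pow_card_le hε ?_
        have hcard : Fintype.card (Sym2 (Fin G.order ⊕ Fin (2 * D + 2))) ≤ D ^ 8 := by
          rw [Sym2.card, Fintype.card_sum, Fintype.card_fin, Fintype.card_fin]
          have hD := P.two_le_D
          calc (G.order + (2 * D + 2) + 1).choose 2 ≤ (G.order + (2 * D + 2) + 1) ^ 2 :=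
                Nat.choose_le_pow _ _
            _ ≤ (D ^ 4) ^ 2 := by
                refine Nat.pow_le_pow_left ?_ 2
                have h8 : 8 * D ≤ D ^ 4 := by
                  calc 8 * D = 2 ^ 3 * D := by norm_num
                    _ ≤ D ^ 3 * D := Nat.mul_le_mul_right _ (Nat.pow_le_pow_left hD 3)
                    _ = D ^ 4 := by ring
                have := order_le hG
                omega
            _ = D ^ 8 := by rw [← pow_mul]
        calc (Fintype.card (Sym2 (Fin G.order ⊕ Fin (2 * D + 2))) : ℝ) * eps D c
            ≤ (D : ℝ) ^ 8 * eps D c := by gcongr; exact_mod_cast hcard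
          _ ≤ 1 := by rw [mul_comm]; exact P.eps_mul_le (by norm_num)

end Template

open Template

variable {𝒢 : Finset Template}

theorem gram_comm (G H : {G : 𝒢 // G.1.order ≤ n}) :
    gram n K q lam 𝒢 G H = gram n K q lam 𝒢 H G := by
  simp only [gram, mul_comm]

theorem abs_gram_sub_one_apply_le (P : Params n K D q lam c)
    (h𝒢 : IsMaximumCollection D 𝒢) (G H : {G : 𝒢 // G.1.order ≤ n}) :
    |gram n K q lam 𝒢 G H - (if G = H then 1 else 0)| ≤
      7 * eps D c ^ (2 * max (editDist G.1.1 H.1.1) 1) := by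
  split_ifs with h
  · subst h
    exact P.abs_expect_Psi_sq_sub_one_le (h𝒢.1 _ G.1.2) G.2
  · rw [sub_zero]
    refine (P.abs_expect_Psi_mul_Psi_le (h𝒢.1 _ G.1.2) (h𝒢.1 _ H.1.2) G.2 H.2 fun he =>
      h (Subtype.ext (Subtype.ext (h𝒢.2.1 _ G.1.2 _ H.1.2 he)))).trans ?_
    have := P.eps_pos
    gcongr
    norm_num

theorem sum_abs_gram_sub_one_le (P : Params n K D q lam c)
    (h𝒢 : IsMaximumCollection D 𝒢) (G : {G : 𝒢 // G.1.order ≤ n}) :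
    ∑ H, |(gram n K q lam 𝒢 - 1) G H| ≤ 21 * eps D c := by
  have hε := P.eps_pos.le
  calc ∑ H, |(gram n K q lam 𝒢 - 1) G H|
      ≤ ∑ H : {G : 𝒢 // G.1.order ≤ n}, 7 * eps D c * eps D c ^ editDist G.1.1 H.1.1 := by
        refine sum_le_sum fun H _ => ?_
        rw [Matrix.sub_apply, Matrix.one_apply]
        refine (abs_gram_sub_one_apply_le P h𝒢 G H).trans ?_
        rw [mul_assoc, ← pow_succ']
        -- Since 2 max(d, 1) ≥ d + 1, one factor `eps` is kept in front and `eps` ^ d is left to be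
        -- summed.
        exact mul_le_mul_of_nonneg_left (P.eps_pow_le (by omega)) (by norm_num)
    _ = 7 * eps D c * ∑ H : {G : 𝒢 // G.1.order ≤ n}, eps D c ^ editDist G.1.1 H.1.1 :=
        (mul_sum _ _ _).symm
    _ ≤ 7 * eps D c * ∑ H ∈ 𝒢, eps D c ^ editDist G.1.1 H := by
        gcongr
        rw [← sum_coe_sort 𝒢]
        rw [← sum_image (s := univ) (g := fun H : {G : 𝒢 // G.1.order ≤ n} => H.1)
          (f := fun H : 𝒢 => eps D c ^ editDist G.1.1 H.1) (Subtype.val_injective.injOn)]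
        exact sum_le_sum_of_subset_of_nonneg (subset_univ _) fun _ _ _ => by positivity
    _ ≤ 7 * eps D c * 3 := by
        gcongr
        exact sum_eps_pow_editDist_le P h𝒢.1 h𝒢.2.1 (h𝒢.1 _ G.1.2)
    _ = 21 * eps D c := by ring

theorem norm_gram_sub_one_le (P : Params n K D q lam c) (h𝒢 : IsMaximumCollection D 𝒢) :
    ‖Matrix.toEuclideanCLM (n := {G : 𝒢 // G.1.order ≤ n}) (𝕜 := ℝ)
        (gram n K q lam 𝒢 - 1)‖ ≤ 21 * eps D c := by
  refine norm_toEuclideanCLM_le_of_sum_abs_le _ (by have := P.eps_pos; positivity)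
    (sum_abs_gram_sub_one_le P h𝒢) fun H => ?_
  refine le_trans (le_of_eq (sum_congr rfl fun G _ => ?_)) (sum_abs_gram_sub_one_le P h𝒢 H)
  simp only [Matrix.sub_apply, Matrix.one_apply, gram_comm G H, eq_comm (a := G)]

end SBM

end

/-! ### The two bounds of the proposition -/

theorem mainTheorem7 (n K D : ℕ) (p q lam c : ℝ) (hlam : lam = p - q)
    (hK2 : 2 ≤ K) (hKn : K ≤ n) (hD : 2 ≤ D) (hc : 14 ≤ c)
    (hq0 : 0 < q) (hpq : q < p) (hp1 : p < 1) (hq : q ≤ 1 / 2) (hqlam : q + 2 * lam ≤ 1)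
    (hsignal : SBM.SignalCondition n K D q lam c)
    (𝒢 : Finset SBM.Template) (h𝒢 : SBM.Template.IsMaximumCollection D 𝒢) :
    (∀ G₁ G₂ : {G : 𝒢 // G.1.order ≤ n},
      |SBM.gram n K q lam 𝒢 G₁ G₂ - (if G₁ = G₂ then 1 else 0)| ≤
        3 * (D : ℝ) ^ (-(c * max (SBM.Template.editDist G₁.1.1 G₂.1.1 : ℝ) 1))) ∧
    ‖Matrix.toEuclideanCLM (n := {G : 𝒢 // G.1.order ≤ n}) (𝕜 := ℝ)
        (SBM.gram n K q lam 𝒢 - 1)‖ ≤ 6 * (D : ℝ) ^ (-(c / 2)) := by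
  have P : SBM.Params n K D q lam c :=
    ⟨hK2, hKn, hD, hc, hq0, by linarith, hq, hqlam, hsignal⟩
  have hD0 := P.D_pos.le
  have hε := P.eps_pos
  have hε14 := P.eps_le
  refine ⟨fun G H => ?_, ?_⟩
  · refine (SBM.abs_gram_sub_one_apply_le P h𝒢 G H).trans ?_
    set m := max (SBM.Template.editDist G.1.1 H.1.1) 1 with hm
    have h1 : (D : ℝ) ^ (-(c * max (SBM.Template.editDist G.1.1 H.1.1 : ℝ) 1)) =
        SBM.eps D c ^ m := by
      rw [SBM.eps, ← Real.rpow_mul_natCast hD0, hm]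
      congr 1
      push_cast
      ring
    have h2 : SBM.eps D c ^ m ≤ SBM.eps D c := by
      simpa using P.eps_pow_le (show 1 ≤ m from le_max_right _ _)
    -- One of the two factors ε^m is at most ε ≤ 2^(-14), which brings the constant from 7 below 3.
    rw [h1, two_mul, pow_add, ← mul_assoc]
    gcongr
    linarith
  · refine (SBM.norm_gram_sub_one_le P h𝒢).trans ?_
    have h1 : SBM.eps D c = ((D : ℝ) ^ (-(c / 2))) ^ 2 := by
      rw [SBM.eps, ← Real.rpow_mul_natCast hD0]
      congr 1
      push_cast
      ring
    -- With x = D^(-c/2) the bound obtained is 21 x², and x ≤ 2^(-7) brings it below 6 x.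
    have h0 : 0 < (D : ℝ) ^ (-(c / 2)) := Real.rpow_pos_of_pos P.D_pos _
    have h2 : (D : ℝ) ^ (-(c / 2)) ≤ 1 / 2 ^ 7 := by
      refine (sq_le_sq₀ (by positivity) (by positivity)).1 ?_
      rw [← h1]
      exact hε14.trans (by norm_num)
    rw [h1]
    nlinarith
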